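/- **Setting.** Let $\Omega\subset\mathbb R^2$ be a bounded polygonal domain with a conforming triangulation $\mathcal T_h$ (so $\Omega$ is the interior of the union of the finitely many closed triangles). Let $\Gamma\subset\Omega$ be a smooth simple closed curve, not touching $\partial\Omega$, which separates $\Omega$ into two open sets $\Omega^-$ and $\Omega^+$, that is, $\Omega\setminus\Gamma=\Omega^-\cup\Omega^+$ is a disjoint union and $\Gamma$ lies in the boundary of both. Let $\beta^\pm>0$ and $\mu^\pm>0$ be constants. A triangle $T\in\mathcal T_h$ is an *interface element* if $\Gamma$ meets its interior. Assume that for every interface element $T$ the curve $\Gamma$ meets $\partial T$ in exactly two points $D\neq E$, which lie on two different edges, that the chord $\Gamma_h^T=DE$ separates the vertices of $T$ adjacent to $T\cap\Omega^-$ from those adjacent to $T\cap\Omega^+$, and that $T$ has no obtuse angle. Let $T_h^\pm$ be the two parts into which the chord cuts $T$, with $T_h^\pm$ on the side of the vertices adjacent to $T\cap\Omega^\pm$, let $X_m$ be the midpoint of the chord, and let $\bar{\mathbf t},\bar{\mathbf n}$ be its unit tangential and normal vectors. For $\mathbf v=(v_1,v_2)$ put $\operatorname{curl}\mathbf v=\partial_{x_1}v_2-\partial_{x_2}v_1$.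 **Spaces.** $\widetilde H^2_0(\Omega)$ is the space of functions $v$ with $v|_{\Omega^\pm}\in H^2(\Omega^\pm)$ (identified with their continuous representatives), with $v=0$ on $\partial\Omega$, and with $v^+=v^-$ and $\beta^+\nabla v^+\cdot\mathbf n=\beta^-\nabla v^-\cdot\mathbf n$ on $\Gamma$. Let $\mathcal{ND}=\{\mathbf a+b(x_2,-x_1)^t:\mathbf a\in\mathbb R^2,\ b\in\mathbb R\}$. If $T$ is not an interface element, then $\mathcal{IND}_h(T)=\mathcal{ND}|_T$ and $\widetilde S_h(T)=\mathbb P_1(T)$. If $T$ is an interface element, then $\mathcal{IND}_h(T)$ consists of the fields that equal $\mathbf z^\pm\in\mathcal{ND}$ on $T_h^\pm$, where at $X_m$ $$\mathbf z^+\cdot\bar{\mathbf t}=\mathbf z^-\cdot\bar{\mathbf t},\qquad \tfrac1{\mu^+}\operatorname{curl}\mathbf z^+=\tfrac1{\mu^-}\operatorname{curl}\mathbf z^-,\qquad \beta^+\mathbf z^+\cdot\bar{\mathbf n}=\beta^-\mathbf z^-\cdot\bar{\mathbf n},$$ and $\widetilde S_h(T)$ consists of the functions that equal $z^\pm\in\mathbb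 P_1$ on $T_h^\pm$, where $z^+=z^-$ and $\beta^+\nabla z^+\cdot\bar{\mathbf n}=\beta^-\nabla z^-\cdot\bar{\mathbf n}$ on $\Gamma_h^T$. $\widetilde S_h(\Omega)$ is the space of functions that are piecewise in $\widetilde S_h(T)$ and continuous at the mesh nodes, and $\mathcal{IND}_h(\Omega)$ is the space of fields $\mathbf z$ that are piecewise in $\mathcal{IND}_h(T)$ with $\int_e[\mathbf z\cdot\mathbf t]_e\,ds=0$ on every interior edge $e$. The subspaces with zero trace, respectively zero tangential trace, on $\partial\Omega$ are $\widetilde S_{h,0}(\Omega)$ and $\mathcal{IND}_{h,0}(\Omega)$. **Interpolations.** $\tilde I_hv\in\widetilde S_h(\Omega)$ is the function with $\tilde I_hv(A)=v(A)$ at every mesh node $A$, and $\widetilde\Pi_h\mathbf u\in\mathcal{IND}_h(\Omega)$ is the field with $\int_e\widetilde\Pi_h\mathbf u\cdot\mathbf t\,ds=\int_e\mathbf u\cdot\mathbf t\,ds$ for every mesh edge $e$, where $\mathbf u\cdot\mathbf t$ on $e$ is the tangential trace of $\mathbf u$. **Claim.** For every $v\in\widetilde H^2_0(\Omega)$ the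 interpolants $\tilde I_hv$ and $\widetilde\Pi_h(\nabla v)$ exist and are unique, they belong to $\widetilde S_{h,0}(\Omega)$ and $\mathcal{IND}_{h,0}(\Omega)$, respectively, and, with the gradient on the right taken on each triangle (on each part $T_h^\pm$ of an interface element), $$\widetilde\Pi_h(\nabla v)=\nabla(\tilde I_hv).$$ -/

import Mathlib

namespace IFE

open MeasureTheory Set
open scoped ContDiff

noncomputable section

/-- The Euclidean plane. -/
abbrev Plane : Type := EuclideanSpace ℝ (Fin 2)

/-! ### Weak derivatives and Sobolev spaces -/

/-- The `j`-th partial derivative of `f` at `x`. -/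
def pd {F : Type*} [NormedAddCommGroup F] [NormedSpace ℝ F] (j : Fin 2) (f : Plane → F)
    (x : Plane) : F :=
  fderiv ℝ f x (EuclideanSpace.single j 1)

/-- Smooth compactly supported functions on the plane. -/
def IsTest (φ : Plane → ℝ) : Prop := ContDiff ℝ ∞ φ ∧ HasCompactSupport φ

/-- `g` is the weak partial derivative `∂_j f` in the open set `U`. -/
structure HasWeakPartial (U : Set Plane) (j : Fin 2) (f g : Plane → ℝ) : Prop where
  locInt : LocallyIntegrableOn f U
  locInt' : LocallyIntegrableOn g U
  eq : ∀ φ, IsTest φ → tsupport φ ⊆ U → ∫ x in U, f x * pd j φ x = -∫ x in U, g x * φ x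

/-- `G` is the weak gradient of `f` in `U`. -/
def HasWeakGrad (U : Set Plane) (f : Plane → ℝ) (G : Plane → Plane) : Prop :=
  ∀ j, HasWeakPartial U j f fun x => G x j

/-- `c` is the weak (scalar) curl `∂₁ u₂ - ∂₂ u₁` of `u` in `U`. -/
structure HasWeakCurl (U : Set Plane) (u : Plane → Plane) (c : Plane → ℝ) : Prop where
  locInt : LocallyIntegrableOn u U
  locInt' : LocallyIntegrableOn c U
  eq : ∀ φ, IsTest φ → tsupport φ ⊆ U →
    ∫ x in U, (u x 1 * pd 0 φ x - u x 0 * pd 1 φ x) = -∫ x in U, c x * φ x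

/-- `d` is the weak divergence of `u` in `U`. -/
structure HasWeakDiv (U : Set Plane) (u : Plane → Plane) (d : Plane → ℝ) : Prop where
  locInt : LocallyIntegrableOn u U
  locInt' : LocallyIntegrableOn d U
  eq : ∀ φ, IsTest φ → tsupport φ ⊆ U →
    ∫ x in U, (u x 0 * pd 0 φ x + u x 1 * pd 1 φ x) = -∫ x in U, d x * φ x

/-- The Sobolev space `H¹(U)`. -/
def MemH1 (U : Set Plane) (f : Plane → ℝ) : Prop :=
  MemLp f 2 (volume.restrict U) ∧
    ∀ j, ∃ g, MemLp g 2 (volume.restrict U) ∧ HasWeakPartial U j f g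

/-- The Sobolev space `H²(U)`. -/
def MemH2 (U : Set Plane) (f : Plane → ℝ) : Prop :=
  MemLp f 2 (volume.restrict U) ∧ ∀ j, ∃ g, MemH1 U g ∧ HasWeakPartial U j f g

/-! ### Triangulations -/

/-- A conforming triangulation; `A i k` is the `k`-th vertex of the `i`-th triangle. Two triangles
meet in a common edge, a common vertex, or not at all. -/
structure Mesh (ι : Type*) where
  A : ι → Fin 3 → Plane
  affineIndep : ∀ i, AffineIndependent ℝ (A i)
  injective : Function.Injective fun i => range (A i)
  conforming : ∀ i j, convexHull ℝ (range (A i)) ∩ convexHull ℝ (range (A j)) =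
    convexHull ℝ (range (A i) ∩ range (A j))

variable {ι : Type*}

/-- The `i`-th closed triangle `T`. -/
def Mesh.tri (M : Mesh ι) (i : ι) : Set Plane := convexHull ℝ (range (M.A i))

/-- The edge of the `i`-th triangle opposite to its `k`-th vertex. -/
def Mesh.edge (M : Mesh ι) (i : ι) (k : Fin 3) : Set Plane :=
  segment ℝ (M.A i (k + 1)) (M.A i (k + 2))

/-- The polygonal domain `Ω` that is triangulated. -/
def Mesh.domain (M : Mesh ι) : Set Plane := interior (⋃ i, M.tri i)

/-- No angle of the `i`-th triangle exceeds `π / 2`. -/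
def Mesh.NonObtuse (M : Mesh ι) (i : ι) : Prop :=
  ∀ k : Fin 3, 0 ≤ inner ℝ (M.A i (k + 1) - M.A i k) (M.A i (k + 2) - M.A i k)

/-! ### The interface and the way it cuts the mesh -/

/-- A smooth simple closed curve `Γ`, parametrized by the `1`-periodic `γ`, which stays away from
`∂Ω` and separates `Ω` into `Ω⁻` and `Ω⁺`. A triangle whose interior meets `Γ` is an interface
element; `Γ` meets the boundary of such an element `T` in exactly two points `D ≠ E` on two
different edges, and the chord `DE` (which approximates `Γ ∩ T`) cuts `T` into `T_h⁻` and `T_h⁺`.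
The unit normal `n` of the chord points from the side of `T_h⁻` to the side of `T_h⁺`: the vertices
of `T` adjacent to `T ∩ Ω⁻` lie on the former, those adjacent to `T ∩ Ω⁺` on the latter.
The values of `D`, `E`, `n` on the other triangles play no role. -/
structure Interface (M : Mesh ι) where
  γ : ℝ → Plane
  smooth : ContDiff ℝ ∞ γ
  regular : ∀ t, deriv γ t ≠ 0
  periodic : Function.Periodic γ 1
  simple : InjOn γ (Ico 0 1)
  Ωm : Set Plane
  Ωp : Set Plane
  isOpen_m : IsOpen Ωm
  isOpen_p : IsOpen Ωp
  disjoint : Disjoint Ωm Ωp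
  subset_domain : range γ ⊆ M.domain
  union : Ωm ∪ Ωp = M.domain \ range γ
  frontier_m : range γ ⊆ frontier Ωm
  frontier_p : range γ ⊆ frontier Ωp
  D : ι → Plane
  E : ι → Plane
  n : ι → Plane
  ne : ∀ i, (range γ ∩ interior (M.tri i)).Nonempty → D i ≠ E i
  inter : ∀ i, (range γ ∩ interior (M.tri i)).Nonempty →
    range γ ∩ frontier (M.tri i) = {D i, E i}
  edges : ∀ i, (range γ ∩ interior (M.tri i)).Nonempty →
    ∃ k l, k ≠ l ∧ D i ∈ M.edge i k ∧ E i ∈ M.edge i l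
  unit : ∀ i, (range γ ∩ interior (M.tri i)).Nonempty → ‖n i‖ = 1
  normal : ∀ i, (range γ ∩ interior (M.tri i)).Nonempty → inner ℝ (E i - D i) (n i) = 0
  side_m : ∀ i, (range γ ∩ interior (M.tri i)).Nonempty → ∀ k,
    M.A i k ∈ closure (interior (M.tri i) ∩ Ωm) → inner ℝ (M.A i k - D i) (n i) ≤ 0
  side_p : ∀ i, (range γ ∩ interior (M.tri i)).Nonempty → ∀ k,
    M.A i k ∈ closure (interior (M.tri i) ∩ Ωp) → 0 ≤ inner ℝ (M.A i k - D i) (n i)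

variable {M : Mesh ι}

/-- The interface `Γ`. -/
def Interface.curve (S : Interface M) : Set Plane := range S.γ

/-- The `i`-th triangle is an interface element. -/
def Interface.IsCut (S : Interface M) (i : ι) : Prop :=
  (S.curve ∩ interior (M.tri i)).Nonempty

/-- The midpoint `X_m` of the chord. -/
def Interface.mid (S : Interface M) (i : ι) : Plane := midpoint ℝ (S.D i) (S.E i)

/-- Signed distance from the chord, negative in `T_h⁻` and positive in `T_h⁺`. -/
def Interface.level (S : Interface M) (i : ι) (x : Plane) : ℝ := inner ℝ (x - S.D i) (S.n i)

/-- `f` is `fm` on `T_h⁻` (with the chord), `fp` on `T_h⁺`, and it is extended by zero outside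
the triangle `T`. -/
def Interface.IsGlued {F : Type*} [Zero F] (S : Interface M) (i : ι) (fm fp f : Plane → F) :
    Prop :=
  (∀ x ∈ M.tri i, S.level i x ≤ 0 → f x = fm x) ∧
  (∀ x ∈ M.tri i, 0 < S.level i x → f x = fp x) ∧
  (∀ x ∉ M.tri i, f x = 0)

/-! ### The broken space of scalar functions -/

/-- The space of functions that are `H²` on `Ω⁻` and on `Ω⁺`, vanish on `∂Ω`, and satisfy
`v⁺ = v⁻` and `β⁺ ∇v⁺ · n = β⁻ ∇v⁻ · n` on `Γ`. Functions in `H²` of the two subdomains are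
identified with their continuous representatives, so that the first jump condition says that `v`
is continuous on `closure Ω`, and the boundary condition is pointwise. The normal traces of
`∇v⁻` and `∇v⁺` on `Γ` are given by Green's formula: the pairing of the outward normal trace of
`G` from `U` with `φ` is `∫_U (G · ∇φ + (div G) φ)`; the outward normals of `Ω⁻` and `Ω⁺` on `Γ`
are opposite. -/
structure Interface.MemH2Zero (S : Interface M) (βm βp : ℝ) (v : Plane → ℝ) : Prop where
  cont : ContinuousOn v (closure M.domain)
  zero : ∀ x ∈ frontier M.domain, v x = 0
  memH2_m : MemH2 S.Ωm v
  memH2_p : MemH2 S.Ωp v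
  flux : ∃ (G : Plane → Plane) (d : Plane → ℝ),
    MemLp G 2 (volume.restrict (S.Ωm ∪ S.Ωp)) ∧ MemLp d 2 (volume.restrict (S.Ωm ∪ S.Ωp)) ∧
    HasWeakGrad (S.Ωm ∪ S.Ωp) v G ∧ HasWeakDiv (S.Ωm ∪ S.Ωp) G d ∧
    ∀ φ, IsTest φ → tsupport φ ⊆ M.domain →
      βm * (∫ x in S.Ωm, (G x 0 * pd 0 φ x + G x 1 * pd 1 φ x + d x * φ x)) +
      βp * (∫ x in S.Ωp, (G x 0 * pd 0 φ x + G x 1 * pd 1 φ x + d x * φ x)) = 0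

/-! ### Edge integrals of tangential components -/

/-- `∫_e u · t ds` over the segment `e` from `P` to `Q`, with `t` oriented from `P` to `Q`. -/
def lineInt (P Q : Plane) (u : Plane → Plane) : ℝ :=
  ∫ s in (0 : ℝ)..1, inner ℝ (u (AffineMap.lineMap P Q s)) (Q - P)

/-- `a₁ b₂ - a₂ b₁`. -/
def cross (a b : Plane) : ℝ := a 0 * b 1 - a 1 * b 0

/-- `τ` is the tangential trace of `u` from within the `i`-th triangle `T` on the edge `PQ`
opposite to its vertex `R`: `τ s = u · (Q - P)` at `P + s (Q - P)`, in the sense of Green's formula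
`∫_{T ∖ Γ} ((curl u) φ + u₂ ∂₁φ - u₁ ∂₂φ) = ± ∫_{PQ} φ u · t ds` for test functions `φ` supported
away from the other two edges and from `Γ ∩ T`; the sign is `+` if `P, Q, R` is
counterclockwise. -/
def Interface.HasEdgeTrace (S : Interface M) (i : ι) (k : Fin 3) (u : Plane → Plane)
    (τ : ℝ → ℝ) : Prop :=
  IntervalIntegrable τ volume 0 1 ∧
  IntegrableOn u (interior (M.tri i) \ S.curve) ∧
  ∃ c : Plane → ℝ, IntegrableOn c (interior (M.tri i) \ S.curve) ∧
    HasWeakCurl (interior (M.tri i) \ S.curve) u c ∧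
    ∀ φ, IsTest φ →
      Disjoint (tsupport φ)
        (M.edge i (k + 1) ∪ M.edge i (k + 2) ∪ closure (S.curve ∩ interior (M.tri i))) →
      ∫ x in interior (M.tri i) \ S.curve,
          (c x * φ x + (u x 1 * pd 0 φ x - u x 0 * pd 1 φ x)) =
        Real.sign (cross (M.A i (k + 2) - M.A i (k + 1)) (M.A i k - M.A i (k + 1))) *
          ∫ s in (0 : ℝ)..1, τ s * φ (AffineMap.lineMap (M.A i (k + 1)) (M.A i (k + 2)) s)

/-- `∫_e u · t ds = I` for the `k`-th edge `e` of the `i`-th triangle, oriented from its vertex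
`k + 1` to its vertex `k + 2`, where `u · t` is the tangential trace. -/
def Interface.HasEdgeIntegral (S : Interface M) (i : ι) (k : Fin 3) (u : Plane → Plane)
    (I : ℝ) : Prop :=
  ∃ τ, S.HasEdgeTrace i k u τ ∧ ∫ s in (0 : ℝ)..1, τ s = I

/-! ### Immersed finite element spaces

Piecewise functions on the mesh are families, indexed by the triangles, of functions on the
triangles (extended by zero). -/

/-- Pointwise scalar curl. -/
def curl (u : Plane → Plane) (x : Plane) : ℝ := pd 0 u x 1 - pd 1 u x 0

/-- The lowest order Nédélec fields `a + b [x₂, -x₁]`. -/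
def IsND (u : Plane → Plane) : Prop :=
  ∃ (a : Plane) (b : ℝ), ∀ x, u x = a + b • !₂[x 1, -x 0]

/-- Affine functions. -/
def IsP1 (f : Plane → ℝ) : Prop := ∃ (c : ℝ) (g : Plane), ∀ x, f x = c + inner ℝ g x

/-- The local immersed Nédélec space. -/
def Interface.MemINDLoc (S : Interface M) (βm βp μm μp : ℝ) (i : ι) (z : Plane → Plane) : Prop :=
  (S.IsCut i → ∃ zm zp, IsND zm ∧ IsND zp ∧
    inner ℝ (zp (S.mid i)) (S.E i - S.D i) = inner ℝ (zm (S.mid i)) (S.E i - S.D i) ∧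
    μp⁻¹ * curl zp (S.mid i) = μm⁻¹ * curl zm (S.mid i) ∧
    βp * inner ℝ (zp (S.mid i)) (S.n i) = βm * inner ℝ (zm (S.mid i)) (S.n i) ∧
    S.IsGlued i zm zp z) ∧
  (¬ S.IsCut i → ∃ p, IsND p ∧ (∀ x ∈ M.tri i, z x = p x) ∧ ∀ x ∉ M.tri i, z x = 0)

/-- The local immersed linear space. -/
def Interface.MemSLoc (S : Interface M) (βm βp : ℝ) (i : ι) (w : Plane → ℝ) : Prop :=
  (S.IsCut i → ∃ wm wp, IsP1 wm ∧ IsP1 wp ∧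
    (∀ x ∈ segment ℝ (S.D i) (S.E i), wp x = wm x ∧
      βm * inner ℝ (gradient wm x) (S.n i) = βp * inner ℝ (gradient wp x) (S.n i)) ∧
    S.IsGlued i wm wp w) ∧
  (¬ S.IsCut i → ∃ p, IsP1 p ∧ (∀ x ∈ M.tri i, w x = p x) ∧ ∀ x ∉ M.tri i, w x = 0)

/-- The global immersed Nédélec space: on common edges of two triangles the integrals of the
tangential components agree. -/
def Interface.MemIND (S : Interface M) (βm βp μm μp : ℝ) (z : ι → Plane → Plane) : Prop :=
  (∀ i, S.MemINDLoc βm βp μm μp i (z i)) ∧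
  ∀ i j, ∀ P ∈ range (M.A i) ∩ range (M.A j), ∀ Q ∈ range (M.A i) ∩ range (M.A j),
    lineInt P Q (z i) = lineInt P Q (z j)

/-- The subspace with zero tangential trace on `∂Ω`. -/
def Interface.MemINDZero (S : Interface M) (βm βp μm μp : ℝ) (z : ι → Plane → Plane) : Prop :=
  S.MemIND βm βp μm μp z ∧
  ∀ i k, M.edge i k ⊆ frontier M.domain →
    ∀ x ∈ openSegment ℝ (M.A i (k + 1)) (M.A i (k + 2)),
    inner ℝ (z i x) (M.A i (k + 2) - M.A i (k + 1)) = 0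

/-- The global immersed linear space, continuous at the mesh nodes. -/
def Interface.MemS (S : Interface M) (βm βp : ℝ) (w : ι → Plane → ℝ) : Prop :=
  (∀ i, S.MemSLoc βm βp i (w i)) ∧
  ∀ i j, ∀ P ∈ range (M.A i) ∩ range (M.A j), w i P = w j P

/-- The subspace with zero trace on `∂Ω`. -/
def Interface.MemSZero (S : Interface M) (βm βp : ℝ) (w : ι → Plane → ℝ) : Prop :=
  S.MemS βm βp w ∧
  ∀ i k, M.edge i k ⊆ frontier M.domain → ∀ x ∈ M.edge i k, w i x = 0

/-- `w` is the nodal interpolant of `v`. -/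
def Interface.IsNodalInterp (S : Interface M) (βm βp : ℝ) (v : Plane → ℝ) (w : ι → Plane → ℝ) :
    Prop :=
  S.MemS βm βp w ∧ ∀ i k, w i (M.A i k) = v (M.A i k)

/-- `z` is the edge interpolant of `u`: `∫_e z · t ds = ∫_e u · t ds` for all edges `e`. -/
def Interface.IsEdgeInterp (S : Interface M) (βm βp μm μp : ℝ) (u : Plane → Plane)
    (z : ι → Plane → Plane) : Prop :=
  S.MemIND βm βp μm μp z ∧
  ∀ i k, S.HasEdgeIntegral i k u (lineInt (M.A i (k + 1)) (M.A i (k + 2)) (z i))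

/-- `z` is the elementwise gradient of `w`, inside the triangles and off the chords. -/
def Interface.IsBrokenGrad (S : Interface M) (w : ι → Plane → ℝ) (z : ι → Plane → Plane) : Prop :=
  ∀ i, ∀ x ∈ interior (M.tri i), (S.IsCut i → S.level i x ≠ 0) → HasGradientAt (w i) (z i x) x

end

end IFE

/-!
On every triangle, the curl-free fields in the immersed Nédélec space are the gradients of the
immersed linear functions. The circulation of a field in that space around the triangle is a nonzero
multiple of its curl coordinate, so a field without circulation is such a gradient. The function `v`
is absolutely continuous along the edges, and the edge integrals of `∇v` are the differences of its
vertex values. Hence all circulations vanish, and the edge interpolant of `∇v` is the gradient of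
the nodal interpolant of `v`.

Nodal values determine an immersed linear function because `1 + ρ ⟨p, n⟩ > 0`, where
`ρ = β⁻ / β⁺ - 1 > -1` and `p` is the gradient of the linear interpolant of the positive part of the
signed distance from the chord. Indeed `p - n` is the gradient of the interpolant of its negative
part, and `⟨p, p - n⟩ ≤ 0` in a triangle without obtuse angle, whence `0 ≤ ⟨p, n⟩ ≤ 1`.

On the two sides of `Γ` only, `v` is `H²`. Every point of an edge is nevertheless the vertex of a
sector off `Γ` one of whose sides lies on the edge, even if `Γ` touches the edge there, and in such
a sector integration of the mixed weak derivative across it makes `v` absolutely continuous along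
the side. For the trace defined by Green's formula, the curl-free field `∇v` is paired with a test
function that is cut off at distance `r` from the edge, and `r` tends to zero.
-/

namespace IFE

open MeasureTheory Set Filter Topology
open scoped ContDiff InnerProductSpace

noncomputable section

/-! ### Triangles in the plane -/

section PlaneGeometry

variable {d n : Plane}

lemma inner_eq_coords (x y : Plane) : ⟪x, y⟫_ℝ = x 0 * y 0 + x 1 * y 1 := by
  simp [PiLp.inner_apply, Fin.sum_univ_two, mul_comm]

lemma plane_ext {x y : Plane} (h0 : x 0 = y 0) (h1 : x 1 = y 1) : x = y := by
  ext i
  fin_cases i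
  exacts [h0, h1]

lemma cross_smul_eq (a b x : Plane) : cross a b • x = cross x b • a + cross a x • b := by
  apply plane_ext <;> simp only [cross, PiLp.smul_apply, PiLp.add_apply, smul_eq_mul] <;> ring

lemma inner_self_mul_inner_self (x y : Plane) :
    ⟪x, x⟫_ℝ * ⟪y, y⟫_ℝ = ⟪x, y⟫_ℝ ^ 2 + cross x y ^ 2 := by
  simp only [inner_eq_coords, cross]
  ring

lemma eq_zero_of_inner_eq_zero {r : Plane} (hdn : cross d n ≠ 0) (hd : ⟪d, r⟫_ℝ = 0)
    (hn : ⟪n, r⟫_ℝ = 0) : r = 0 := by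
  rw [inner_eq_coords] at hd hn
  have h0 : cross d n * r 0 = 0 := by rw [cross]; linear_combination n 1 * hd - d 1 * hn
  have h1 : cross d n * r 1 = 0 := by rw [cross]; linear_combination d 0 * hn - n 0 * hd
  exact plane_ext ((mul_eq_zero.1 h0).resolve_left hdn) ((mul_eq_zero.1 h1).resolve_left hdn)

lemma eq_inner_smul_of_inner_eq_zero {a : Plane} (hd : d ≠ 0) (hn : ‖n‖ = 1)
    (hdn : ⟪d, n⟫_ℝ = 0) (hda : ⟪d, a⟫_ℝ = 0) : a = ⟪a, n⟫_ℝ • n := by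
  have hnn : ⟪n, n⟫_ℝ = 1 := by rw [real_inner_self_eq_norm_sq, hn, one_pow]
  have hcross : cross d n ≠ 0 := fun h => by
    have h_sq := inner_self_mul_inner_self d n
    rw [h, hdn, hnn] at h_sq
    exact hd (by simpa using h_sq)
  refine sub_eq_zero.1 (eq_zero_of_inner_eq_zero hcross ?_ ?_)
  · rw [inner_sub_right, real_inner_smul_right, hda, hdn, mul_zero, sub_zero]
  · rw [inner_sub_right, real_inner_smul_right, hnn, mul_one, real_inner_comm, sub_self]

lemma fin_three_eq_or : ∀ j k : Fin 3, j = k ∨ j = k + 1 ∨ j = k + 2 := by decide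

lemma fin_three_add : ∀ k : Fin 3,
    k + 1 + 1 = k + 2 ∧ k + 1 + 2 = k ∧ k + 2 + 1 = k ∧ k + 2 + 2 = k + 1 := by decide

lemma sum_fin_three {F : Type*} [AddCommMonoid F] (f : Fin 3 → F) (k : Fin 3) :
    ∑ j, f j = f k + f (k + 1) + f (k + 2) := by
  have h : ∑ j, f (k + j) = ∑ j, f j := Equiv.sum_comp (Equiv.addLeft k) f
  rw [← h, Fin.sum_univ_three, add_zero]

lemma affineMap_vertex_add (f : Plane →ᵃ[ℝ] ℝ) (x y z : Plane) (s t : ℝ) :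
    f (x + s • (y - x) + t • (z - x)) = f x + s * (f y - f x) + t * (f z - f x) := by
  have h : ∀ u v : Plane, f (u + v) = f u + f.linear v := fun u v => by
    rw [add_comm, ← vadd_eq_add, f.map_vadd, vadd_eq_add, add_comm]
  have h_sub : ∀ u v : Plane, f.linear (u - v) = f u - f v := fun u v =>
    f.linearMap_vsub u v
  rw [h, h, map_smul, map_smul, h_sub, h_sub, smul_eq_mul, smul_eq_mul]

variable (T : AffineBasis (Fin 3) ℝ Plane)

/-- Twice the area of the triangle with vertices `A`, positive if these are counterclockwise. -/
def twiceArea (A : Fin 3 → Plane) : ℝ := cross (A 1 - A 0) (A 2 - A 0)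

lemma cross_edges (A : Fin 3 → Plane) (k : Fin 3) :
    cross (A (k + 2) - A (k + 1)) (A k - A (k + 1)) = twiceArea A := by
  fin_cases k <;> simp [twiceArea, cross] <;> ring

lemma cross_sub_vertices (k : Fin 3) (x : Plane) :
    cross (T (k + 1) - x) (T (k + 2) - x) = twiceArea T * T.coord k x := by
  have h_sum := T.sum_coord_apply_eq_one x
  have hx := T.linear_combination_coord_eq_self x
  rw [sum_fin_three _ k] at h_sum hx
  have hx0 := congrArg (· 0) hx
  have hx1 := congrArg (· 1) hx
  simp only [PiLp.add_apply, PiLp.smul_apply, smul_eq_mul] at hx0 hx1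
  rw [← cross_edges T k]
  obtain h : T.coord k x = 1 - T.coord (k + 1) x - T.coord (k + 2) x := by linarith
  rw [h] at hx0 hx1 ⊢
  simp only [cross, PiLp.sub_apply, ← hx0, ← hx1]
  ring

lemma twiceArea_ne_zero : twiceArea T ≠ 0 := fun h => by
  have h_lin : (T.coord 1).linear (T 1 - T 0) = 1 ∧ (T.coord 1).linear (T 2 - T 0) = 0 := by
    constructor <;> refine ((T.coord 1).linearMap_vsub _ _).trans ?_ <;> simp
  have h_cross : ∀ u, cross u (T 2 - T 0) = 0 := fun u => by
    have h_coord := congrArg (T.coord 1).linear (cross_smul_eq (T 1 - T 0) (T 2 - T 0) u)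
    rw [← twiceArea, h, zero_smul, map_zero, map_add, map_smul, map_smul, h_lin.1,
      h_lin.2] at h_coord
    simpa using h_coord.symm
  have h_eq : T 2 - T 0 = 0 := by
    refine plane_ext (neg_eq_zero.1 ?_) (?_ : _ = (0 : ℝ))
    · simpa only [cross, PiLp.single_apply, Fin.isValue, zero_ne_one, if_true, if_false, zero_mul,
        one_mul, zero_sub] using h_cross (EuclideanSpace.single 1 1)
    · simpa only [cross, PiLp.single_apply, Fin.isValue, one_ne_zero, if_true, if_false, zero_mul,
        one_mul, sub_zero] using h_cross (EuclideanSpace.single 0 1)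
  exact absurd (T.ind.injective (sub_eq_zero.1 h_eq)) (by decide)

lemma cross_edges_ne_zero (k : Fin 3) :
    cross (T (k + 2) - T (k + 1)) (T k - T (k + 1)) ≠ 0 := by
  rw [cross_edges]
  exact twiceArea_ne_zero T

lemma twiceArea_sq_mul_inner (A : Fin 3 → Plane) (p q : Plane) :
    twiceArea A ^ 2 * ⟪p, q⟫_ℝ = ∑ k : Fin 3, ⟪A (k + 1) - A k, A (k + 2) - A k⟫_ℝ *
      (⟪p, A (k + 1) - A (k + 2)⟫_ℝ * ⟪q, A (k + 1) - A (k + 2)⟫_ℝ) := by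
  simp [Fin.sum_univ_three, inner_eq_coords, twiceArea, cross]
  ring

end PlaneGeometry

namespace Mesh

variable {ι : Type*} (M : Mesh ι)

/-- The vertices of the `i`-th triangle as an affine basis, whose coordinates are the barycentric
coordinates. -/
def basis (i : ι) : AffineBasis (Fin 3) ℝ Plane where
  toFun := M.A i
  ind' := M.affineIndep i
  tot' := (M.affineIndep i).affineSpan_eq_top_iff_card_eq_finrank_add_one.2 (by simp)

@[simp] lemma coe_basis (i : ι) : ⇑(M.basis i) = M.A i := rfl

lemma mem_tri_iff {i : ι} {x : Plane} : x ∈ M.tri i ↔ ∀ k, 0 ≤ (M.basis i).coord k x :=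
  Set.ext_iff.1 (M.basis i).convexHull_eq_nonneg_coord x

lemma mem_interior_tri_iff {i : ι} {x : Plane} :
    x ∈ interior (M.tri i) ↔ ∀ k, 0 < (M.basis i).coord k x :=
  Set.ext_iff.1 (M.basis i).interior_convexHull x

lemma interior_tri_nonempty (i : ι) : (interior (M.tri i)).Nonempty :=
  ⟨_, (M.basis i).centroid_mem_interior_convexHull⟩

lemma vertex_mem_tri (i : ι) (k : Fin 3) : M.A i k ∈ M.tri i :=
  subset_convexHull ℝ _ (mem_range_self k)

variable {M} in
lemma segment_subset_tri {i : ι} {P Q : Plane} (hP : P ∈ range (M.A i))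
    (hQ : Q ∈ range (M.A i)) : segment ℝ P Q ⊆ M.tri i :=
  segment_subset_convexHull hP hQ

lemma edge_subset_tri (i : ι) (k : Fin 3) : M.edge i k ⊆ M.tri i :=
  segment_subset_tri (mem_range_self _) (mem_range_self _)

end Mesh

/-! ### Unisolvence of the immersed linear element -/

section Interpolation

variable {E κ : Type*} [NormedAddCommGroup E] [InnerProductSpace ℝ E] [Finite κ]

lemma affine_eq_zero_of_vertices (T : AffineBasis κ ℝ E) {c : ℝ} {g : E}
    (h : ∀ k, c + ⟪g, T k⟫_ℝ = 0) : c = 0 ∧ g = 0 := by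
  cases nonempty_fintype κ
  have h_all : ∀ x, c + ⟪g, x⟫_ℝ = 0 := fun x => by
    calc c + ⟪g, x⟫_ℝ = (∑ k, T.coord k x) * c + ⟪g, ∑ k, T.coord k x • T k⟫_ℝ := by
          rw [T.sum_coord_apply_eq_one, T.linear_combination_coord_eq_self, one_mul]
      _ = ∑ k, T.coord k x * (c + ⟪g, T k⟫_ℝ) := by
          simp only [inner_sum, real_inner_smul_right, Finset.sum_mul, mul_add,
            Finset.sum_add_distrib]
      _ = 0 := by simp only [h, mul_zero, Finset.sum_const_zero]
  have hc : c = 0 := by simpa using h_all 0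
  exact ⟨hc, by simpa [hc] using h_all g⟩

lemma exists_affine_interp [FiniteDimensional ℝ E] (T : AffineBasis κ ℝ E) (V : κ → ℝ) :
    ∃ (c : ℝ) (g : E), ∀ k, c + ⟪g, T k⟫_ℝ = V k := by
  cases nonempty_fintype κ
  let f : E →ᵃ[ℝ] ℝ := (Fintype.linearCombination ℝ V).toAffineMap.comp T.coords
  refine ⟨f 0, (InnerProductSpace.toDual ℝ E).symm f.linear.toContinuousLinearMap, fun k => ?_⟩
  have hf : f (T k) = V k := by
    classical simp [f, Fintype.linearCombination_apply, AffineBasis.coord_apply]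
  rw [InnerProductSpace.toDual_symm_apply, ← hf, f.decomp]
  simp [add_comm]

/-- The gradient on the positive side of a line (or hyperplane) with unit normal `n`, for a
function which has the gradient `g` on the negative side and is continuous: only the normal
component is changed, from `⟪g, n⟫` to `(1 + ρ) ⟪g, n⟫`. -/
def refract (n : E) (ρ : ℝ) (g : E) : E := g + (ρ * ⟪g, n⟫_ℝ) • n

/-- The continuous function, affine on both sides of the hyperplane through `D` with normal `n`,
whose gradient is `g` on the negative and `refract n ρ g` on the positive side. -/
def pwLin (D n : E) (ρ c : ℝ) (g x : E) : ℝ := c + ⟪g, x⟫_ℝ + ρ * ⟪g, n⟫_ℝ * (⟪x - D, n⟫_ℝ)⁺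

variable {D n g p q x : E} {ρ a c : ℝ}

lemma pwLin_of_nonpos (h : ⟪x - D, n⟫_ℝ ≤ 0) : pwLin D n ρ c g x = c + ⟪g, x⟫_ℝ := by
  rw [pwLin, posPart_of_nonpos h, mul_zero, add_zero]

lemma pwLin_of_nonneg (h : 0 ≤ ⟪x - D, n⟫_ℝ) :
    pwLin D n ρ c g x = c - ρ * ⟪g, n⟫_ℝ * ⟪D, n⟫_ℝ + ⟪refract n ρ g, x⟫_ℝ := by
  rw [pwLin, posPart_of_nonneg h, refract, inner_add_left, real_inner_smul_left, inner_sub_left,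
    real_inner_comm n x]
  ring

lemma existsUnique_pwLin_interp [FiniteDimensional ℝ E] (T : AffineBasis κ ℝ E)
    (hp : ∀ k, a + ⟪p, T k⟫_ℝ = (⟪T k - D, n⟫_ℝ)⁺)
    (hρ : 1 + ρ * ⟪p, n⟫_ℝ ≠ 0) (V : κ → ℝ) :
    ∃! f : ℝ × E, ∀ k, pwLin D n ρ f.1 f.2 (T k) = V k := by
  have hpw : ∀ (f : ℝ × E) k, pwLin D n ρ f.1 f.2 (T k) =
      (f.1 + ρ * ⟪f.2, n⟫_ℝ * a) + ⟪f.2 + (ρ * ⟪f.2, n⟫_ℝ) • p, T k⟫_ℝ := fun f k => by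
    rw [pwLin, ← hp k, inner_add_left, real_inner_smul_left]
    ring
  obtain ⟨b, q, hq⟩ := exists_affine_interp T V
  have hsolve : ∀ g : E, g + (ρ * ⟪g, n⟫_ℝ) • p = q →
      ⟪g, n⟫_ℝ = ⟪q, n⟫_ℝ / (1 + ρ * ⟪p, n⟫_ℝ) := fun g hg => by
    rw [eq_div_iff hρ, ← hg, inner_add_left, real_inner_smul_left]
    ring
  set m := ⟪q, n⟫_ℝ / (1 + ρ * ⟪p, n⟫_ℝ) with hm
  refine ⟨(b - ρ * m * a, q - (ρ * m) • p), fun k => ?_, ?_⟩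
  · have hgn : ⟪q - (ρ * m) • p, n⟫_ℝ = m := by
      rw [inner_sub_left, real_inner_smul_left, hm]
      field_simp
      ring
    rw [hpw, hgn, sub_add_cancel, sub_add_cancel, hq]
  · rintro ⟨c, g⟩ hcg
    obtain ⟨hc, hg⟩ := affine_eq_zero_of_vertices T (c := c + ρ * ⟪g, n⟫_ℝ * a - b)
      (g := g + (ρ * ⟪g, n⟫_ℝ) • p - q) fun k => by
        rw [inner_sub_left]
        linear_combination (hpw (c, g) k).symm.trans (hcg k) - hq k
    rw [sub_eq_zero] at hc hg
    rw [hsolve g hg] at hc hg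
    rw [← hc, ← hg, add_sub_cancel_right, add_sub_cancel_right]

lemma inner_mem_Icc_of_sub_eq (hn : ‖n‖ = 1) (hpq : p - q = n) (h : ⟪p, q⟫_ℝ ≤ 0) :
    ⟪p, n⟫_ℝ ∈ Icc 0 1 := by
  have hnn : ⟪p - q, n⟫_ℝ = 1 := by rw [hpq, real_inner_self_eq_norm_sq, hn, one_pow]
  have hp : ⟪p, n⟫_ℝ = ⟪p, p⟫_ℝ - ⟪p, q⟫_ℝ := by rw [← hpq, inner_sub_right]
  have hq : ⟪q, n⟫_ℝ = ⟪p, q⟫_ℝ - ⟪q, q⟫_ℝ := by rw [← hpq, inner_sub_right, real_inner_comm]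
  rw [inner_sub_left] at hnn
  have hpp : 0 ≤ ⟪p, p⟫_ℝ := real_inner_self_nonneg
  have hqq : 0 ≤ ⟪q, q⟫_ℝ := real_inner_self_nonneg
  constructor <;> linarith

lemma posPart_sub_mul_negPart_sub_nonpos (a b : ℝ) : (a⁺ - b⁺) * (a⁻ - b⁻) ≤ 0 := by
  rcases le_total 0 a with ha | ha <;> rcases le_total 0 b with hb | hb <;>
    simp only [posPart_of_nonneg, posPart_of_nonpos, negPart_of_nonneg, negPart_of_nonpos, ha, hb]
  all_goals nlinarith

end Interpolation

section NonObtuse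

variable {D n p : Plane} {a ρ : ℝ}

lemma inner_posPart_interp_mem_Icc (T : AffineBasis (Fin 3) ℝ Plane)
    (hT : ∀ k : Fin 3, 0 ≤ ⟪T (k + 1) - T k, T (k + 2) - T k⟫_ℝ) (hn : ‖n‖ = 1)
    (hp : ∀ k, a + ⟪p, T k⟫_ℝ = (⟪T k - D, n⟫_ℝ)⁺) : ⟪p, n⟫_ℝ ∈ Icc 0 1 := by
  -- `p - n` is the gradient of the interpolant of the negative part.
  refine inner_mem_Icc_of_sub_eq (q := p - n) hn (sub_sub_cancel p n) ?_
  have hq : ∀ k, a + ⟪D, n⟫_ℝ + ⟪p - n, T k⟫_ℝ = (⟪T k - D, n⟫_ℝ)⁻ := fun k => by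
    have h := posPart_sub_negPart (⟪T k - D, n⟫_ℝ)
    rw [← hp k, inner_sub_left (T k), real_inner_comm n (T k)] at h
    rw [inner_sub_left, inner_sub_left (T k), real_inner_comm n (T k)]
    linarith
  have hneg : twiceArea T ^ 2 * ⟪p, p - n⟫_ℝ ≤ 0 := by
    rw [twiceArea_sq_mul_inner]
    refine Finset.sum_nonpos fun k _ => mul_nonpos_of_nonneg_of_nonpos (hT k) ?_
    have hp' : ⟪p, T (k + 1) - T (k + 2)⟫_ℝ =
        (⟪T (k + 1) - D, n⟫_ℝ)⁺ - (⟪T (k + 2) - D, n⟫_ℝ)⁺ := by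
      rw [← hp, ← hp, inner_sub_right, add_sub_add_left_eq_sub]
    have hq' : ⟪p - n, T (k + 1) - T (k + 2)⟫_ℝ =
        (⟪T (k + 1) - D, n⟫_ℝ)⁻ - (⟪T (k + 2) - D, n⟫_ℝ)⁻ := by
      rw [← hq, ← hq, inner_sub_right, add_sub_add_left_eq_sub]
    rw [hp', hq']
    exact posPart_sub_mul_negPart_sub_nonpos _ _
  exact nonpos_of_mul_nonpos_right hneg (sq_pos_of_ne_zero (twiceArea_ne_zero T))

lemma existsUnique_pwLin_interp_of_nonObtuse (T : AffineBasis (Fin 3) ℝ Plane)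
    (hT : ∀ k : Fin 3, 0 ≤ ⟪T (k + 1) - T k, T (k + 2) - T k⟫_ℝ) (hn : ‖n‖ = 1) (hρ : -1 < ρ)
    (V : Fin 3 → ℝ) : ∃! f : ℝ × Plane, ∀ k, pwLin D n ρ f.1 f.2 (T k) = V k := by
  obtain ⟨a, p, hp⟩ := exists_affine_interp T fun k => (⟪T k - D, n⟫_ℝ)⁺
  obtain ⟨hp0, hp1⟩ := inner_posPart_interp_mem_Icc T hT hn hp
  refine existsUnique_pwLin_interp T hp (ne_of_gt ?_) V
  rcases hp1.lt_or_eq with h_lt | h_eq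
  · nlinarith
  · rw [h_eq]
    linarith

lemma existsUnique_pwLin_interp_of_eq_zero (T : AffineBasis (Fin 3) ℝ Plane) (V : Fin 3 → ℝ) :
    ∃! f : ℝ × Plane, ∀ k, pwLin D n 0 f.1 f.2 (T k) = V k := by
  obtain ⟨a, p, hp⟩ := exists_affine_interp T fun k => (⟪T k - D, n⟫_ℝ)⁺
  exact existsUnique_pwLin_interp T hp (by norm_num) V

end NonObtuse

/-! ### The local immersed spaces in coordinates -/

section LocalFields

lemma inner_combo_sub {E : Type*} [NormedAddCommGroup E] [InnerProductSpace ℝ E]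
    (P Q D n : E) {a b : ℝ} (hab : a + b = 1) :
    ⟪a • P + b • Q - D, n⟫_ℝ = a * ⟪P - D, n⟫_ℝ + b * ⟪Q - D, n⟫_ℝ := by
  rw [← real_inner_smul_left, ← real_inner_smul_left, ← inner_add_left, smul_sub, smul_sub,
    sub_add_sub_comm, ← add_smul, hab, one_smul]

/-- The rotated position field `[x₂, -x₁]`, which spans the nonconstant Nédélec fields. -/
def rot : Plane →ₗ[ℝ] Plane where
  toFun x := !₂[x 1, -x 0]
  map_add' x y := by
    ext i
    fin_cases i <;> simp [add_comm]
  map_smul' r x := by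
    ext i
    fin_cases i <;> simp

lemma rot_apply (x : Plane) : rot x = !₂[x 1, -x 0] := rfl

/-- The field which is a Nédélec field on either side of the line through `D` with normal `n`;
its value at the centre `X` is `g` on the negative and `refract n ρ g` on the positive side, and
its curl jumps by the factor `ν`. -/
def pwND (X D n : Plane) (ρ ν : ℝ) (g : Plane) (b : ℝ) (x : Plane) : Plane :=
  if ⟪x - D, n⟫_ℝ ≤ 0 then g + b • rot (x - X) else refract n ρ g + (ν * b) • rot (x - X)

variable {d n g g' X : Plane}

lemma eq_refract_iff (hd : d ≠ 0) (hn : ‖n‖ = 1) (hdn : ⟪d, n⟫_ℝ = 0) {βm βp : ℝ} (hβp : βp ≠ 0) :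
    g' = refract n (βm / βp - 1) g ↔
      ⟪d, g'⟫_ℝ = ⟪d, g⟫_ℝ ∧ βp * ⟪g', n⟫_ℝ = βm * ⟪g, n⟫_ℝ := by
  constructor
  · rintro rfl
    have hnn : ⟪n, n⟫_ℝ = 1 := by rw [real_inner_self_eq_norm_sq, hn, one_pow]
    constructor
    · rw [refract, inner_add_right, real_inner_smul_right, hdn, mul_zero, add_zero]
    · rw [refract, inner_add_left, real_inner_smul_left, hnn]
      field_simp
      ring
  · rintro ⟨htan, hnor⟩
    have h_sub := eq_inner_smul_of_inner_eq_zero (a := g' - g) hd hn hdn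
      (by rw [inner_sub_right, htan, sub_self])
    have h_jump : ⟪g' - g, n⟫_ℝ = (βm / βp - 1) * ⟪g, n⟫_ℝ := by
      rw [inner_sub_left]
      field_simp
      linarith
    rw [refract, ← h_jump, ← h_sub, add_sub_cancel]

lemma hasGradientAt_affine (c : ℝ) (g x : Plane) :
    HasGradientAt (fun y => c + ⟪g, y⟫_ℝ) g x := by
  rw [hasGradientAt_iff_hasFDerivAt]
  exact ((InnerProductSpace.toDual ℝ Plane g).hasFDerivAt (x := x)).const_add c

lemma isND_iff_exists_centred (X : Plane) {u : Plane → Plane} :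
    IsND u ↔ ∃ (g : Plane) (b : ℝ), u = fun x => g + b • rot (x - X) := by
  constructor
  · rintro ⟨a, b, hu⟩
    refine ⟨a + b • rot X, b, funext fun x => ?_⟩
    rw [hu x, ← rot_apply, map_sub, smul_sub]
    abel
  · rintro ⟨g, b, rfl⟩
    refine ⟨g - b • rot X, b, fun x => ?_⟩
    simp only [← rot_apply, map_sub, smul_sub]
    abel

lemma curl_centred (X g : Plane) (b : ℝ) (x : Plane) :
    curl (fun y => g + b • rot (y - X)) x = -2 * b := by
  have h_rot : HasFDerivAt (fun y => rot (y - X)) rot.toContinuousLinearMap x :=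
    rot.toContinuousLinearMap.hasFDerivAt.comp x ((hasFDerivAt_id x).sub_const X)
  have h_deriv : HasFDerivAt (fun y => g + b • rot (y - X)) (b • rot.toContinuousLinearMap) x :=
    (h_rot.const_smul b).const_add g
  rw [curl, pd, pd, h_deriv.fderiv]
  simp only [smul_apply, LinearMap.coe_toContinuousLinearMap', rot_apply]
  simp
  ring

end LocalFields

lemma eq_indicator_iff {α F : Type*} [Zero F] {s : Set α} {f p : α → F} :
    f = s.indicator p ↔ (∀ x ∈ s, f x = p x) ∧ ∀ x ∉ s, f x = 0 := by
  constructor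
  · rintro rfl
    exact ⟨fun x hx => indicator_of_mem hx p, fun x hx => indicator_of_notMem hx p⟩
  · rintro ⟨h_on, h_off⟩
    funext x
    by_cases hx : x ∈ s
    · rw [h_on x hx, indicator_of_mem hx]
    · rw [h_off x hx, indicator_of_notMem hx]

namespace Interface

variable {ι : Type*} {M : Mesh ι} (S : Interface M) (βm βp μm μp : ℝ) (i : ι)

open Classical in
/-- The parameter `ρ` with which gradients are refracted at the chord; `0` in the elements which are
not cut. -/
def nJump : ℝ := if S.IsCut i then βm / βp - 1 else 0

open Classical in
/-- The ratio of the curls on the two sides of the chord; `1` in the elements which are not cut. -/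
def cRatio : ℝ := if S.IsCut i then μp / μm else 1

open Classical in
/-- The point about which the local Nédélec fields are expanded: the midpoint of the chord, or a
vertex in the elements which are not cut. -/
def centre : Plane := if S.IsCut i then S.mid i else M.A i 0

/-- The element of the local immersed linear space with coordinates `c` and `g`. -/
def locLin (c : ℝ) (g : Plane) : Plane → ℝ :=
  (M.tri i).indicator (pwLin (S.D i) (S.n i) (S.nJump βm βp i) c g)

/-- The element of the local immersed Nédélec space with coordinates `g` and `b`. -/
def locND (g : Plane) (b : ℝ) : Plane → Plane :=
  (M.tri i).indicator
    (pwND (S.centre i) (S.D i) (S.n i) (S.nJump βm βp i) (S.cRatio μm μp i) g b)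

variable {S βm βp μm μp i} {c : ℝ} {g x : Plane}

lemma nJump_of_isCut (h : S.IsCut i) : S.nJump βm βp i = βm / βp - 1 := if_pos h

lemma nJump_of_not_isCut (h : ¬ S.IsCut i) : S.nJump βm βp i = 0 := if_neg h

lemma neg_one_lt_nJump (hβm : 0 < βm) (hβp : 0 < βp) : -1 < S.nJump βm βp i := by
  rw [nJump]
  split_ifs
  · linarith [div_pos hβm hβp]
  · norm_num

lemma cRatio_pos (hμm : 0 < μm) (hμp : 0 < μp) : 0 < S.cRatio μm μp i := by
  rw [cRatio]
  split_ifs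
  exacts [div_pos hμp hμm, one_pos]

lemma centre_mem_tri : S.centre i ∈ M.tri i := by
  rw [centre]
  split_ifs with h
  · obtain ⟨k, l, -, hD, hE⟩ := S.edges i h
    exact (convex_convexHull ℝ _).midpoint_mem (M.edge_subset_tri i k hD) (M.edge_subset_tri i l hE)
  · exact M.vertex_mem_tri i 0

lemma locLin_of_mem (h : x ∈ M.tri i) :
    S.locLin βm βp i c g x = pwLin (S.D i) (S.n i) (S.nJump βm βp i) c g x :=
  indicator_of_mem h _

lemma isGlued_iff {F : Type*} [Zero F] {fm fp f : Plane → F} :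
    S.IsGlued i fm fp f ↔
      f = (M.tri i).indicator fun x => if ⟪x - S.D i, S.n i⟫_ℝ ≤ 0 then fm x else fp x := by
  rw [eq_indicator_iff, IsGlued, ← and_assoc, ← forall₂_and]
  refine and_congr_left' (forall₂_congr fun x _ => ?_)
  rw [level]
  split_ifs with h <;> simp [h, not_lt.2, not_le.1]

lemma inner_chord_eq_zero (h : S.IsCut i) (hx : x ∈ segment ℝ (S.D i) (S.E i)) :
    ⟪x - S.D i, S.n i⟫_ℝ = 0 := by
  obtain ⟨a, b, -, -, hab, rfl⟩ := hx
  rw [inner_combo_sub _ _ _ _ hab, sub_self, inner_zero_left, S.normal i h, mul_zero, mul_zero,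
    add_zero]

lemma memSLoc_iff_of_isCut (h : S.IsCut i) (hβp : βp ≠ 0) {w : Plane → ℝ} :
    S.MemSLoc βm βp i w ↔
      ∃ c g, w = (M.tri i).indicator (pwLin (S.D i) (S.n i) (βm / βp - 1) c g) := by
  have h_refract := fun g g' => eq_refract_iff (g := g) (g' := g') (βm := βm)
    (sub_ne_zero.2 (S.ne i h).symm) (S.unit i h) (S.normal i h) hβp
  have h_grad : ∀ (c : ℝ) g x, gradient (fun y => c + ⟪g, y⟫_ℝ) x = g := fun c g x =>
    (hasGradientAt_affine c g x).gradient
  simp only [MemSLoc, h, not_true, false_imp_iff, and_true, true_imp_iff, isGlued_iff]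
  constructor
  · rintro ⟨wm, wp, ⟨c, g, hm⟩, ⟨c', g', hp⟩, h_chord, rfl⟩
    obtain rfl : wm = fun x => c + ⟪g, x⟫_ℝ := funext hm
    obtain rfl : wp = fun x => c' + ⟪g', x⟫_ℝ := funext hp
    simp only [h_grad] at h_chord
    obtain ⟨hD, hβ⟩ := h_chord _ (left_mem_segment ℝ _ _)
    obtain ⟨hE, -⟩ := h_chord _ (right_mem_segment ℝ _ _)
    obtain rfl : g' = refract (S.n i) (βm / βp - 1) g := by
      refine (h_refract g g').2 ⟨?_, hβ.symm⟩
      rw [real_inner_comm g', real_inner_comm g, inner_sub_right, inner_sub_right]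
      linarith
    refine ⟨c, g, congrArg _ (funext fun x => ?_)⟩
    split_ifs with hx
    · rw [pwLin_of_nonpos hx]
    · rw [pwLin_of_nonneg (not_le.1 hx).le, add_left_inj, ← sub_eq_zero]
      rw [refract, inner_add_left, real_inner_smul_left, real_inner_comm (S.D i) (S.n i)] at hD
      linarith
  · rintro ⟨c, g, rfl⟩
    refine ⟨_, _, ⟨c, g, fun _ => rfl⟩, ⟨c - (βm / βp - 1) * ⟪g, S.n i⟫_ℝ * ⟪S.D i, S.n i⟫_ℝ,
      refract (S.n i) (βm / βp - 1) g, fun _ => rfl⟩, fun x hx => ⟨?_, ?_⟩,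
      congrArg _ (funext fun x => ?_)⟩
    · have hx0 := inner_chord_eq_zero h hx
      rw [← pwLin_of_nonneg hx0.ge, ← pwLin_of_nonpos hx0.le]
    · rw [h_grad, h_grad]
      exact ((h_refract g _).1 rfl).2.symm
    · split_ifs with hx
      exacts [pwLin_of_nonpos hx, pwLin_of_nonneg (not_le.1 hx).le]

lemma memSLoc_iff (hβp : βp ≠ 0) {w : Plane → ℝ} :
    S.MemSLoc βm βp i w ↔ ∃ c g, w = S.locLin βm βp i c g := by
  by_cases h : S.IsCut i
  · simp only [memSLoc_iff_of_isCut h hβp, locLin, nJump_of_isCut h]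
  · simp only [MemSLoc, h, false_imp_iff, true_and, not_false_iff, true_imp_iff, locLin,
      nJump_of_not_isCut h, ← eq_indicator_iff]
    have h_zero : ∀ c g, pwLin (S.D i) (S.n i) 0 c g = fun x => c + ⟪g, x⟫_ℝ := fun c g => by
      funext x
      rw [pwLin, zero_mul, zero_mul, add_zero]
    constructor
    · rintro ⟨p, ⟨c, g, hp⟩, rfl⟩
      exact ⟨c, g, by rw [h_zero, funext hp]⟩
    · rintro ⟨c, g, rfl⟩
      exact ⟨_, ⟨c, g, fun _ => rfl⟩, by rw [h_zero]⟩

lemma memINDLoc_iff_of_isCut (h : S.IsCut i) (hβp : βp ≠ 0) (hμm : μm ≠ 0) (hμp : μp ≠ 0)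
    {z : Plane → Plane} :
    S.MemINDLoc βm βp μm μp i z ↔ ∃ g b, z = (M.tri i).indicator
      (pwND (S.mid i) (S.D i) (S.n i) (βm / βp - 1) (μp / μm) g b) := by
  have h_refract := fun g g' => eq_refract_iff (g := g) (g' := g') (βm := βm)
    (sub_ne_zero.2 (S.ne i h).symm) (S.unit i h) (S.normal i h) hβp
  have h_curl : ∀ b b' : ℝ, μp⁻¹ * (-2 * b') = μm⁻¹ * (-2 * b) ↔ b' = μp / μm * b := fun b b' => by
    constructor <;> intro h <;> field_simp at h ⊢ <;> linarith
  simp only [MemINDLoc, h, not_true, false_imp_iff, and_true, true_imp_iff, isGlued_iff,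
    isND_iff_exists_centred (S.mid i)]
  constructor
  · rintro ⟨zm, zp, ⟨g, b, rfl⟩, ⟨g', b', rfl⟩, ht, hcurl, hβ, rfl⟩
    simp only [sub_self, map_zero, smul_zero, add_zero, curl_centred, h_curl] at ht hcurl hβ
    obtain rfl := (h_refract g g').2 ⟨by rw [real_inner_comm, ht, real_inner_comm], hβ⟩
    exact ⟨g, b, by rw [hcurl]; rfl⟩
  · rintro ⟨g, b, rfl⟩
    obtain ⟨ht, hβ⟩ := (h_refract g _).1 rfl
    refine ⟨_, _, ⟨g, b, rfl⟩, ⟨_, μp / μm * b, rfl⟩, ?_, ?_, ?_, rfl⟩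
    · simpa only [sub_self, map_zero, smul_zero, add_zero, real_inner_comm (S.E i - S.D i)] using ht
    · rw [curl_centred, curl_centred, h_curl]
    · simpa only [sub_self, map_zero, smul_zero, add_zero] using hβ

lemma memINDLoc_iff (hβp : βp ≠ 0) (hμm : μm ≠ 0) (hμp : μp ≠ 0) {z : Plane → Plane} :
    S.MemINDLoc βm βp μm μp i z ↔ ∃ g b, z = S.locND βm βp μm μp i g b := by
  by_cases h : S.IsCut i
  · simp only [memINDLoc_iff_of_isCut h hβp hμm hμp, locND, nJump_of_isCut h, cRatio, centre, h,
      if_true]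
  · simp only [MemINDLoc, h, false_imp_iff, true_and, not_false_iff, true_imp_iff, locND, cRatio,
      centre, if_false, nJump_of_not_isCut h, ← eq_indicator_iff,
      isND_iff_exists_centred (M.A i 0)]
    have h_one : ∀ g b, pwND (M.A i 0) (S.D i) (S.n i) 0 1 g b =
        fun x => g + b • rot (x - M.A i 0) := fun g b => by
      funext x
      rw [pwND, refract, zero_mul, zero_smul, add_zero, one_mul, ite_self]
    simp only [h_one]
    constructor
    · rintro ⟨p, ⟨g, b, rfl⟩, rfl⟩
      exact ⟨g, b, rfl⟩
    · rintro ⟨g, b, rfl⟩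
      exact ⟨_, ⟨g, b, rfl⟩, rfl⟩

lemma existsUnique_locLin_interp (hβm : 0 < βm) (hβp : 0 < βp) (hM : S.IsCut i → M.NonObtuse i)
    (V : Fin 3 → ℝ) : ∃! f : ℝ × Plane, ∀ k, S.locLin βm βp i f.1 f.2 (M.A i k) = V k := by
  simp only [locLin_of_mem (M.vertex_mem_tri i _)]
  by_cases h : S.IsCut i
  · exact existsUnique_pwLin_interp_of_nonObtuse (M.basis i) (hM h) (S.unit i h)
      (neg_one_lt_nJump hβm hβp) V
  · rw [nJump_of_not_isCut h]
    exact existsUnique_pwLin_interp_of_eq_zero (M.basis i) V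

end Interface

/-! ### Line integrals of piecewise Nédélec fields -/

/-- The fraction of a segment on which an affine function with end values `a`, `b` is positive. -/
def posFrac (a b : ℝ) : ℝ := ∫ s in (0 : ℝ)..1, if a + s * (b - a) ≤ 0 then (0 : ℝ) else 1

lemma intervalIntegrable_posFrac (a b : ℝ) :
    IntervalIntegrable (fun s : ℝ => if a + s * (b - a) ≤ 0 then (0 : ℝ) else 1) volume 0 1 := by
  rw [intervalIntegrable_iff]
  refine Measure.integrableOn_of_bounded (M := 1) (by simp) ?_ (ae_of_all _ fun s => ?_)
  · exact (Measurable.ite (measurableSet_le (by fun_prop) measurable_const) measurable_const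
      measurable_const).aestronglyMeasurable
  · split_ifs <;> simp

lemma posFrac_mem_Icc (a b : ℝ) : posFrac a b ∈ Icc 0 1 := by
  constructor
  · exact intervalIntegral.integral_nonneg zero_le_one fun _ _ => by split_ifs <;> simp
  · calc posFrac a b ≤ ∫ _ in (0 : ℝ)..1, (1 : ℝ) :=
        intervalIntegral.integral_mono_on zero_le_one (intervalIntegrable_posFrac a b) (by simp)
          fun _ _ => by split_ifs <;> simp
      _ = 1 := by simp

lemma hasDerivAt_posPart {x : ℝ} (hx : x ≠ 0) :
    HasDerivAt (fun y : ℝ => y⁺) (if x ≤ 0 then 0 else 1) x := by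
  rcases hx.lt_or_gt with h | h
  · rw [if_pos h.le]
    refine (hasDerivAt_const x (0 : ℝ)).congr_of_eventuallyEq ?_
    filter_upwards [Iio_mem_nhds h] with y hy
    exact posPart_of_nonpos (le_of_lt hy)
  · rw [if_neg (not_le.2 h)]
    refine (hasDerivAt_id x).congr_of_eventuallyEq ?_
    filter_upwards [Ioi_mem_nhds h] with y hy
    exact posPart_of_nonneg (le_of_lt hy)

lemma posFrac_mul_sub (a b : ℝ) : posFrac a b * (b - a) = b⁺ - a⁺ := by
  rcases eq_or_ne a b with rfl | hab
  · rw [sub_self, sub_self, mul_zero]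
  have hba : b - a ≠ 0 := sub_ne_zero.2 hab.symm
  have h_deriv : ∀ s ∈ Ioo (0 : ℝ) 1 \ {-a / (b - a)}, HasDerivAt (fun s => (a + s * (b - a))⁺)
      ((if a + s * (b - a) ≤ 0 then 0 else 1) * (b - a)) s := by
    rintro s ⟨-, hs⟩
    have h_ne : a + s * (b - a) ≠ 0 := fun h => hs <| by
      rw [mem_singleton_iff, eq_div_iff hba]
      linarith
    have h_lin : HasDerivAt (fun s : ℝ => a + s * (b - a)) (b - a) s := by
      simpa using ((hasDerivAt_id s).mul_const (b - a)).const_add a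
    exact (hasDerivAt_posPart h_ne).comp s h_lin
  rw [posFrac, ← intervalIntegral.integral_mul_const,
    integral_eq_of_hasDerivAt_off_countable_of_le _ _ zero_le_one (countable_singleton _)
      (by simp only [posPart_def]; fun_prop) h_deriv
      ((intervalIntegrable_posFrac a b).mul_const _)]
  simp

section LineIntegrals

variable {X D n g P Q : Plane} {ρ ν b c : ℝ}

lemma inner_rot_lineMap_sub (X P Q : Plane) (s : ℝ) :
    ⟪rot (AffineMap.lineMap P Q s - X), Q - P⟫_ℝ = -cross (P - X) (Q - X) := by
  rw [AffineMap.lineMap_apply_module', inner_eq_coords, rot_apply]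
  simp [cross]
  ring

lemma lineInt_pwND {z : Plane → Plane} (hz : ∀ x ∈ segment ℝ P Q, z x = pwND X D n ρ ν g b x) :
    lineInt P Q z = pwLin D n ρ c g Q - pwLin D n ρ c g P -
      (1 + (ν - 1) * posFrac ⟪P - D, n⟫_ℝ ⟪Q - D, n⟫_ℝ) * cross (P - X) (Q - X) * b := by
  set p := ⟪P - D, n⟫_ℝ with hp
  set q := ⟪Q - D, n⟫_ℝ with hq
  set κ := cross (P - X) (Q - X)
  set J : ℝ := ρ * ⟪g, n⟫_ℝ * (q - p) - (ν - 1) * b * κ with hJ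
  have h_level : ∀ s : ℝ, ⟪AffineMap.lineMap P Q s - D, n⟫_ℝ = p + s * (q - p) := fun s => by
    rw [AffineMap.lineMap_apply_module, inner_combo_sub _ _ _ _ (sub_add_cancel 1 s)]
    ring
  have h_tangent : ⟪n, Q - P⟫_ℝ = q - p := by
    rw [hp, hq, ← inner_sub_left, sub_sub_sub_cancel_right, real_inner_comm]
  have h_integrand : lineInt P Q z = ∫ s in (0 : ℝ)..1,
      (⟪g, Q - P⟫_ℝ - b * κ + J * if p + s * (q - p) ≤ 0 then (0 : ℝ) else 1) := by
    refine intervalIntegral.integral_congr fun s hs => ?_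
    rw [uIcc_of_le zero_le_one] at hs
    have hx : AffineMap.lineMap P Q s ∈ segment ℝ P Q := by
      rw [segment_eq_image_lineMap]
      exact mem_image_of_mem _ hs
    beta_reduce
    rw [hz _ hx, pwND, h_level]
    split_ifs
    · rw [inner_add_left, real_inner_smul_left, inner_rot_lineMap_sub]
      ring
    · rw [inner_add_left, real_inner_smul_left, inner_rot_lineMap_sub, refract, inner_add_left,
        real_inner_smul_left, h_tangent, hJ]
      ring
  rw [h_integrand, intervalIntegral.integral_add (by simp)
    ((intervalIntegrable_posFrac p q).const_mul J), intervalIntegral.integral_const_mul, ← posFrac,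
    intervalIntegral.integral_const, pwLin, pwLin, hJ, inner_sub_right]
  linear_combination ρ * ⟪g, n⟫_ℝ * posFrac_mul_sub p q

lemma eq_zero_of_sum_lineInt_pwND (T : AffineBasis (Fin 3) ℝ Plane)
    (hX : X ∈ convexHull ℝ (range T)) (hν : 0 < ν) {z : Plane → Plane}
    (hz : ∀ x ∈ convexHull ℝ (range T), z x = pwND X D n ρ ν g b x)
    (h_sum : ∑ k : Fin 3, lineInt (T (k + 1)) (T (k + 2)) z = 0) : b = 0 := by
  set θ : Fin 3 → ℝ := fun k => 1 + (ν - 1) * posFrac ⟪T (k + 1) - D, n⟫_ℝ ⟪T (k + 2) - D, n⟫_ℝ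
  have hθ : ∀ k, min 1 ν ≤ θ k := fun k => by
    obtain ⟨h0, h1⟩ := posFrac_mem_Icc ⟪T (k + 1) - D, n⟫_ℝ ⟪T (k + 2) - D, n⟫_ℝ
    simp only [θ]
    nlinarith [min_le_left 1 ν, min_le_right 1 ν]
  rw [T.convexHull_eq_nonneg_coord] at hX
  have h_pos : 0 < ∑ k, T.coord k X * θ k :=
    calc 0 < min 1 ν := lt_min one_pos hν
      _ = ∑ k, T.coord k X * min 1 ν := by
        rw [← Finset.sum_mul, T.sum_coord_apply_eq_one, one_mul]
      _ ≤ ∑ k, T.coord k X * θ k :=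
        Finset.sum_le_sum fun k _ => mul_le_mul_of_nonneg_left (hθ k) (hX k)
  have h_lin : ∑ k : Fin 3, lineInt (T (k + 1)) (T (k + 2)) z =
      -(twiceArea T * (∑ k, T.coord k X * θ k) * b) := by
    rw [Finset.sum_congr rfl fun k _ => lineInt_pwND (c := 0) fun x hx => hz x
      (segment_subset_convexHull (mem_range_self _) (mem_range_self _) hx)]
    simp only [cross_sub_vertices, Fin.sum_univ_three, Fin.isValue, θ, zero_add, Fin.reduceAdd]
    ring
  rw [h_lin, neg_eq_zero] at h_sum
  exact (mul_eq_zero.1 h_sum).resolve_left (mul_ne_zero (twiceArea_ne_zero T) h_pos.ne')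

lemma hasGradientAt_pwLin {x : Plane} (h : ρ = 0 ∨ ⟪x - D, n⟫_ℝ ≠ 0) :
    HasGradientAt (pwLin D n ρ c g) (pwND X D n ρ ν g 0 x) x := by
  have h_cont : ContinuousAt (fun y : Plane => ⟪y - D, n⟫_ℝ) x := by fun_prop
  simp only [pwND, mul_zero, zero_smul, add_zero]
  rcases h with rfl | h
  · simp only [refract, zero_mul, zero_smul, add_zero, ite_self]
    exact (hasGradientAt_affine c g x).congr_of_eventuallyEq (.of_forall fun y => by simp [pwLin])
  rcases h.lt_or_gt with h | h
  · rw [if_pos h.le]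
    refine (hasGradientAt_affine c g x).congr_of_eventuallyEq ?_
    filter_upwards [h_cont.eventually_lt continuousAt_const h] with y hy
    exact pwLin_of_nonpos hy.le
  · rw [if_neg (not_le.2 h)]
    refine (hasGradientAt_affine (c - ρ * ⟪g, n⟫_ℝ * ⟪D, n⟫_ℝ) _ x).congr_of_eventuallyEq ?_
    filter_upwards [continuousAt_const.eventually_lt h_cont h] with y hy
    exact pwLin_of_nonneg hy.le

lemma exists_affine_of_mul_nonneg (X : Plane) (c ν : ℝ) (g : Plane)
    (h : ρ = 0 ∨ 0 ≤ ⟪P - D, n⟫_ℝ * ⟪Q - D, n⟫_ℝ) :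
    ∃ (a : ℝ) (q : Plane), (∀ x ∈ segment ℝ P Q, pwLin D n ρ c g x = a + ⟪q, x⟫_ℝ) ∧
      ∀ x ∈ openSegment ℝ P Q, ⟪pwND X D n ρ ν g 0 x, Q - P⟫_ℝ = ⟪q, Q - P⟫_ℝ := by
  simp only [pwND, mul_zero, zero_smul, add_zero]
  rw [mul_nonneg_iff] at h
  rcases h with rfl | ⟨hP, hQ⟩ | ⟨hP, hQ⟩
  · refine ⟨c, g, fun x _ => ?_, fun x _ => ?_⟩
    · rw [pwLin, zero_mul, zero_mul, add_zero]
    · rw [refract, zero_mul, zero_smul, add_zero, ite_self]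
  · refine ⟨c - ρ * ⟪g, n⟫_ℝ * ⟪D, n⟫_ℝ, refract n ρ g, ?_, ?_⟩
    · rintro _ ⟨a, b, ha, hb, hab, rfl⟩
      exact pwLin_of_nonneg (by rw [inner_combo_sub _ _ _ _ hab]; positivity)
    · rintro _ ⟨a, b, ha, hb, hab, rfl⟩
      split_ifs with hx
      · rw [inner_combo_sub _ _ _ _ hab] at hx
        have hP0 : ⟪P - D, n⟫_ℝ = 0 := by nlinarith
        have hQ0 : ⟪Q - D, n⟫_ℝ = 0 := by nlinarith
        rw [refract, inner_add_left, real_inner_smul_left, ← sub_sub_sub_cancel_right Q P D,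
          real_inner_comm _ n, inner_sub_left (Q - D), hP0, hQ0, sub_zero, mul_zero, add_zero]
      · rfl
  · have h_nonpos : ∀ x ∈ segment ℝ P Q, ⟪x - D, n⟫_ℝ ≤ 0 := by
      rintro _ ⟨a, b, ha, hb, hab, rfl⟩
      rw [inner_combo_sub _ _ _ _ hab]
      nlinarith
    refine ⟨c, g, fun x hx => pwLin_of_nonpos (h_nonpos x hx), fun x hx => ?_⟩
    rw [if_pos (h_nonpos x (openSegment_subset_segment ℝ _ _ hx))]

lemma eq_zero_of_endpoints_of_mul_nonneg (h : ρ = 0 ∨ 0 ≤ ⟪P - D, n⟫_ℝ * ⟪Q - D, n⟫_ℝ)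
    (hP : pwLin D n ρ c g P = 0) (hQ : pwLin D n ρ c g Q = 0) :
    (∀ x ∈ segment ℝ P Q, pwLin D n ρ c g x = 0) ∧
      ∀ x ∈ openSegment ℝ P Q, ⟪pwND X D n ρ ν g 0 x, Q - P⟫_ℝ = 0 := by
  obtain ⟨a, q, h_lin, h_ND⟩ := exists_affine_of_mul_nonneg X c ν g h
  rw [h_lin P (left_mem_segment ℝ P Q)] at hP
  rw [h_lin Q (right_mem_segment ℝ P Q)] at hQ
  constructor
  · intro x hx
    rw [h_lin x hx]
    obtain ⟨s, t, -, -, hst, rfl⟩ := hx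
    rw [inner_add_right, real_inner_smul_right, real_inner_smul_right]
    linear_combination s * hP + t * hQ - a * hst
  · intro x hx
    rw [h_ND x hx, inner_sub_right]
    linarith

lemma mul_nonpos_of_mem_segment {R : Plane} (hD : D ∈ segment ℝ R P) :
    ⟪R - D, n⟫_ℝ * ⟪P - D, n⟫_ℝ ≤ 0 ∧ (⟪R - D, n⟫_ℝ = 0 → ⟪P - D, n⟫_ℝ ≠ 0 → D = R) := by
  obtain ⟨a, b, ha, hb, hab, h⟩ := hD
  have h_combo := inner_combo_sub R P D n hab
  rw [h, sub_self, inner_zero_left] at h_combo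
  refine ⟨?_, fun hR hP => ?_⟩
  · have h_prod : ⟪R - D, n⟫_ℝ * ⟪P - D, n⟫_ℝ = -(a * ⟪R - D, n⟫_ℝ ^ 2 + b * ⟪P - D, n⟫_ℝ ^ 2) := by
      linear_combination -(⟪R - D, n⟫_ℝ + ⟪P - D, n⟫_ℝ) * h_combo -
        ⟪R - D, n⟫_ℝ * ⟪P - D, n⟫_ℝ * hab
    rw [h_prod, neg_nonpos]
    positivity
  · rw [hR, mul_zero, zero_add, eq_comm, mul_eq_zero, or_iff_left hP] at h_combo
    rw [← h, h_combo, zero_smul, add_zero, (by linarith : a = 1), one_smul]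

lemma mul_nonneg_of_chord {R E : Plane} (hDE : D ≠ E) (h_normal : ⟪E - D, n⟫_ℝ = 0)
    (hD : D ∈ segment ℝ R P) (hE : E ∈ segment ℝ R Q) :
    0 ≤ ⟪P - D, n⟫_ℝ * ⟪Q - D, n⟫_ℝ := by
  have h_shift : ∀ x, ⟪x - E, n⟫_ℝ = ⟪x - D, n⟫_ℝ := fun x => by
    rw [← sub_sub_sub_cancel_right x E D, inner_sub_left, h_normal, sub_zero]
  obtain ⟨hRP, hDR⟩ := mul_nonpos_of_mem_segment (n := n) hD
  obtain ⟨hRQ, hER⟩ := mul_nonpos_of_mem_segment (n := n) hE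
  simp only [h_shift] at hRQ hER
  by_contra! h_neg
  have hR : ⟪R - D, n⟫_ℝ = 0 := by
    by_contra hR
    nlinarith [mul_nonneg_of_nonpos_of_nonpos hRP hRQ, sq_pos_of_ne_zero hR]
  exact hDE ((hDR hR (left_ne_zero_of_mul h_neg.ne)).trans
    (hER hR (right_ne_zero_of_mul h_neg.ne)).symm)

end LineIntegrals

namespace Interface

variable {ι : Type*} {M : Mesh ι} {S : Interface M} {i : ι} {k : Fin 3}

lemma mul_nonneg_of_edge_subset_frontier (hc : S.IsCut i) (hk : M.edge i k ⊆ frontier M.domain) :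
    0 ≤ ⟪M.A i (k + 1) - S.D i, S.n i⟫_ℝ * ⟪M.A i (k + 2) - S.D i, S.n i⟫_ℝ := by
  have h_interior : ∀ x ∈ ({S.D i, S.E i} : Set Plane), ∀ j, x ∈ M.edge i j → j ≠ k := by
    rintro x hx j hj rfl
    rw [← S.inter i hc] at hx
    exact (isOpen_interior.frontier_eq.subset (hk hj)).2 (S.subset_domain hx.1)
  have h_sides : ∀ x j, x ∈ M.edge i j → j ≠ k →
      j = k + 1 ∧ x ∈ segment ℝ (M.A i k) (M.A i (k + 2)) ∨
      j = k + 2 ∧ x ∈ segment ℝ (M.A i k) (M.A i (k + 1)) := by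
    intro x j hx hj
    obtain ⟨h11, h12, h21, h22⟩ := fin_three_add k
    rcases (fin_three_eq_or j k).resolve_left hj with rfl | rfl
    · rw [Mesh.edge, h11, h12, segment_symm] at hx
      exact Or.inl ⟨rfl, hx⟩
    · rw [Mesh.edge, h21, h22] at hx
      exact Or.inr ⟨rfl, hx⟩
  obtain ⟨j, l, hjl, hD, hE⟩ := S.edges i hc
  rcases h_sides _ j hD (h_interior _ (mem_insert _ _) j hD) with ⟨hj, hD⟩ | ⟨hj, hD⟩ <;>
    rcases h_sides _ l hE (h_interior _ (mem_insert_of_mem _ rfl) l hE) with ⟨hl, hE⟩ | ⟨hl, hE⟩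
  · exact absurd (hj.trans hl.symm) hjl
  · rw [mul_comm]
    exact mul_nonneg_of_chord (S.ne i hc) (S.normal i hc) hD hE
  · exact mul_nonneg_of_chord (S.ne i hc) (S.normal i hc) hD hE
  · exact absurd (hj.trans hl.symm) hjl

end Interface

namespace Interface

variable {ι : Type*} {M : Mesh ι} {S : Interface M} {βm βp μm μp : ℝ} {i : ι} {k : Fin 3} {c : ℝ}
  {g x : Plane}

lemma nJump_eq_zero_or_mul_nonneg (hk : M.edge i k ⊆ frontier M.domain) :
    S.nJump βm βp i = 0 ∨
      0 ≤ ⟪M.A i (k + 1) - S.D i, S.n i⟫_ℝ * ⟪M.A i (k + 2) - S.D i, S.n i⟫_ℝ := by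
  by_cases h : S.IsCut i
  exacts [Or.inr (mul_nonneg_of_edge_subset_frontier h hk), Or.inl (nJump_of_not_isCut h)]

lemma locND_of_mem {b : ℝ} (hx : x ∈ M.tri i) : S.locND βm βp μm μp i g b x =
    pwND (S.centre i) (S.D i) (S.n i) (S.nJump βm βp i) (S.cRatio μm μp i) g b x :=
  indicator_of_mem hx _

lemma locLin_add_const_of_mem (a : ℝ) (hx : x ∈ M.tri i) :
    S.locLin βm βp i (a + c) g x = a + S.locLin βm βp i c g x := by
  rw [locLin_of_mem hx, locLin_of_mem hx, pwLin, pwLin, add_assoc, add_assoc, add_assoc]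

lemma lineInt_locND_zero (c : ℝ) {P Q : Plane} (hP : P ∈ range (M.A i)) (hQ : Q ∈ range (M.A i)) :
    lineInt P Q (S.locND βm βp μm μp i g 0) =
      S.locLin βm βp i c g Q - S.locLin βm βp i c g P := by
  rw [locLin_of_mem (subset_convexHull ℝ _ hP), locLin_of_mem (subset_convexHull ℝ _ hQ),
    lineInt_pwND (c := c) fun x hx => locND_of_mem (M.segment_subset_tri hP hQ hx), mul_zero,
    sub_zero]

lemma eq_zero_of_sum_lineInt_locND (hμm : 0 < μm) (hμp : 0 < μp) {b : ℝ}
    (h : ∑ k : Fin 3, lineInt (M.A i (k + 1)) (M.A i (k + 2)) (S.locND βm βp μm μp i g b) = 0) :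
    b = 0 :=
  eq_zero_of_sum_lineInt_pwND (M.basis i) centre_mem_tri (cRatio_pos hμm hμp)
    (fun _ => locND_of_mem) h

lemma zero_trace (hk : M.edge i k ⊆ frontier M.domain)
    (h1 : S.locLin βm βp i c g (M.A i (k + 1)) = 0)
    (h2 : S.locLin βm βp i c g (M.A i (k + 2)) = 0) :
    (∀ x ∈ M.edge i k, S.locLin βm βp i c g x = 0) ∧
      ∀ x ∈ openSegment ℝ (M.A i (k + 1)) (M.A i (k + 2)),
        ⟪S.locND βm βp μm μp i g 0 x, M.A i (k + 2) - M.A i (k + 1)⟫_ℝ = 0 := by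
  rw [locLin_of_mem (M.vertex_mem_tri i _)] at h1 h2
  obtain ⟨h_lin, h_ND⟩ := eq_zero_of_endpoints_of_mul_nonneg (X := S.centre i)
    (ν := S.cRatio μm μp i) (nJump_eq_zero_or_mul_nonneg hk) h1 h2
  refine ⟨fun x hx => ?_, fun x hx => ?_⟩
  · rw [locLin_of_mem (M.edge_subset_tri i k hx), h_lin x hx]
  · rw [locND_of_mem (M.edge_subset_tri i k (openSegment_subset_segment ℝ _ _ hx)), h_ND x hx]

lemma hasGradientAt_locLin (hx : x ∈ interior (M.tri i)) (h_level : S.IsCut i → S.level i x ≠ 0) :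
    HasGradientAt (S.locLin βm βp i c g) (S.locND βm βp μm μp i g 0 x) x := by
  rw [locND_of_mem (interior_subset hx)]
  have h : S.nJump βm βp i = 0 ∨ ⟪x - S.D i, S.n i⟫_ℝ ≠ 0 := by
    by_cases hc : S.IsCut i
    exacts [Or.inr (h_level hc), Or.inl (nJump_of_not_isCut hc)]
  refine (hasGradientAt_pwLin (c := c) h).congr_of_eventuallyEq ?_
  filter_upwards [mem_interior_iff_mem_nhds.1 hx] with y hy using locLin_of_mem hy

variable {v : Plane → ℝ} {c : ι → ℝ} {g : ι → Plane}

lemma isNodalInterp_iff (hβm : 0 < βm) (hβp : 0 < βp) (hM : ∀ i, S.IsCut i → M.NonObtuse i)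
    (hcg : ∀ i k, S.locLin βm βp i (c i) (g i) (M.A i k) = v (M.A i k)) {w : ι → Plane → ℝ} :
    S.IsNodalInterp βm βp v w ↔ w = fun i => S.locLin βm βp i (c i) (g i) := by
  constructor
  · rintro ⟨⟨h_loc, -⟩, hw⟩
    funext i
    obtain ⟨c', g', hi⟩ := (memSLoc_iff hβp.ne').1 (h_loc i)
    obtain ⟨rfl, rfl⟩ := Prod.mk.inj <|
      (existsUnique_locLin_interp hβm hβp (hM i) fun k => v (M.A i k)).unique
        (y₁ := (c', g')) (y₂ := (c i, g i)) (fun k => by rw [← hi, hw]) (hcg i)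
    exact hi
  · rintro rfl
    refine ⟨⟨fun i => (memSLoc_iff hβp.ne').2 ⟨c i, g i, rfl⟩, ?_⟩, hcg⟩
    rintro i j P ⟨⟨k, rfl⟩, ⟨l, hl⟩⟩
    exact (hcg i k).trans (hl ▸ (hcg j l).symm)

lemma eq_of_lineInt_locND_zero (hβm : 0 < βm) (hβp : 0 < βp) (hM : S.IsCut i → M.NonObtuse i)
    {c : ℝ} {g g' : Plane} (h : ∀ k : Fin 3,
      lineInt (M.A i (k + 1)) (M.A i (k + 2)) (S.locND βm βp μm μp i g' 0) =
        S.locLin βm βp i c g (M.A i (k + 2)) - S.locLin βm βp i c g (M.A i (k + 1))) : g' = g := by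
  set V : Fin 3 → ℝ := fun k => S.locLin βm βp i c g (M.A i k)
  set W : Fin 3 → ℝ := fun k => S.locLin βm βp i 0 g' (M.A i k)
  have hVW : ∀ k, V k - W k = V 0 - W 0 := by
    have h_diff : ∀ k : Fin 3, W (k + 2) - W (k + 1) = V (k + 2) - V (k + 1) := fun k =>
      (lineInt_locND_zero 0 (mem_range_self _) (mem_range_self _)).symm.trans (h k)
    have h2 : W 0 - W 2 = V 0 - V 2 := h_diff 1
    have h1 : W 1 - W 0 = V 1 - V 0 := h_diff 2
    rw [Fin.forall_fin_succ, Fin.forall_fin_two]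
    exact ⟨rfl, by linarith!, by linarith!⟩
  have h_eq : ((V 0 - W 0) + 0, g') = (c, g) :=
    (existsUnique_locLin_interp hβm hβp hM V).unique (fun k => by
      rw [locLin_add_const_of_mem _ (M.vertex_mem_tri i k), ← hVW k]
      exact sub_add_cancel _ _) fun _ => rfl
  exact (Prod.ext_iff.1 h_eq).2

lemma isEdgeInterp_iff (hβm : 0 < βm) (hβp : 0 < βp) (hμm : 0 < μm) (hμp : 0 < μp)
    (hM : ∀ i, S.IsCut i → M.NonObtuse i)
    (hcg : ∀ i k, S.locLin βm βp i (c i) (g i) (M.A i k) = v (M.A i k)) {G : Plane → Plane}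
    (hG : ∀ i k I, S.HasEdgeIntegral i k G I ↔ I = v (M.A i (k + 2)) - v (M.A i (k + 1)))
    {z : ι → Plane → Plane} :
    S.IsEdgeInterp βm βp μm μp G z ↔ z = fun i => S.locND βm βp μm μp i (g i) 0 := by
  simp only [IsEdgeInterp, hG]
  constructor
  · rintro ⟨⟨h_loc, -⟩, hz⟩
    funext i
    obtain ⟨g', b, hi⟩ := (memINDLoc_iff hβp.ne' hμm.ne' hμp.ne').1 (h_loc i)
    have h_circ : ∑ k : Fin 3, lineInt (M.A i (k + 1)) (M.A i (k + 2)) (z i) = 0 := by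
      simp only [hz, Fin.sum_univ_three, Fin.isValue, zero_add, Fin.reduceAdd]
      ring
    rw [hi] at h_circ
    obtain rfl := eq_zero_of_sum_lineInt_locND hμm hμp h_circ
    have hg : g' = g i := eq_of_lineInt_locND_zero hβm hβp (hM i) (c := c i) fun k => by
      rw [← hi, hz, hcg, hcg]
    rw [hi, hg]
  · rintro rfl
    refine ⟨⟨fun i => (memINDLoc_iff hβp.ne' hμm.ne' hμp.ne').2 ⟨g i, 0, rfl⟩, ?_⟩, fun i k => ?_⟩
    · rintro i j P ⟨⟨k, rfl⟩, hPj⟩ Q ⟨⟨l, rfl⟩, hQj⟩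
      have h_nodal : ∀ k, M.A i k ∈ range (M.A j) → S.locLin βm βp j (c j) (g j) (M.A i k) =
          S.locLin βm βp i (c i) (g i) (M.A i k) := by
        rintro k ⟨m, hm⟩
        rw [hcg, ← hm, hcg]
      rw [lineInt_locND_zero (c i) (mem_range_self _) (mem_range_self _),
        lineInt_locND_zero (c j) hPj hQj, h_nodal k hPj, h_nodal l hQj]
    · rw [lineInt_locND_zero (c i) (mem_range_self _) (mem_range_self _), hcg, hcg]

theorem commuting_of_hasEdgeIntegral_iff (hβm : 0 < βm) (hβp : 0 < βp) (hμm : 0 < μm)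
    (hμp : 0 < μp) (hM : ∀ i, S.IsCut i → M.NonObtuse i) (hv : ∀ x ∈ frontier M.domain, v x = 0)
    {G : Plane → Plane}
    (hG : ∀ i k I, S.HasEdgeIntegral i k G I ↔ I = v (M.A i (k + 2)) - v (M.A i (k + 1))) :
    (∃! w, S.IsNodalInterp βm βp v w) ∧
    (∃! z, S.IsEdgeInterp βm βp μm μp G z) ∧
    ∀ w z, S.IsNodalInterp βm βp v w → S.IsEdgeInterp βm βp μm μp G z →
      S.MemSZero βm βp w ∧ S.MemINDZero βm βp μm μp z ∧ S.IsBrokenGrad w z := by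
  choose f hf using fun i =>
    (existsUnique_locLin_interp hβm hβp (hM i) fun k => v (M.A i k)).exists
  have h_nodal : ∀ {w}, S.IsNodalInterp βm βp v w ↔ _ := isNodalInterp_iff hβm hβp hM hf
  have h_edge : ∀ {z}, S.IsEdgeInterp βm βp μm μp G z ↔ _ :=
    isEdgeInterp_iff hβm hβp hμm hμp hM hf hG
  refine ⟨⟨_, h_nodal.2 rfl, fun w => h_nodal.1⟩, ⟨_, h_edge.2 rfl, fun z => h_edge.1⟩, ?_⟩
  rintro w z hw hz
  have h_trace : ∀ i k, M.edge i k ⊆ frontier M.domain → _ := fun i k hk =>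
    zero_trace (μm := μm) (μp := μp) hk ((hf i _).trans (hv _ (hk (left_mem_segment ℝ _ _))))
      ((hf i _).trans (hv _ (hk (right_mem_segment ℝ _ _))))
  have hw_mem := hw.1
  have hz_mem := hz.1
  obtain rfl := h_nodal.1 hw
  obtain rfl := h_edge.1 hz
  exact ⟨⟨hw_mem, fun i k hk => (h_trace i k hk).1⟩, ⟨hz_mem, fun i k hk => (h_trace i k hk).2⟩,
    fun i x => hasGradientAt_locLin⟩

end Interface

/-! ### Smooth cutoffs on the line -/

/-- A smooth monotone function that vanishes up to `a + r` and is one from `a + 2 * r` on. -/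
def cutoff (a r s : ℝ) : ℝ := Real.smoothTransition ((s - a) / r - 1)

section Cutoff

variable {a b r s : ℝ}

lemma contDiff_cutoff (a r : ℝ) : ContDiff ℝ ∞ (cutoff a r) :=
  Real.smoothTransition.contDiff.comp (by fun_prop)

lemma cutoff_of_le (hr : 0 < r) (h : s ≤ a + r) : cutoff a r s = 0 := by
  refine Real.smoothTransition.zero_of_nonpos ?_
  rw [sub_nonpos, div_le_one hr]
  linarith

lemma cutoff_of_ge (hr : 0 < r) (h : a + 2 * r ≤ s) : cutoff a r s = 1 := by
  refine Real.smoothTransition.one_of_one_le ?_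
  rw [le_sub_iff_add_le, le_div_iff₀ hr]
  linarith

lemma cutoff_mem_Icc (a r s : ℝ) : cutoff a r s ∈ Icc 0 1 :=
  ⟨Real.smoothTransition.nonneg _, Real.smoothTransition.le_one _⟩

lemma monotone_cutoff (hr : 0 < r) : Monotone (cutoff a r) := fun s t h =>
  Real.smoothTransition.monotone (by gcongr)

lemma continuous_deriv_cutoff (a r : ℝ) : Continuous (deriv (cutoff a r)) :=
  (contDiff_cutoff a r).continuous_deriv (by simp)

lemma deriv_cutoff_eq_zero (hr : 0 < r) (h : s ∉ Icc (a + r) (a + 2 * r)) :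
    deriv (cutoff a r) s = 0 := by
  rw [mem_Icc, not_and_or, not_le, not_le] at h
  rcases h with h | h
  · have h_const : cutoff a r =ᶠ[𝓝 s] fun _ => 0 := by
      filter_upwards [Iio_mem_nhds h] with t ht using cutoff_of_le hr (le_of_lt ht)
    rw [h_const.deriv_eq, deriv_const]
  · have h_const : cutoff a r =ᶠ[𝓝 s] fun _ => 1 := by
      filter_upwards [Ioi_mem_nhds h] with t ht using cutoff_of_ge hr (le_of_lt ht)
    rw [h_const.deriv_eq, deriv_const]

lemma exists_norm_deriv_cutoff_le (a : ℝ) (hr : 0 < r) :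
    ∃ C, ∀ s, ‖deriv (cutoff a r) s‖ ≤ C :=
  (continuous_deriv_cutoff a r).bounded_above_of_compact_support
    (HasCompactSupport.intro isCompact_Icc fun _ h => deriv_cutoff_eq_zero hr h)

lemma setIntegral_deriv_cutoff (hr : 0 < r) (hb : a + 2 * r < b) :
    ∫ s in Ioo a b, deriv (cutoff a r) s = 1 := by
  rw [← integral_Ioc_eq_integral_Ioo, ← intervalIntegral.integral_of_le (by linarith),
    intervalIntegral.integral_deriv_eq_sub
      (fun s _ => (contDiff_cutoff a r).differentiable (by simp) s)
      ((continuous_deriv_cutoff a r).intervalIntegrable _ _),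
    cutoff_of_ge hr hb.le, cutoff_of_le hr (by linarith), sub_zero]

lemma tendsto_cutoff (h : a < s) : Tendsto (fun r => cutoff a r s) (𝓝[>] 0) (𝓝 1) := by
  refine tendsto_const_nhds.congr' ?_
  filter_upwards [Ioo_mem_nhdsGT (half_pos (sub_pos.2 h))] with r hr
  exact (cutoff_of_ge hr.1 (by linarith [hr.2])).symm

lemma tendsto_setIntegral_mul_deriv_cutoff {m : ℝ → ℝ} {l : ℝ} (hab : a < b)
    (hm : IntegrableOn m (Ioo a b)) (h_lim : Tendsto m (𝓝[>] a) (𝓝 l)) :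
    Tendsto (fun r => ∫ s in Ioo a b, m s * deriv (cutoff a r) s) (𝓝[>] 0) (𝓝 l) := by
  simp only [mul_comm (m _), ← smul_eq_mul]
  have h_pos : ∀ᶠ r in 𝓝[>] (0 : ℝ), 0 < r := self_mem_nhdsWithin
  refine tendsto_setIntegral_peak_smul_of_integrableOn_of_tendsto measurableSet_Ioo
    measurableSet_Ioo subset_rfl self_mem_nhdsWithin (by simp) ?_ (fun u hu hau => ?_) ?_ ?_ hm
    (by rwa [nhdsWithin_Ioo_eq_nhdsGT hab])
  · filter_upwards [h_pos] with r hr s _ using (monotone_cutoff hr).deriv_nonneg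
  · obtain ⟨ε, hε, hεu⟩ := Metric.isOpen_iff.1 hu a hau
    refine Metric.tendstoUniformlyOn_iff.2 fun δ hδ => ?_
    filter_upwards [Ioo_mem_nhdsGT (half_pos hε)] with r hr s hs
    rw [deriv_cutoff_eq_zero hr.1 fun h => hs.2 (hεu ?_), Pi.zero_apply, dist_self]
    · exact hδ
    · rw [Real.ball_eq_Ioo]
      exact ⟨by linarith [hr.1, h.1], by linarith [hr.2, h.2]⟩
  · refine tendsto_const_nhds.congr' ?_
    filter_upwards [Ioo_mem_nhdsGT (half_pos (sub_pos.2 hab))] with r hr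
    exact (setIntegral_deriv_cutoff hr.1 (by linarith [hr.2])).symm
  · exact .of_forall fun r => (continuous_deriv_cutoff a r).aestronglyMeasurable

lemma integrableOn_mul_deriv_cutoff {f : ℝ → ℝ} {E : Set ℝ} (hf : IntegrableOn f E) (a : ℝ)
    (hr : 0 < r) : IntegrableOn (fun s => f s * deriv (cutoff a r) s) E :=
  (exists_norm_deriv_cutoff_le a hr).elim fun _ hC =>
    hf.mul_bdd (continuous_deriv_cutoff a r).aestronglyMeasurable (ae_of_all _ hC)

lemma integrableOn_mul_one_sub_cutoff {f : ℝ → ℝ} {E : Set ℝ} (hf : IntegrableOn f E) (a r : ℝ) :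
    IntegrableOn (fun s => f s * (1 - cutoff a r s)) E := by
  refine hf.mul_bdd (c := 1)
    (continuous_const.sub (contDiff_cutoff a r).continuous).aestronglyMeasurable
    (ae_of_all _ fun s => ?_)
  obtain ⟨h0, h1⟩ := cutoff_mem_Icc a r s
  rw [Real.norm_eq_abs, abs_le]
  constructor <;> linarith

end Cutoff

/-! ### Absolutely continuous functions of one variable -/

section AbsolutelyContinuous

variable {f g τ : ℝ → ℝ} {a b c l : ℝ}

lemma absolutelyContinuousOnInterval_congr (hf : AbsolutelyContinuousOnInterval f a b)
    (h : EqOn f g (uIcc a b)) : AbsolutelyContinuousOnInterval g a b := by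
  refine Tendsto.congr' (eventually_inf_principal.2 (.of_forall fun E hE => ?_)) hf
  exact Finset.sum_congr rfl fun i hi => by rw [h (hE.1 i hi).1, h (hE.1 i hi).2]

lemma absolutelyContinuousOnInterval_of_eq_integral (hab : a ≤ b)
    (hτ : IntervalIntegrable τ volume a b) (h : ∀ x ∈ Icc a b, f x = c + ∫ t in a..x, τ t) :
    AbsolutelyContinuousOnInterval f a b := by
  have h_const : AbsolutelyContinuousOnInterval (fun _ => c) a b :=
    ContDiffOn.absolutelyContinuousOnInterval contDiffOn_const
  refine absolutelyContinuousOnInterval_congr (h_const.fun_add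
    (hτ.absolutelyContinuousOnInterval_intervalIntegral left_mem_uIcc)) fun x hx => ?_
  rw [uIcc_of_le hab] at hx
  exact (h x hx).symm

lemma absolutelyContinuousOnInterval_trans (hab : a ≤ b) (hbc : b ≤ c)
    (h1 : AbsolutelyContinuousOnInterval f a b) (h2 : AbsolutelyContinuousOnInterval f b c) :
    AbsolutelyContinuousOnInterval f a c := by
  have h1_deriv := h1.intervalIntegrable_deriv
  refine absolutelyContinuousOnInterval_of_eq_integral (τ := deriv f) (c := f a) (hab.trans hbc)
    (h1_deriv.trans h2.intervalIntegrable_deriv) fun x hx => ?_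
  rcases le_total x b with hxb | hbx
  · have h1x := h1.mono (uIcc_subset_uIcc_left (by rw [uIcc_of_le hab]; exact ⟨hx.1, hxb⟩))
    rw [h1x.integral_deriv_eq_sub, add_sub_cancel]
  · have h2x := h2.mono (uIcc_subset_uIcc_left (by rw [uIcc_of_le hbc]; exact ⟨hbx, hx.2⟩))
    rw [← intervalIntegral.integral_add_adjacent_intervals h1_deriv
      h2x.intervalIntegrable_deriv, h1.integral_deriv_eq_sub, h2x.integral_deriv_eq_sub]
    ring

lemma absolutelyContinuousOnInterval_of_locally (hab : a ≤ b)
    (hr : ∀ x ∈ Ico a b, ∃ y > x, AbsolutelyContinuousOnInterval f x y)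
    (hl : ∀ x ∈ Ioc a b, ∃ y < x, AbsolutelyContinuousOnInterval f y x) :
    AbsolutelyContinuousOnInterval f a b := by
  set s : Set ℝ := {x | AbsolutelyContinuousOnInterval f a x}
  have ha : a ∈ s := absolutelyContinuousOnInterval_of_eq_integral (τ := 0) (c := f a) le_rfl
    .refl fun x hx => by rw [le_antisymm hx.2 hx.1]; simp
  suffices h : Icc a b ⊆ s from h (right_mem_Icc.2 hab)
  refine IsClosed.Icc_subset_of_forall_exists_gt (isClosed_of_closure_subset fun x hx => ?_) ha ?_
  · have hx_mem : x ∈ Icc a b := closure_minimal inter_subset_right isClosed_Icc hx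
    refine ⟨?_, hx_mem⟩
    rcases hx_mem.1.eq_or_lt with rfl | hax
    · exact ha
    obtain ⟨z, hzx, hz⟩ := hl x ⟨hax, hx_mem.2⟩
    obtain ⟨y, hzy, hy_mem, hy⟩ := mem_closure_iff.1 hx (Ioi z) isOpen_Ioi hzx
    rcases le_total x y with h | h
    · exact hy_mem.mono (uIcc_subset_uIcc_left (by rw [uIcc_of_le hy.1]; exact ⟨hax.le, h⟩))
    · exact absolutelyContinuousOnInterval_trans hy.1 h hy_mem
        (hz.mono (uIcc_subset_uIcc_right (by rw [uIcc_of_le hzx.le]; exact ⟨le_of_lt hzy, h⟩)))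
  · rintro x ⟨hxs, hx⟩ y (hxy : x < y)
    obtain ⟨z, hxz, hz⟩ := hr x hx
    refine ⟨min y z, ?_, lt_min hxy hxz, min_le_left _ _⟩
    refine absolutelyContinuousOnInterval_trans hx.1 (lt_min hxy hxz).le hxs
      (hz.mono (uIcc_subset_uIcc_left ?_))
    rw [uIcc_of_le hxz.le]
    exact ⟨(lt_min hxy hxz).le, min_le_right _ _⟩

/-- Smooth functions with compact support in the open interval `(a, b)`. -/
structure IsTestOn (η : ℝ → ℝ) (a b : ℝ) : Prop where
  contDiff : ContDiff ℝ ∞ η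
  tsupport_subset : tsupport η ⊆ Ioo a b

lemma IsTestOn.deriv {η : ℝ → ℝ} (hη : IsTestOn η a b) : IsTestOn (deriv η) a b where
  contDiff := contDiff_infty_iff_deriv.1 hη.contDiff |>.2
  tsupport_subset := tsupport_deriv_subset.trans hη.tsupport_subset

/-- `τ` is the weak derivative of `f` in the interval `(a, b)`. -/
def HasWeakDerivOn (f τ : ℝ → ℝ) (a b : ℝ) : Prop :=
  ∀ η, IsTestOn η a b → ∫ s in Ioo a b, f s * deriv η s = -∫ s in Ioo a b, τ s * η s

lemma HasWeakDerivOn.mono (h : HasWeakDerivOn f τ a b) {a' b' : ℝ}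
    (h_sub : Ioo a' b' ⊆ Ioo a b) : HasWeakDerivOn f τ a' b' := by
  intro η hη
  have h_restrict : ∀ F : ℝ → ℝ, (∀ s ∉ Ioo a' b', F s = 0) →
      ∫ s in Ioo a' b', F s = ∫ s in Ioo a b, F s := fun F hF =>
    (setIntegral_eq_of_subset_of_forall_sdiff_eq_zero measurableSet_Ioo h_sub
      fun s hs => hF s hs.2).symm
  have h_deriv : ∀ s ∉ Ioo a' b', deriv η s = 0 := fun s hs =>
    image_eq_zero_of_notMem_tsupport fun h => hs (hη.tsupport_subset (tsupport_deriv_subset h))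
  have h_zero : ∀ s ∉ Ioo a' b', η s = 0 := fun s hs =>
    image_eq_zero_of_notMem_tsupport fun h => hs (hη.tsupport_subset h)
  rw [h_restrict _ fun s hs => by rw [h_deriv s hs, mul_zero],
    h_restrict _ fun s hs => by rw [h_zero s hs, mul_zero]]
  exact h η ⟨hη.contDiff, hη.tsupport_subset.trans h_sub⟩

lemma HasWeakDerivOn.integral_cutoff_sub_cutoff (h : HasWeakDerivOn f τ a b)
    (hf : IntegrableOn f (Ioo a b)) {r y q : ℝ} (hr : 0 < r) (hrq : r < q) (hy : a ≤ y)
    (hyb : y + 2 * q < b) :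
    (∫ s in Ioo a b, f s * deriv (cutoff a r) s) - ∫ s in Ioo a b, f s * deriv (cutoff y q) s =
      -∫ s in Ioo a b, τ s * (cutoff a r s - cutoff y q s) := by
  have hq := hr.trans hrq
  have h_zero : ∀ s ∉ Icc (a + r) (y + 2 * q), cutoff a r s - cutoff y q s = 0 := fun s hs => by
    rw [mem_Icc, not_and_or, not_le, not_le] at hs
    rcases hs with hs | hs
    · rw [cutoff_of_le hr hs.le, cutoff_of_le hq (by linarith), sub_zero]
    · rw [cutoff_of_ge hr (by linarith), cutoff_of_ge hq hs.le, sub_self]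
  have h_supp : tsupport (fun s => cutoff a r s - cutoff y q s) ⊆ Icc (a + r) (y + 2 * q) :=
    closure_minimal (fun s hs => by_contra fun h => hs (h_zero s h)) isClosed_Icc
  rw [← h _ ⟨(contDiff_cutoff a r).sub (contDiff_cutoff y q),
      h_supp.trans (Icc_subset_Ioo (by linarith) hyb)⟩,
    ← integral_sub (integrableOn_mul_deriv_cutoff hf a hr) (integrableOn_mul_deriv_cutoff hf y hq)]
  refine integral_congr_ae (ae_of_all _ fun s => ?_)
  simp only [deriv_fun_sub ((contDiff_cutoff a r).differentiable (by simp) s)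
    ((contDiff_cutoff y q).differentiable (by simp) s), mul_sub]

lemma HasWeakDerivOn.eq_integral_of_tendsto (h : HasWeakDerivOn f τ a b)
    (hf : IntegrableOn f (Ioo a b)) (hτ : IntegrableOn τ (Ioo a b))
    (h_lim : Tendsto f (𝓝[>] a) (𝓝 l)) {y q : ℝ} (hy : a ≤ y) (hq : 0 < q) (hyb : y + 2 * q < b) :
    l = ∫ s in Ioo a b, (f s * deriv (cutoff y q) s - τ s * (1 - cutoff y q s)) := by
  have h_cut : ∀ x r, Continuous (cutoff x r) := fun x r => (contDiff_cutoff x r).continuous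
  have h_abs : ∀ r s, ‖cutoff a r s - cutoff y q s‖ ≤ 1 := fun r s => by
    obtain ⟨⟨h0, h1⟩, h2, h3⟩ := And.intro (cutoff_mem_Icc a r s) (cutoff_mem_Icc y q s)
    rw [Real.norm_eq_abs, abs_le]
    constructor <;> linarith
  have h_test : ∀ᶠ r in 𝓝[>] (0 : ℝ), (∫ s in Ioo a b, f s * deriv (cutoff a r) s) -
      ∫ s in Ioo a b, f s * deriv (cutoff y q) s =
        -∫ s in Ioo a b, τ s * (cutoff a r s - cutoff y q s) := by
    filter_upwards [Ioo_mem_nhdsGT hq] with r hr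
    exact h.integral_cutoff_sub_cutoff hf hr.1 hr.2 hy hyb
  have h_lim_left := (tendsto_setIntegral_mul_deriv_cutoff (by linarith) hf h_lim).sub_const
    (∫ s in Ioo a b, f s * deriv (cutoff y q) s)
  have h_lim_right : Tendsto (fun r => -∫ s in Ioo a b, τ s * (cutoff a r s - cutoff y q s))
      (𝓝[>] 0) (𝓝 (-∫ s in Ioo a b, τ s * (1 - cutoff y q s))) := by
    refine (tendsto_integral_filter_of_dominated_convergence (fun s => ‖τ s‖)
      (.of_forall fun r => hτ.aestronglyMeasurable.mul
        ((h_cut a r).sub (h_cut y q)).aestronglyMeasurable)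
      (.of_forall fun r => ae_of_all _ fun s => ?_) hτ.norm ?_).neg
    · exact (norm_mul _ _).trans_le (mul_le_of_le_one_right (norm_nonneg _) (h_abs r s))
    · filter_upwards [ae_restrict_mem measurableSet_Ioo] with s hs
      exact ((tendsto_cutoff hs.1).sub_const _).const_mul _
  have h_eq := tendsto_nhds_unique (h_lim_left.congr' h_test) h_lim_right
  rw [integral_sub (integrableOn_mul_deriv_cutoff hf y hq) (integrableOn_mul_one_sub_cutoff hτ y q)]
  linarith

lemma HasWeakDerivOn.absolutelyContinuousOnInterval (h : HasWeakDerivOn f τ a b)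
    (hf : ContinuousOn f (Icc a b)) (hτ : IntegrableOn τ (Ioo a b)) (hc : c ∈ Ico a b) :
    AbsolutelyContinuousOnInterval f a c := by
  set q := (b - c) / 3 with hq
  have hq_pos : 0 < q := div_pos (sub_pos.2 hc.2) three_pos
  have hf_int := (hf.integrableOn_Icc (μ := volume)).mono_set Ioo_subset_Icc_self
  set K : ℝ → ℝ := fun s => f s * deriv (cutoff c q) s - τ s * (1 - cutoff c q s)
  have hK : IntegrableOn K (Ioo a b) :=
    (integrableOn_mul_deriv_cutoff hf_int c hq_pos).sub (integrableOn_mul_one_sub_cutoff hτ c q)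
  have hK' : IntervalIntegrable K volume a b :=
    (intervalIntegrable_iff_integrableOn_Ioo_of_le (hc.1.trans hc.2.le)).2 hK
  refine absolutelyContinuousOnInterval_of_eq_integral (τ := -K) (c := ∫ s in a..b, K s) hc.1
    (hK'.mono_set (uIcc_subset_uIcc_left ?_)).neg fun x hx => ?_
  · rw [uIcc_of_le (hc.1.trans hc.2.le)]
    exact ⟨hc.1, hc.2.le⟩
  have hxb : x < b := hx.2.trans_lt hc.2
  have h_sub : Ioo x b ⊆ Ioo a b := Ioo_subset_Ioo_left hx.1
  have h_lim : Tendsto f (𝓝[>] x) (𝓝 (f x)) := by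
    rw [← nhdsWithin_Ioo_eq_nhdsGT hxb]
    exact (hf x ⟨hx.1, hxb.le⟩).mono (h_sub.trans Ioo_subset_Icc_self)
  have h_eq := (h.mono h_sub).eq_integral_of_tendsto (hf_int.mono_set h_sub) (hτ.mono_set h_sub)
    h_lim hx.2 hq_pos (by linarith)
  rw [h_eq, ← integral_Ioc_eq_integral_Ioo, ← intervalIntegral.integral_of_le hxb.le]
  have h_mem : x ∈ uIcc a b := by rw [uIcc_of_le (hc.1.trans hc.2.le)]; exact ⟨hx.1, hxb.le⟩
  rw [← intervalIntegral.integral_add_adjacent_intervals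
    (hK'.mono_set (uIcc_subset_uIcc_left h_mem)) (hK'.mono_set (uIcc_subset_uIcc_right h_mem))]
  simp only [Pi.neg_apply, intervalIntegral.integral_neg]
  ring

end AbsolutelyContinuous

/-! ### Weak directional derivatives -/

namespace IsTest

variable {φ : Plane → ℝ}

lemma differentiable (hφ : IsTest φ) : Differentiable ℝ φ := hφ.1.differentiable (by simp)

lemma fderiv_apply (hφ : IsTest φ) (e : Plane) : IsTest fun x => fderiv ℝ φ x e :=
  ⟨(hφ.1.fderiv_right (m := ∞) (by simp)).clm_apply contDiff_const, hφ.2.fderiv_apply ℝ e⟩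

lemma fderiv_fderiv_comm (hφ : IsTest φ) (x e w : Plane) :
    fderiv ℝ (fun y => fderiv ℝ φ y e) x w = fderiv ℝ (fun y => fderiv ℝ φ y w) x e := by
  have hd : DifferentiableAt ℝ (fderiv ℝ φ) x :=
    (hφ.1.fderiv_right (m := ∞) (by simp)).differentiable (by simp) x
  rw [fderiv_clm_apply hd (differentiableAt_const _), fderiv_clm_apply hd
    (differentiableAt_const _)]
  simpa using second_derivative_symmetric (fun y => (hφ.differentiable y).hasFDerivAt)
    hd.hasFDerivAt w e

lemma indicator {U : Set Plane} (hU : IsOpen U) (hφ : IsTest φ)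
    (h : tsupport φ ∩ closure U ⊆ U) :
    IsTest (U.indicator φ) ∧ tsupport (U.indicator φ) ⊆ U := by
  have hs : tsupport (U.indicator φ) ⊆ tsupport φ ∩ closure U := by
    refine closure_minimal (fun x hx => ?_) ((isClosed_tsupport φ).inter isClosed_closure)
    rw [Function.mem_support, indicator_apply_ne_zero] at hx
    exact ⟨subset_tsupport φ hx.2, subset_closure hx.1⟩
  refine ⟨⟨contDiff_iff_contDiffAt.2 fun x => ?_,
    hφ.2.of_isClosed_subset (isClosed_tsupport _) (hs.trans inter_subset_left)⟩, hs.trans h⟩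
  by_cases hx : x ∈ U
  · exact hφ.1.contDiffAt.congr_of_eventuallyEq (eqOn_indicator.eventuallyEq_of_mem
      (hU.mem_nhds hx))
  · exact contDiffAt_const.congr_of_eventuallyEq
      (notMem_tsupport_iff_eventuallyEq.1 fun h' => hx (h (hs h')))

end IsTest

/-- `g` is the weak derivative of `f` in the direction `e` in the set `U`. -/
structure HasWeakLineDeriv (U : Set Plane) (e : Plane) (f g : Plane → ℝ) : Prop where
  locInt : LocallyIntegrableOn f U
  locInt' : LocallyIntegrableOn g U
  eq : ∀ φ, IsTest φ → tsupport φ ⊆ U → ∫ x in U, f x * fderiv ℝ φ x e = -∫ x in U, g x * φ x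

lemma integrableOn_mul_of_tsupport_inter_closure {U : Set Plane} (hU : IsOpen U)
    {f φ : Plane → ℝ} (hf : LocallyIntegrableOn f U) (hφ : Continuous φ)
    (hc : HasCompactSupport φ) (hs : tsupport φ ∩ closure U ⊆ U) :
    IntegrableOn (fun x => f x * φ x) U := by
  have hK : IsCompact (tsupport φ ∩ closure U) := hc.isCompact.inter_right isClosed_closure
  refine ((hf.integrableOn_compact_subset hs hK).mul_continuousOn hφ.continuousOn
    hK).of_forall_sdiff_eq_zero hU.measurableSet fun x hx => ?_
  rw [image_eq_zero_of_notMem_tsupport fun h => hx.2 ⟨h, subset_closure hx.1⟩, mul_zero]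

lemma setIntegral_mul_of_tsupport_subset {U : Set Plane} {φ : Plane → ℝ} (hs : tsupport φ ⊆ U)
    (f : Plane → ℝ) : ∫ x in U, f x * φ x = ∫ x, f x * φ x :=
  setIntegral_eq_integral_of_forall_compl_eq_zero fun x hx => by
    rw [image_eq_zero_of_notMem_tsupport fun h => hx (hs h), mul_zero]

lemma ae_eq_of_forall_integral_mul_eq {U : Set Plane} (hU : IsOpen U) {f g : Plane → ℝ}
    (hf : LocallyIntegrableOn f U) (hg : LocallyIntegrableOn g U)
    (h : ∀ φ, IsTest φ → tsupport φ ⊆ U → ∫ x in U, f x * φ x = ∫ x in U, g x * φ x) :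
    ∀ᵐ x, x ∈ U → f x = g x := by
  have h_sub := hU.ae_eq_zero_of_integral_contDiff_smul_eq_zero (μ := volume) (hf.sub hg)
    fun φ hφ hc hs => by
      have hi : ∀ {F}, LocallyIntegrableOn F U → IntegrableOn (fun x => F x * φ x) U :=
        fun hF => integrableOn_mul_of_tsupport_inter_closure hU hF hφ.continuous hc
          (inter_subset_left.trans hs)
      calc ∫ x, φ x • (f - g) x = ∫ x in U, (f x * φ x - g x * φ x) := by
            rw [← integral_congr_ae (.of_forall fun x => sub_mul (f x) (g x) (φ x)),
              setIntegral_mul_of_tsupport_subset hs]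
            simp only [smul_eq_mul, Pi.sub_apply, mul_comm]
        _ = 0 := by rw [integral_sub (hi hf) (hi hg), h φ ⟨hφ, hc⟩ hs, sub_self]
  filter_upwards [h_sub] with x hx hxU using sub_eq_zero.1 (hx hxU)

lemma integral_linearComb_mul {U : Set Plane} (hU : IsOpen U) {f g φ : Plane → ℝ}
    (hf : LocallyIntegrableOn f U) (hg : LocallyIntegrableOn g U) (hφ : IsTest φ)
    (hs : tsupport φ ⊆ U) (a b : ℝ) :
    ∫ x in U, (a * f x + b * g x) * φ x =
      a * (∫ x in U, f x * φ x) + b * ∫ x in U, g x * φ x := by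
  have hi : ∀ {F}, LocallyIntegrableOn F U → IntegrableOn (fun x => F x * φ x) U := fun hF =>
    integrableOn_mul_of_tsupport_inter_closure hU hF hφ.1.continuous hφ.2
      (inter_subset_left.trans hs)
  rw [← integral_const_mul, ← integral_const_mul,
    ← integral_add ((hi hf).const_mul a) ((hi hg).const_mul b)]
  congr 1 with x
  ring

lemma hasWeakPartial_iff {U : Set Plane} {j : Fin 2} {f g : Plane → ℝ} :
    HasWeakPartial U j f g ↔ HasWeakLineDeriv U (EuclideanSpace.single j 1) f g :=
  ⟨fun h => ⟨h.locInt, h.locInt', h.eq⟩, fun h => ⟨h.locInt, h.locInt', h.eq⟩⟩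

namespace HasWeakLineDeriv

variable {U V : Set Plane} {e e₁ e₂ : Plane} {f f₁ f₂ g g₁ g₂ : Plane → ℝ}

lemma mono (h : HasWeakLineDeriv U e f g) (hVU : V ⊆ U) : HasWeakLineDeriv V e f g where
  locInt := h.locInt.mono_set hVU
  locInt' := h.locInt'.mono_set hVU
  eq φ hφ hs := by
    have hs' : tsupport (fun x => fderiv ℝ φ x e) ⊆ V :=
      (tsupport_fderiv_apply_subset ℝ e).trans hs
    rw [setIntegral_mul_of_tsupport_subset hs, setIntegral_mul_of_tsupport_subset hs',
      ← setIntegral_mul_of_tsupport_subset (hs.trans hVU),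
      ← setIntegral_mul_of_tsupport_subset (hs'.trans hVU), h.eq φ hφ (hs.trans hVU)]

lemma ae_eq (h₁ : HasWeakLineDeriv U e f g₁) (h₂ : HasWeakLineDeriv U e f g₂) (hU : IsOpen U) :
    ∀ᵐ x, x ∈ U → g₁ x = g₂ x :=
  ae_eq_of_forall_integral_mul_eq hU h₁.locInt' h₂.locInt' fun φ hφ hs =>
    neg_injective ((h₁.eq φ hφ hs).symm.trans (h₂.eq φ hφ hs))

lemma linearComb (h₁ : HasWeakLineDeriv U e f₁ g₁) (h₂ : HasWeakLineDeriv U e f₂ g₂)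
    (hU : IsOpen U) (a b : ℝ) :
    HasWeakLineDeriv U e (fun x => a * f₁ x + b * f₂ x) fun x => a * g₁ x + b * g₂ x where
  locInt := (h₁.locInt.smul a).add (h₂.locInt.smul b)
  locInt' := (h₁.locInt'.smul a).add (h₂.locInt'.smul b)
  eq φ hφ hs := by
    rw [integral_linearComb_mul hU h₁.locInt h₂.locInt (hφ.fderiv_apply e)
        ((tsupport_fderiv_apply_subset ℝ e).trans hs),
      integral_linearComb_mul hU h₁.locInt' h₂.locInt' hφ hs, h₁.eq φ hφ hs, h₂.eq φ hφ hs]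
    ring

lemma linearComb_direction (h₁ : HasWeakLineDeriv U e₁ f g₁) (h₂ : HasWeakLineDeriv U e₂ f g₂)
    (hU : IsOpen U) (a b : ℝ) :
    HasWeakLineDeriv U (a • e₁ + b • e₂) f fun x => a * g₁ x + b * g₂ x where
  locInt := h₁.locInt
  locInt' := (h₁.locInt'.smul a).add (h₂.locInt'.smul b)
  eq φ hφ hs := by
    have hi : ∀ e, IntegrableOn (fun x => f x * fderiv ℝ φ x e) U := fun e =>
      integrableOn_mul_of_tsupport_inter_closure hU h₁.locInt (hφ.fderiv_apply e).1.continuous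
        (hφ.fderiv_apply e).2
        (inter_subset_left.trans ((tsupport_fderiv_apply_subset ℝ e).trans hs))
    calc ∫ x in U, f x * fderiv ℝ φ x (a • e₁ + b • e₂)
        = ∫ x in U, (a * (f x * fderiv ℝ φ x e₁) + b * (f x * fderiv ℝ φ x e₂)) := by
          congr 1 with x
          simp only [map_add, map_smul, smul_eq_mul]
          ring
      _ = a * (∫ x in U, f x * fderiv ℝ φ x e₁) + b * ∫ x in U, f x * fderiv ℝ φ x e₂ := by
          rw [integral_add ((hi e₁).const_mul a) ((hi e₂).const_mul b), integral_const_mul,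
            integral_const_mul]
      _ = -∫ x in U, (a * g₁ x + b * g₂ x) * φ x := by
          rw [integral_linearComb_mul hU h₁.locInt' h₂.locInt' hφ hs, h₁.eq φ hφ hs,
            h₂.eq φ hφ hs]
          ring

/-- The restriction of `φ` to `U`, extended by zero, is again a test function. -/
lemma integral_mul_fderiv (h : HasWeakLineDeriv U e f g) (hU : IsOpen U) {φ : Plane → ℝ}
    (hφ : IsTest φ) (hs : tsupport φ ∩ closure U ⊆ U) :
    ∫ x in U, f x * fderiv ℝ φ x e = -∫ x in U, g x * φ x := by
  obtain ⟨hφU, hsU⟩ := hφ.indicator hU hs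
  calc ∫ x in U, f x * fderiv ℝ φ x e = ∫ x in U, f x * fderiv ℝ (U.indicator φ) x e :=
        setIntegral_congr_fun hU.measurableSet fun x hx => by
          simp only [(eqOn_indicator.eventuallyEq_of_mem (hU.mem_nhds hx)).fderiv_eq]
    _ = -∫ x in U, g x * U.indicator φ x := h.eq _ hφU hsU
    _ = -∫ x in U, g x * φ x := by
        rw [setIntegral_congr_fun (g := fun x => g x * φ x) hU.measurableSet fun x hx => by
          simp only [indicator_of_mem hx]]

end HasWeakLineDeriv

lemma eq_linearComb_single (e : Plane) :
    e 0 • EuclideanSpace.single 0 1 + e 1 • EuclideanSpace.single 1 1 = e := by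
  apply plane_ext <;> simp

lemma HasWeakGrad.hasWeakLineDeriv {U : Set Plane} (hU : IsOpen U) {f : Plane → ℝ}
    {G : Plane → Plane} (hG : HasWeakGrad U f G) (e : Plane) :
    HasWeakLineDeriv U e f fun x => ⟪e, G x⟫_ℝ := by
  simpa only [eq_linearComb_single, ← inner_eq_coords] using
    (hasWeakPartial_iff.1 (hG 0)).linearComb_direction (hasWeakPartial_iff.1 (hG 1)) hU (e 0) (e 1)

lemma MemH1.exists_hasWeakLineDeriv {U : Set Plane} (hU : IsOpen U) {f : Plane → ℝ}
    (hf : MemH1 U f) (e : Plane) :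
    ∃ g, MemLp g 2 (volume.restrict U) ∧ HasWeakLineDeriv U e f g := by
  obtain ⟨g₀, hg₀, hf₀⟩ := hf.2 0
  obtain ⟨g₁, hg₁, hf₁⟩ := hf.2 1
  refine ⟨fun x => e 0 * g₀ x + e 1 * g₁ x, (hg₀.const_mul _).add (hg₁.const_mul _), ?_⟩
  simpa only [eq_linearComb_single] using
    (hasWeakPartial_iff.1 hf₀).linearComb_direction (hasWeakPartial_iff.1 hf₁) hU (e 0) (e 1)

lemma MemH2.exists_hasWeakLineDeriv {U : Set Plane} (hU : IsOpen U) {f : Plane → ℝ}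
    (hf : MemH2 U f) (e w : Plane) :
    ∃ g h, MemLp g 2 (volume.restrict U) ∧ MemLp h 2 (volume.restrict U) ∧
      HasWeakLineDeriv U e f g ∧ HasWeakLineDeriv U w g h := by
  obtain ⟨g₀, hg₀, hf₀⟩ := hf.2 0
  obtain ⟨g₁, hg₁, hf₁⟩ := hf.2 1
  obtain ⟨h₀, hh₀, hw₀⟩ := hg₀.exists_hasWeakLineDeriv hU w
  obtain ⟨h₁, hh₁, hw₁⟩ := hg₁.exists_hasWeakLineDeriv hU w
  refine ⟨fun x => e 0 * g₀ x + e 1 * g₁ x, fun x => e 0 * h₀ x + e 1 * h₁ x,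
    (hg₀.1.const_mul _).add (hg₁.1.const_mul _), (hh₀.const_mul _).add (hh₁.const_mul _), ?_,
    hw₀.linearComb hw₁ hU (e 0) (e 1)⟩
  simpa only [eq_linearComb_single] using
    (hasWeakPartial_iff.1 hf₀).linearComb_direction (hasWeakPartial_iff.1 hf₁) hU (e 0) (e 1)

lemma MemH2.exists_hasWeakGrad {U : Set Plane} {f : Plane → ℝ} (hf : MemH2 U f) :
    ∃ G : Plane → Plane, MemLp G 2 (volume.restrict U) ∧ HasWeakGrad U f G := by
  choose g hg hfg using hf.2
  refine ⟨fun x => WithLp.toLp 2 fun j => g j x, ?_, fun j => hfg j⟩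
  exact MemLp.of_eval_piLp fun j => (hg j).1

/-! ### Oblique coordinates -/

/-- The affine parametrization of the plane with origin `P` and axes `e`, `w`. -/
def par (P e w : Plane) (p : ℝ × ℝ) : Plane := P + p.1 • e + p.2 • w

/-- The first oblique coordinate. -/
def coordS (P e w x : Plane) : ℝ := cross (x - P) w / cross e w

/-- The second oblique coordinate. -/
def coordT (P e w x : Plane) : ℝ := cross e (x - P) / cross e w

section Coordinates

variable {P e w : Plane}

@[fun_prop]
lemma continuous_par : Continuous (par P e w) := by
  unfold par
  fun_prop

lemma contDiff_coordS : ContDiff ℝ ∞ (coordS P e w) := by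
  unfold coordS cross
  simp only [PiLp.sub_apply]
  fun_prop

lemma contDiff_coordT : ContDiff ℝ ∞ (coordT P e w) := by
  unfold coordT cross
  simp only [PiLp.sub_apply]
  fun_prop

variable (hc : cross e w ≠ 0)
include hc

lemma coordS_par (p : ℝ × ℝ) : coordS P e w (par P e w p) = p.1 := by
  rw [coordS, div_eq_iff hc]
  simp only [cross, par, PiLp.sub_apply, PiLp.add_apply, PiLp.smul_apply, smul_eq_mul]
  ring

lemma coordT_par (p : ℝ × ℝ) : coordT P e w (par P e w p) = p.2 := by
  rw [coordT, div_eq_iff hc]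
  simp only [cross, par, PiLp.sub_apply, PiLp.add_apply, PiLp.smul_apply, smul_eq_mul]
  ring

lemma par_coord (x : Plane) : par P e w (coordS P e w x, coordT P e w x) = x := by
  refine smul_right_injective Plane hc ?_
  simp only [par, coordS, coordT, smul_add, smul_smul, mul_div_cancel₀ _ hc]
  rw [add_assoc, ← cross_smul_eq, ← smul_add, add_sub_cancel]

variable (P) in
/-- The parametrization by oblique coordinates as a homeomorphism. -/
def parHomeo : ℝ × ℝ ≃ₜ Plane where
  toFun := par P e w
  invFun x := (coordS P e w x, coordT P e w x)
  left_inv p := Prod.ext (coordS_par hc p) (coordT_par hc p)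
  right_inv x := par_coord hc x
  continuous_toFun := continuous_par
  continuous_invFun := contDiff_coordS.continuous.prodMk contDiff_coordT.continuous

lemma measurableEmbedding_par : MeasurableEmbedding (par P e w) :=
  (parHomeo P hc).measurableEmbedding

lemma map_par_volume :
    Measure.map (par P e w) volume = ENNReal.ofReal |(cross e w)⁻¹| • volume := by
  let L : Plane →ₗ[ℝ] Plane := (EuclideanSpace.proj 0 : Plane →L[ℝ] ℝ).toLinearMap.smulRight e +
    (EuclideanSpace.proj 1 : Plane →L[ℝ] ℝ).toLinearMap.smulRight w
  have h_det : LinearMap.det L = cross e w := by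
    rw [← LinearMap.det_toMatrix (EuclideanSpace.basisFun (Fin 2) ℝ).toBasis, Matrix.det_fin_two]
    simp [LinearMap.toMatrix_apply, L, cross, mul_comm]
  have h_fst_snd : MeasurePreserving
      (fun p : ℝ × ℝ => WithLp.toLp 2 ![p.1, p.2] : ℝ × ℝ → Plane) volume volume :=
    (PiLp.volume_preserving_toLp (Fin 2)).comp (volume_preserving_finTwoArrow ℝ).symm
  have h_par : par P e w = (fun x => P + x) ∘ L ∘
      (fun p : ℝ × ℝ => WithLp.toLp 2 ![p.1, p.2] : ℝ × ℝ → Plane) := by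
    funext p
    simp [par, L, add_assoc]
  have hL : Measurable L := L.continuous_of_finiteDimensional.measurable
  rw [h_par, ← Measure.map_map (measurable_const_add P) (hL.comp h_fst_snd.measurable),
    ← Measure.map_map hL h_fst_snd.measurable, h_fst_snd.map_eq,
    Measure.map_linearMap_addHaar_eq_smul_addHaar volume (by rwa [h_det]), h_det,
    Measure.map_smul, map_add_left_eq_self]

lemma setIntegral_eq_setIntegral_par (U : Set Plane) (F : Plane → ℝ) :
    ∫ x in U, F x = |cross e w| * ∫ p in par P e w ⁻¹' U, F (par P e w p) := by
  rw [← (measurableEmbedding_par hc).setIntegral_map F U, map_par_volume hc,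
    Measure.restrict_smul, integral_smul_measure, ENNReal.toReal_ofReal (abs_nonneg _), abs_inv,
    smul_eq_mul, mul_inv_cancel_left₀ (abs_ne_zero.2 hc)]

lemma integrableOn_comp_par_iff {U : Set Plane} {F : Plane → ℝ} :
    IntegrableOn (F ∘ par P e w) (par P e w ⁻¹' U) ↔ IntegrableOn F U := by
  rw [← (measurableEmbedding_par hc).integrableOn_map_iff, map_par_volume hc, IntegrableOn,
    Measure.restrict_smul, integrable_smul_measure
      (by simpa only [ne_eq, ENNReal.ofReal_eq_zero, not_le, abs_pos, inv_eq_zero] using hc)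
      ENNReal.ofReal_ne_top, IntegrableOn]

end Coordinates

lemma hasFDerivAt_par (P e w : Plane) (p : ℝ × ℝ) :
    HasFDerivAt (par P e w) ((ContinuousLinearMap.fst ℝ ℝ ℝ).smulRight e +
      (ContinuousLinearMap.snd ℝ ℝ ℝ).smulRight w) p :=
  ((hasFDerivAt_fst.smul_const e).const_add P).add (hasFDerivAt_snd.smul_const w)

lemma HasWeakLineDeriv.integral_par {U : Set Plane} (hU : IsOpen U) {P e w : Plane}
    (hc : cross e w ≠ 0) {u : ℝ × ℝ} {f g : Plane → ℝ}
    (h : HasWeakLineDeriv U (u.1 • e + u.2 • w) f g) {Φ : ℝ × ℝ → ℝ} (hΦ : ContDiff ℝ ∞ Φ)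
    (hΦc : HasCompactSupport Φ)
    (hs : tsupport Φ ∩ closure (par P e w ⁻¹' U) ⊆ par P e w ⁻¹' U) :
    ∫ p in par P e w ⁻¹' U, f (par P e w p) * fderiv ℝ Φ p u =
      -∫ p in par P e w ⁻¹' U, g (par P e w p) * Φ p := by
  let T := parHomeo P hc
  have hφ : IsTest (Φ ∘ T.symm) :=
    ⟨hΦ.comp (contDiff_coordS.prodMk contDiff_coordT), hΦc.comp_homeomorph T.symm⟩
  have h_comp (p) : (Φ ∘ T.symm) (par P e w p) = Φ p := congrArg Φ (T.symm_apply_apply p)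
  have h_fderiv (p) : fderiv ℝ (Φ ∘ T.symm) (par P e w p) (u.1 • e + u.2 • w) =
      fderiv ℝ Φ p u := by
    have h_chain := (hφ.differentiable (par P e w p)).hasFDerivAt.comp p (hasFDerivAt_par P e w p)
    rw [show (Φ ∘ T.symm) ∘ par P e w = Φ from funext h_comp] at h_chain
    rw [h_chain.fderiv]
    rfl
  have h_supp : tsupport (Φ ∘ T.symm) ∩ closure U ⊆ U := by
    rintro x ⟨hx, hxU⟩
    rw [tsupport_comp_eq_preimage] at hx
    obtain ⟨p, rfl⟩ := T.surjective x
    rw [mem_preimage, T.symm_apply_apply] at hx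
    exact hs ⟨hx, (T.preimage_closure U).subset hxU⟩
  have h_int := h.integral_mul_fderiv hU hφ h_supp
  rw [setIntegral_eq_setIntegral_par hc (P := P), setIntegral_eq_setIntegral_par hc (P := P) U,
    ← mul_neg] at h_int
  simpa only [h_comp, h_fderiv] using mul_left_cancel₀ (abs_ne_zero.2 hc) h_int

/-! ### Traces on the sides of parallelograms -/

section Rectangle

variable {a b : ℝ} {f g h : ℝ × ℝ → ℝ} {α β : ℝ → ℝ}

/-- `g` is the weak derivative `∂f/∂s` in the rectangle `(0, a) × (0, b)` of the `(s, t)` plane,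
tested against products only. -/
def HasWeakFstDeriv (f g : ℝ × ℝ → ℝ) (a b : ℝ) : Prop :=
  ∀ η ζ, IsTestOn η 0 a → IsTestOn ζ 0 b →
    ∫ p in Ioo 0 a ×ˢ Ioo 0 b, f p * (deriv η p.1 * ζ p.2) =
      -∫ p in Ioo 0 a ×ˢ Ioo 0 b, g p * (η p.1 * ζ p.2)

/-- `g` is the weak derivative `∂f/∂t` in the rectangle `(0, a) × (0, b)` of the `(s, t)` plane,
tested against products only. -/
def HasWeakSndDeriv (f g : ℝ × ℝ → ℝ) (a b : ℝ) : Prop :=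
  ∀ η ζ, IsTestOn η 0 a → IsTestOn ζ 0 b →
    ∫ p in Ioo 0 a ×ˢ Ioo 0 b, f p * (η p.1 * deriv ζ p.2) =
      -∫ p in Ioo 0 a ×ˢ Ioo 0 b, g p * (η p.1 * ζ p.2)

lemma integrableOn_mul_prodMul (hf : IntegrableOn f (Ioo 0 a ×ˢ Ioo 0 b)) (hα : Continuous α)
    (hβ : Continuous β) :
    IntegrableOn (fun p => f p * (α p.1 * β p.2)) (Ioo 0 a ×ˢ Ioo 0 b) :=
  have hαβ : Continuous fun p : ℝ × ℝ => α p.1 * β p.2 := by fun_prop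
  hf.mul_continuousOn_of_subset hαβ.continuousOn
    (measurableSet_Ioo.prod measurableSet_Ioo) (isCompact_Icc.prod isCompact_Icc)
    (prod_mono Ioo_subset_Icc_self Ioo_subset_Icc_self)

lemma setIntegral_mul_prodMul (hf : IntegrableOn f (Ioo 0 a ×ˢ Ioo 0 b)) (hα : Continuous α)
    (hβ : Continuous β) :
    ∫ p in Ioo 0 a ×ˢ Ioo 0 b, f p * (α p.1 * β p.2) =
      ∫ s in Ioo 0 a, (∫ t in Ioo 0 b, f (s, t) * β t) * α s := by
  rw [Measure.volume_eq_prod, setIntegral_prod _ (integrableOn_mul_prodMul hf hα hβ)]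
  simp only [← integral_mul_const, mul_assoc, mul_comm (β _)]

lemma setIntegral_mul_prodMul_swap (hf : IntegrableOn f (Ioo 0 a ×ˢ Ioo 0 b)) (hα : Continuous α)
    (hβ : Continuous β) :
    ∫ p in Ioo 0 a ×ˢ Ioo 0 b, f p * (α p.1 * β p.2) =
      ∫ t in Ioo 0 b, (∫ s in Ioo 0 a, f (s, t) * α s) * β t := by
  have hint := integrableOn_mul_prodMul hf hα hβ
  rw [IntegrableOn, Measure.volume_eq_prod, ← Measure.prod_restrict] at hint
  rw [Measure.volume_eq_prod, ← Measure.prod_restrict, integral_prod_symm _ hint]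
  simp only [← integral_mul_const, mul_assoc]

lemma integrableOn_integral_mul_fst (hf : IntegrableOn f (Ioo 0 a ×ˢ Ioo 0 b))
    (hα : Continuous α) : IntegrableOn (fun t => ∫ s in Ioo 0 a, f (s, t) * α s) (Ioo 0 b) := by
  have hint := integrableOn_mul_prodMul hf hα (continuous_const (y := 1))
  rw [IntegrableOn, Measure.volume_eq_prod, ← Measure.prod_restrict] at hint
  simpa only [IntegrableOn, mul_one] using hint.integral_prod_right

lemma integrableOn_integral_mul_snd (hf : IntegrableOn f (Ioo 0 a ×ˢ Ioo 0 b))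
    (hβ : Continuous β) : IntegrableOn (fun s => ∫ t in Ioo 0 b, f (s, t) * β t) (Ioo 0 a) := by
  have hint := integrableOn_mul_prodMul hf (continuous_const (y := 1)) hβ
  rw [IntegrableOn, Measure.volume_eq_prod, ← Measure.prod_restrict] at hint
  simpa only [IntegrableOn, one_mul] using hint.integral_prod_left

lemma HasWeakFstDeriv.hasWeakDerivOn_integral_mul_deriv (hfg : HasWeakFstDeriv f g a b)
    (hgh : HasWeakSndDeriv g h a b) (hf : IntegrableOn f (Ioo 0 a ×ˢ Ioo 0 b))
    (hh : IntegrableOn h (Ioo 0 a ×ˢ Ioo 0 b)) {η : ℝ → ℝ} (hη : IsTestOn η 0 a) :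
    HasWeakDerivOn (fun t => ∫ s in Ioo 0 a, f (s, t) * deriv η s)
      (fun t => -∫ s in Ioo 0 a, h (s, t) * η s) 0 b := fun ζ hζ => by
  simp only [neg_mul, integral_neg, neg_neg]
  rw [← setIntegral_mul_prodMul_swap hf hη.deriv.contDiff.continuous hζ.deriv.contDiff.continuous,
    ← setIntegral_mul_prodMul_swap hh hη.contDiff.continuous hζ.contDiff.continuous,
    hfg η _ hη hζ.deriv, hgh η ζ hη hζ, neg_neg]

lemma tendsto_integral_mul_slice (hb : 0 < b) (hf : ContinuousOn f (Icc 0 a ×ˢ Icc 0 b))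
    (hα : Continuous α) :
    Tendsto (fun t => ∫ s in Ioo 0 a, f (s, t) * α s) (𝓝[>] 0)
      (𝓝 (∫ s in Ioo 0 a, f (s, 0) * α s)) := by
  obtain ⟨C, hC⟩ := (isCompact_Icc.prod isCompact_Icc).exists_bound_of_continuousOn hf
  have h_slice : ∀ t ∈ Icc 0 b, ContinuousOn (fun s => f (s, t)) (Icc 0 a) := fun t ht =>
    hf.comp (by fun_prop) fun s hs => ⟨hs, ht⟩
  have hα_int : IntegrableOn (fun s => C * ‖α s‖) (Ioo 0 a) :=
    ((continuous_const.mul hα.norm).integrableOn_Icc).mono_set Ioo_subset_Icc_self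
  rw [← nhdsWithin_Ioo_eq_nhdsGT hb]
  refine tendsto_integral_filter_of_dominated_convergence _ ?_ ?_ hα_int ?_
  · filter_upwards [self_mem_nhdsWithin] with t ht
    exact (((h_slice t (Ioo_subset_Icc_self ht)).mono Ioo_subset_Icc_self).mul
      hα.continuousOn).aestronglyMeasurable measurableSet_Ioo
  · filter_upwards [self_mem_nhdsWithin] with t ht
    filter_upwards [ae_restrict_mem measurableSet_Ioo] with s hs
    rw [norm_mul]
    gcongr
    exact hC (s, t) ⟨Ioo_subset_Icc_self hs, Ioo_subset_Icc_self ht⟩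
  · filter_upwards [ae_restrict_mem measurableSet_Ioo] with s hs
    have h_cont : ContinuousOn (fun t => f (s, t)) (Icc 0 b) :=
      hf.comp (by fun_prop) fun t ht => ⟨Ioo_subset_Icc_self hs, ht⟩
    exact ((h_cont 0 ⟨le_rfl, hb.le⟩).mono Ioo_subset_Icc_self).mul_const _

lemma isTestOn_deriv_cutoff {r : ℝ} (hr : 0 < r) (hb : a + 2 * r < b) :
    IsTestOn (deriv (cutoff a r)) a b where
  contDiff := contDiff_infty_iff_deriv.1 (contDiff_cutoff a r) |>.2
  tsupport_subset :=
    (closure_minimal (fun _ (hs : _ ≠ 0) => by_contra fun h => hs (deriv_cutoff_eq_zero hr h))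
      isClosed_Icc).trans (Icc_subset_Ioo (by linarith) hb)

lemma HasWeakFstDeriv.hasWeakDerivOn_side (hb : 0 < b) (hfg : HasWeakFstDeriv f g a b)
    (hgh : HasWeakSndDeriv g h a b) (hf : ContinuousOn f (Icc 0 a ×ˢ Icc 0 b))
    (hg : IntegrableOn g (Ioo 0 a ×ˢ Ioo 0 b)) (hh : IntegrableOn h (Ioo 0 a ×ˢ Ioo 0 b)) :
    ∃ τ, IntegrableOn τ (Ioo 0 a) ∧ HasWeakDerivOn (fun s => f (s, 0)) τ 0 a := by
  have hf_int : IntegrableOn f (Ioo 0 a ×ˢ Ioo 0 b) :=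
    (hf.integrableOn_compact (isCompact_Icc.prod isCompact_Icc)).mono_set
      (prod_mono Ioo_subset_Icc_self Ioo_subset_Icc_self)
  set q := b / 3 with hq
  have hζ : IsTestOn (deriv (cutoff 0 q)) 0 b := isTestOn_deriv_cutoff (by positivity) (by linarith)
  have hζ_cont := hζ.contDiff.continuous
  have hχ_cont : Continuous fun t => 1 - cutoff 0 q t :=
    continuous_const.sub (contDiff_cutoff 0 q).continuous
  have hgζ := integrableOn_integral_mul_snd hg hζ_cont
  have hhχ := integrableOn_integral_mul_snd hh hχ_cont
  refine ⟨_, hgζ.sub hhχ, fun η hη => ?_⟩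
  have hη_cont := hη.contDiff.continuous
  have hη'_cont := hη.deriv.contDiff.continuous
  have hN := integrableOn_integral_mul_fst hf_int hη'_cont
  have hN' := integrableOn_integral_mul_fst hh hη_cont
  have h_side := (hfg.hasWeakDerivOn_integral_mul_deriv hgh hf_int hh hη).eq_integral_of_tendsto
    hN hN'.neg (tendsto_integral_mul_slice hb hf hη'_cont) le_rfl (by positivity : 0 < q)
    (by linarith)
  have h_mul_η : ∀ {k : ℝ → ℝ}, IntegrableOn k (Ioo 0 a) →
      IntegrableOn (fun s => k s * η s) (Ioo 0 a) := fun hk =>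
    hk.mul_continuousOn_of_subset hη_cont.continuousOn measurableSet_Ioo isCompact_Icc
      Ioo_subset_Icc_self
  rw [h_side]
  simp only [neg_mul, sub_neg_eq_add, Pi.sub_apply, sub_mul]
  rw [integral_add (integrableOn_mul_deriv_cutoff hN 0 (by positivity))
      (integrableOn_mul_one_sub_cutoff hN' 0 q),
    integral_sub (h_mul_η hgζ) (h_mul_η hhχ),
    ← setIntegral_mul_prodMul_swap hf_int hη'_cont hζ_cont, hfg η _ hη hζ,
    ← setIntegral_mul_prodMul_swap hh hη_cont hχ_cont,
    setIntegral_mul_prodMul hg hη_cont hζ_cont, setIntegral_mul_prodMul hh hη_cont hχ_cont]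
  ring

end Rectangle

lemma tsupport_prodMul_subset {η ζ : ℝ → ℝ} {a b c d : ℝ} (hη : IsTestOn η a b)
    (hζ : IsTestOn ζ c d) :
    tsupport (fun p : ℝ × ℝ => η p.1 * ζ p.2) ⊆ Ioo a b ×ˢ Ioo c d := by
  refine (closure_minimal (fun p hp => ?_)
    ((isClosed_tsupport η).prod (isClosed_tsupport ζ))).trans
    (prod_mono hη.tsupport_subset hζ.tsupport_subset)
  rw [Function.mem_support, mul_ne_zero_iff] at hp
  exact ⟨subset_tsupport η hp.1, subset_tsupport ζ hp.2⟩

lemma fderiv_prodMul {η ζ : ℝ → ℝ} (hη : Differentiable ℝ η) (hζ : Differentiable ℝ ζ)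
    (p u : ℝ × ℝ) :
    fderiv ℝ (fun p : ℝ × ℝ => η p.1 * ζ p.2) p u =
      u.1 * (deriv η p.1 * ζ p.2) + u.2 * (η p.1 * deriv ζ p.2) := by
  have h := ((hη p.1).hasDerivAt.hasFDerivAt.comp p hasFDerivAt_fst).mul
    ((hζ p.2).hasDerivAt.hasFDerivAt.comp p hasFDerivAt_snd)
  refine (congrArg (fun L : ℝ × ℝ →L[ℝ] ℝ => L u) h.fderiv).trans ?_
  simp only [Function.comp_apply, add_apply, smul_apply,
    ContinuousLinearMap.comp_apply, ContinuousLinearMap.coe_fst', ContinuousLinearMap.coe_snd',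
    ContinuousLinearMap.toSpanSingleton_apply, smul_eq_mul]
  ring

lemma HasWeakLineDeriv.integral_par_prodMul {V : Set Plane} {P e w : Plane}
    (hc : cross e w ≠ 0) {u : ℝ × ℝ} {f g : Plane → ℝ}
    (h : HasWeakLineDeriv V (u.1 • e + u.2 • w) f g) {a b : ℝ}
    (hV : Ioo 0 a ×ˢ Ioo 0 b ⊆ par P e w ⁻¹' V) {η ζ : ℝ → ℝ} (hη : IsTestOn η 0 a)
    (hζ : IsTestOn ζ 0 b) :
    ∫ p in Ioo 0 a ×ˢ Ioo 0 b,
        f (par P e w p) * (u.1 * (deriv η p.1 * ζ p.2) + u.2 * (η p.1 * deriv ζ p.2)) =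
      -∫ p in Ioo 0 a ×ˢ Ioo 0 b, g (par P e w p) * (η p.1 * ζ p.2) := by
  set R : Set (ℝ × ℝ) := Ioo 0 a ×ˢ Ioo 0 b
  have hR_open : IsOpen (par P e w '' R) :=
    (parHomeo P hc).isOpenMap _ (isOpen_Ioo.prod isOpen_Ioo)
  have hR_pre : par P e w ⁻¹' (par P e w '' R) = R :=
    preimage_image_eq _ (parHomeo P hc).injective
  have hΦ : ContDiff ℝ ∞ fun p : ℝ × ℝ => η p.1 * ζ p.2 :=
    (hη.contDiff.comp contDiff_fst).mul (hζ.contDiff.comp contDiff_snd)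
  have hΦ_supp := tsupport_prodMul_subset hη hζ
  have hΦ_compact : HasCompactSupport fun p : ℝ × ℝ => η p.1 * ζ p.2 :=
    (isCompact_Icc.prod isCompact_Icc).of_isClosed_subset (isClosed_tsupport _)
      (hΦ_supp.trans (prod_mono Ioo_subset_Icc_self Ioo_subset_Icc_self))
  have h_int := (h.mono (image_subset_iff.2 hV)).integral_par hR_open hc (P := P) hΦ hΦ_compact
    (by rw [hR_pre]; exact inter_subset_left.trans hΦ_supp)
  simpa only [hR_pre, fderiv_prodMul (hη.contDiff.differentiable (by simp))
    (hζ.contDiff.differentiable (by simp))] using h_int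

lemma integrableOn_comp_par_of_memLp {V : Set Plane} {P e w : Plane} (hc : cross e w ≠ 0)
    {a b : ℝ} (hV : Ioo 0 a ×ˢ Ioo 0 b ⊆ par P e w ⁻¹' V) {F : Plane → ℝ}
    (hF : MemLp F 2 (volume.restrict V)) :
    IntegrableOn (F ∘ par P e w) (Ioo 0 a ×ˢ Ioo 0 b) := by
  set R : Set (ℝ × ℝ) := Ioo 0 a ×ˢ Ioo 0 b
  rw [← preimage_image_eq R (parHomeo P hc).injective]
  refine (integrableOn_comp_par_iff hc).2 ?_
  have h_compact : IsCompact (par P e w '' Icc 0 a ×ˢ Icc 0 b) :=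
    (isCompact_Icc.prod isCompact_Icc).image continuous_par
  have h_finite : volume (par P e w '' R) < ⊤ :=
    (measure_mono (image_mono (Set.prod_mono Ioo_subset_Icc_self Ioo_subset_Icc_self))).trans_lt
      h_compact.measure_lt_top
  have : IsFiniteMeasure (volume.restrict (par P e w '' R)) :=
    isFiniteMeasure_restrict.2 h_finite.ne
  exact (hF.mono_measure (Measure.restrict_mono (image_subset_iff.2 hV) le_rfl)).integrable
    one_le_two

lemma MemH2.absolutelyContinuous_side {V : Set Plane} (hV_open : IsOpen V) {v : Plane → ℝ}
    (hv : MemH2 V v) {P e w : Plane} (hc : cross e w ≠ 0) {a b c : ℝ} (hb : 0 < b)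
    (hV : Ioo 0 a ×ˢ Ioo 0 b ⊆ par P e w ⁻¹' V)
    (hv_cont : ContinuousOn (v ∘ par P e w) (Icc 0 a ×ˢ Icc 0 b)) (hca : c ∈ Ico 0 a) :
    AbsolutelyContinuousOnInterval (fun s => v (P + s • e)) 0 c := by
  obtain ⟨g, h, hg, hh, hvg, hgh⟩ := hv.exists_hasWeakLineDeriv hV_open e w
  have h_fst : HasWeakFstDeriv (v ∘ par P e w) (g ∘ par P e w) a b := fun η ζ hη hζ => by
    simpa using HasWeakLineDeriv.integral_par_prodMul hc (u := (1, 0)) (by simpa using hvg) hV hη hζ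
  have h_snd : HasWeakSndDeriv (g ∘ par P e w) (h ∘ par P e w) a b := fun η ζ hη hζ => by
    simpa using HasWeakLineDeriv.integral_par_prodMul hc (u := (0, 1)) (by simpa using hgh) hV hη hζ
  obtain ⟨τ, hτ, h_side⟩ := h_fst.hasWeakDerivOn_side hb h_snd hv_cont
    (integrableOn_comp_par_of_memLp hc hV hg) (integrableOn_comp_par_of_memLp hc hV hh)
  have h_cont : ContinuousOn (fun s => (v ∘ par P e w) (s, 0)) (Icc 0 a) :=
    hv_cont.comp (by fun_prop) fun s hs => ⟨hs, le_rfl, hb.le⟩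
  simpa [par] using h_side.absolutelyContinuousOnInterval h_cont hτ hca

/-! ### Sectors off the interface -/

/-- Close to `x`, an open sector with vertex `x` and with the half-line in direction `e` as one of
its sides lies in `U`. -/
def HasSectorAt (U : Set Plane) (x e : Plane) : Prop :=
  ∃ w, cross e w ≠ 0 ∧ ∀ᶠ p in 𝓝[>] (0 : ℝ) ×ˢ 𝓝[>] (0 : ℝ), par x e w p ∈ U

section Sectors

variable {U V K : Set Plane} {x e d : Plane} {c : ℝ → Plane}

lemma tendsto_par_nhdsGT (x e w : Plane) :
    Tendsto (par x e w) (𝓝[>] (0 : ℝ) ×ˢ 𝓝[>] (0 : ℝ)) (𝓝 x) := by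
  have h : Tendsto (par x e w) (𝓝 (0, 0)) (𝓝 x) := by
    simpa [par] using (continuous_par (P := x) (e := e) (w := w)).tendsto (0, 0)
  rw [nhds_prod_eq] at h
  exact h.mono_left (Filter.prod_mono nhdsWithin_le_nhds nhdsWithin_le_nhds)

lemma eventually_fst_snd_pos :
    ∀ᶠ p : ℝ × ℝ in 𝓝[>] (0 : ℝ) ×ˢ 𝓝[>] (0 : ℝ), 0 < p.1 ∧ 0 < p.2 :=
  prod_mem_prod self_mem_nhdsWithin self_mem_nhdsWithin

lemma HasSectorAt.inter_nhds (h : HasSectorAt U x e) (hV : V ∈ 𝓝 x) :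
    HasSectorAt (U ∩ V) x e := by
  obtain ⟨w, hc, hw⟩ := h
  exact ⟨w, hc, hw.and (tendsto_par_nhdsGT x e w hV)⟩

lemma HasSectorAt.mono (h : HasSectorAt U x e) (hUV : U ⊆ V) : HasSectorAt V x e := by
  obtain ⟨w, hc, hw⟩ := h
  exact ⟨w, hc, hw.mono fun _ hp => hUV hp⟩

lemma hasDerivAt_cross_sub {t : ℝ} (hc : HasDerivAt c d t) (a x : Plane) :
    HasDerivAt (fun t => cross a (c t - x)) (cross a d) t := by
  have hi (i : Fin 2) : HasDerivAt (fun t => c t i) (d i) t :=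
    (EuclideanSpace.proj i : Plane →L[ℝ] ℝ).hasFDerivAt.comp_hasDerivAt t hc
  exact (((hi 1).sub_const (x 1)).const_mul (a 0)).sub (((hi 0).sub_const (x 0)).const_mul (a 1))

/-- The complementary sector is spanned by `e` and `e + d`: along the curve, the component in
direction `e` is of smaller order than the component in direction `d`. -/
lemma hasSectorAt_compl_of_transversal {t₀ : ℝ} (hc : HasDerivAt c d t₀)
    (hK : 𝓝[K] (c t₀) ≤ map c (𝓝 t₀)) (hed : cross e d ≠ 0) : HasSectorAt Kᶜ (c t₀) e := by
  have h_small : ∀ᶠ t in 𝓝 t₀, |cross d (c t - c t₀)| ≤ |cross e (c t - c t₀)| := by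
    have h_iso : (fun t => t - t₀) =O[𝓝 t₀] fun t => cross e (c t - c t₀) := by
      simpa [cross, Function.comp_def] using
        ((hasDerivAt_cross_sub hc e (c t₀)).isTheta_sub hed).isBigO_symm
    have h₁ := (hasDerivAt_iff_isLittleO.1 (hasDerivAt_cross_sub hc d (c t₀))).trans_isBigO h_iso
    refine (h₁.bound one_pos).mono fun t ht => ?_
    simpa [cross, mul_comm] using ht
  have h_near : ∀ᶠ y in 𝓝 (c t₀), y ∈ K → |cross d (y - c t₀)| ≤ |cross e (y - c t₀)| :=
    eventually_nhdsWithin_iff.1 (hK (eventually_map.2 h_small))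
  refine ⟨e + d, by simpa [cross, mul_add, mul_comm] using hed, ?_⟩
  filter_upwards [tendsto_par_nhdsGT (c t₀) e (e + d) h_near, eventually_fst_snd_pos]
    with p hp ⟨hp₁, hp₂⟩ hpK
  have h_le := hp hpK
  have h₁ : cross d (par (c t₀) e (e + d) p - c t₀) = -((p.1 + p.2) * cross e d) := by
    simp [cross, par]; ring
  have h₂ : cross e (par (c t₀) e (e + d) p - c t₀) = p.2 * cross e d := by
    simp [cross, par]; ring
  rw [h₁, h₂, abs_neg, abs_mul, abs_mul, abs_of_pos hp₂, abs_of_pos (add_pos hp₁ hp₂)] at h_le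
  nlinarith [abs_pos.2 hed]

lemma exists_eventually_mul_pos {g : ℝ → ℝ} (hg : Continuous g) {a : ℝ}
    (h : ∀ᶠ t in 𝓝[>] a, g t ≠ 0) : ∃ σ ≠ 0, ∀ᶠ t in 𝓝[>] a, 0 < σ * g t := by
  obtain ⟨u, hu, h_ne⟩ := mem_nhdsGT_iff_exists_Ioo_subset.1 h
  obtain ⟨m, hm⟩ := nonempty_Ioo.2 (mem_Ioi.1 hu)
  have hm0 : g m ≠ 0 := h_ne hm
  refine ⟨g m, hm0, mem_of_superset (Ioo_mem_nhdsGT hu) fun t ht => ?_⟩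
  by_contra h_le
  obtain ⟨s, hs, hs0⟩ := isPreconnected_Ioo.intermediate_value ht hm
    (hg.const_mul (g m)).continuousOn ⟨not_lt.1 h_le, mul_self_nonneg (g m)⟩
  exact mul_ne_zero hm0 (h_ne hs) hs0

lemma eq_smul_of_cross_eq_zero (he : e ≠ 0) (h : cross e x = 0) :
    x = (⟪e, x⟫_ℝ / ⟪e, e⟫_ℝ) • e := by
  have hee : ⟪e, e⟫_ℝ ≠ 0 := inner_self_ne_zero.2 he
  have h' : e 0 * x 1 = e 1 * x 0 := sub_eq_zero.1 h
  apply plane_ext <;>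
    rw [PiLp.smul_apply, smul_eq_mul, div_mul_eq_mul_div, eq_div_iff hee] <;>
    simp only [inner_eq_coords]
  · linear_combination -(e 1) * h'
  · linear_combination e 0 * h'

lemma eventually_sign_inner_sub_eq (hc : HasDerivAt c e 0) (he : e ≠ 0) :
    ∀ᶠ t in 𝓝 (0 : ℝ), SignType.sign ⟪e, c t - c 0⟫_ℝ = SignType.sign t := by
  have h_inner : HasDerivAt (fun t => ⟪e, c t - c 0⟫_ℝ) ⟪e, e⟫_ℝ 0 := by
    simpa using (hasDerivAt_const (0 : ℝ) e).inner ℝ (hc.sub_const (c 0))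
  have h_pos : 0 < deriv (fun t => ⟪e, c t - c 0⟫_ℝ) 0 :=
    h_inner.deriv.symm ▸ real_inner_self_pos.2 he
  exact (eventually_nhdsWithin_sign_eq_of_deriv_pos h_pos (by simp)).mono
    fun t ht => by rwa [sub_zero] at ht

lemma eventually_cross_sub_ne_zero (hc_cont : Continuous c) (hc : HasDerivAt c e 0) (he : e ≠ 0)
    (h_off : ∀ᶠ s in 𝓝[>] (0 : ℝ), c 0 + s • e ∉ range c) :
    ∀ᶠ t in 𝓝[>] (0 : ℝ), cross e (c t - c 0) ≠ 0 := by
  have h_lim : Tendsto (fun t => ⟪e, c t - c 0⟫_ℝ / ⟪e, e⟫_ℝ) (𝓝[>] 0) (𝓝[>] 0) := by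
    refine tendsto_nhdsWithin_iff.2 ⟨?_, ?_⟩
    · have h_cont : Continuous fun t => ⟪e, c t - c 0⟫_ℝ / ⟪e, e⟫_ℝ := by fun_prop
      simpa using (h_cont.tendsto 0).mono_left nhdsWithin_le_nhds
    · filter_upwards [nhdsWithin_le_nhds (eventually_sign_inner_sub_eq hc he),
        self_mem_nhdsWithin] with t ht ht0
      exact div_pos (sign_eq_one_iff.1 (ht.trans (sign_eq_one_iff.2 ht0)))
        (real_inner_self_pos.2 he)
  filter_upwards [h_lim h_off] with t ht h0
  refine ht ⟨t, ?_⟩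
  rw [← eq_smul_of_cross_eq_zero he h0, add_sub_cancel]

/-- Along the part of the curve that leaves `c 0` in direction `e`, the component of `c t - c 0`
normal to `e` has a constant sign; the complementary sector is the one on the other side. -/
lemma hasSectorAt_compl_of_tangent (hc_cont : Continuous c) (hc : HasDerivAt c e 0) (he : e ≠ 0)
    (hK : 𝓝[K] (c 0) ≤ map c (𝓝 0))
    (h_off : ∀ᶠ s in 𝓝[>] (0 : ℝ), c 0 + s • e ∉ range c) : HasSectorAt Kᶜ (c 0) e := by
  have hee : 0 < ⟪e, e⟫_ℝ := real_inner_self_pos.2 he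
  obtain ⟨σ, hσ, h_side⟩ := exists_eventually_mul_pos
    (g := fun t => cross e (c t - c 0)) (by unfold cross; fun_prop)
    (eventually_cross_sub_ne_zero hc_cont hc he h_off)
  have h_near : ∀ᶠ y in 𝓝[K] (c 0), 0 < ⟪e, y - c 0⟫_ℝ → 0 < σ * cross e (y - c 0) := by
    refine hK (eventually_map.2 ?_)
    filter_upwards [eventually_nhdsWithin_iff.1 h_side, eventually_sign_inner_sub_eq hc he]
      with t ht hs hft
    exact ht (sign_eq_one_iff.1 (hs.symm.trans (sign_eq_one_iff.2 hft)))
  have hc_rot : cross e (σ • rot e) = -(σ * ⟪e, e⟫_ℝ) := by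
    simp only [cross, rot_apply, PiLp.smul_apply, smul_eq_mul, inner_eq_coords]
    simp; ring
  refine ⟨σ • rot e, hc_rot ▸ neg_ne_zero.2 (mul_ne_zero hσ hee.ne'), ?_⟩
  filter_upwards [tendsto_par_nhdsGT (c 0) e (σ • rot e) (eventually_nhdsWithin_iff.1 h_near),
    eventually_fst_snd_pos] with p hp ⟨hp₁, hp₂⟩ hpK
  have h_in : ⟪e, par (c 0) e (σ • rot e) p - c 0⟫_ℝ = p.1 * ⟪e, e⟫_ℝ := by
    rw [inner_eq_coords, inner_eq_coords]
    simp [par, rot_apply]; ring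
  have h_cr : cross e (par (c 0) e (σ • rot e) p - c 0) = p.2 * cross e (σ • rot e) := by
    simp [par, cross]; ring
  have h := hp hpK (h_in ▸ mul_pos hp₁ hee)
  rw [h_cr, hc_rot] at h
  nlinarith [mul_pos hp₂ (mul_pos (sq_pos_of_ne_zero hσ) hee)]

end Sectors

section Edges

variable {ι : Type*} {M : Mesh ι} (S : Interface M) {x e : Plane}

/-- The curve is the homeomorphic image of a circle. -/
lemma Interface.nhdsWithin_curve_le (t₀ : ℝ) : 𝓝[S.curve] (S.γ t₀) ≤ map S.γ (𝓝 t₀) := by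
  set f : AddCircle (1 : ℝ) → Plane := S.periodic.lift
  have hf : Continuous f := S.smooth.continuous.quotient_lift _
  have hf_inj : Function.Injective f := by
    intro p q hpq
    obtain ⟨s, hs, rfl⟩ := (AddCircle.coe_image_Ico_eq (1 : ℝ) 0).symm ▸ mem_univ p
    obtain ⟨t, ht, rfl⟩ := (AddCircle.coe_image_Ico_eq (1 : ℝ) 0).symm ▸ mem_univ q
    rw [zero_add] at hs ht
    exact congrArg _ (S.simple hs ht hpq)
  have h_comp : f ∘ ((↑) : ℝ → AddCircle (1 : ℝ)) = S.γ := rfl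
  have h_range : range f = S.curve := by
    rw [Interface.curve, ← h_comp, (QuotientAddGroup.mk_surjective).range_comp]
  have h := (hf.isClosedEmbedding hf_inj).isEmbedding.map_nhds_eq (t₀ : AddCircle (1 : ℝ))
  rw [h_range, QuotientAddGroup.nhds_eq, map_map] at h
  exact h.ge

lemma Interface.hasSectorAt_compl_curve (hx : x ∈ S.curve) (he : e ≠ 0)
    (h_off : ∀ᶠ s in 𝓝[>] (0 : ℝ), x + s • e ∉ S.curve) : HasSectorAt S.curveᶜ x e := by
  obtain ⟨t₀, rfl⟩ := hx
  have hγ : HasDerivAt S.γ (deriv S.γ t₀) t₀ := (S.smooth.differentiable (by simp) t₀).hasDerivAt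
  by_cases h_tangent : cross e (deriv S.γ t₀) = 0
  swap
  · exact hasSectorAt_compl_of_transversal hγ (S.nhdsWithin_curve_le t₀) h_tangent
  obtain ⟨κ, hκ⟩ : ∃ κ : ℝ, deriv S.γ t₀ = κ • e := ⟨_, eq_smul_of_cross_eq_zero he h_tangent⟩
  have hκ0 : κ ≠ 0 := by
    rintro rfl
    exact S.regular t₀ (by rw [hκ, zero_smul])
  set θ : ℝ ≃ₜ ℝ := affineHomeomorph κ⁻¹ t₀ (inv_ne_zero hκ0)
  have hθ (t : ℝ) : θ t = κ⁻¹ * t + t₀ := rfl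
  have hθ0 : θ 0 = t₀ := by simp [hθ]
  have h := hasSectorAt_compl_of_tangent (c := S.γ ∘ θ) (K := S.curve) (e := e)
    (S.smooth.continuous.comp θ.continuous) ?_ he ?_ ?_
  · simpa only [Function.comp_apply, hθ0] using h
  · have hθ' : HasDerivAt θ κ⁻¹ 0 := by
      refine HasDerivAt.congr_deriv (f := fun t => κ⁻¹ * t + t₀) ?_ (mul_one κ⁻¹)
      exact ((hasDerivAt_id (0 : ℝ)).const_mul κ⁻¹).add_const t₀
    rw [← hθ0] at hγ
    have h := hγ.scomp (0 : ℝ) hθ'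
    rwa [hθ0, hκ, smul_smul, inv_mul_cancel₀ hκ0, one_smul] at h
  · rw [← map_map, θ.map_nhds_eq, Function.comp_apply, hθ0]
    exact S.nhdsWithin_curve_le t₀
  · rwa [Function.comp_apply, hθ0, θ.surjective.range_comp]

lemma Interface.isClosed_curve : IsClosed S.curve :=
  (S.periodic.compact_of_continuous one_ne_zero S.smooth.continuous).isClosed

lemma Mesh.coord_eq_zero_of_mem_edge {i : ι} {k : Fin 3} (hx : x ∈ M.edge i k) :
    (M.basis i).coord k x = 0 := by
  rw [Mesh.edge, segment_eq_image_lineMap] at hx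
  obtain ⟨s, -, rfl⟩ := hx
  have h_vertex {j : Fin 3} (hj : k ≠ j) : (M.basis i).coord k (M.A i j) = 0 := by
    simpa only [M.coe_basis] using (M.basis i).coord_apply_ne hj
  rw [AffineMap.apply_lineMap, h_vertex (by fin_cases k <;> decide),
    h_vertex (by fin_cases k <;> decide), AffineMap.lineMap_same_apply]

lemma Mesh.edge_subset_frontier (i : ι) (k : Fin 3) : M.edge i k ⊆ frontier (M.tri i) :=
  fun _ hx => ⟨subset_closure (M.edge_subset_tri i k hx), fun h =>
    (M.mem_interior_tri_iff.1 h k).ne' (M.coord_eq_zero_of_mem_edge hx)⟩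

lemma Mesh.interior_tri_subset_domain (i : ι) : interior (M.tri i) ⊆ M.domain :=
  interior_mono (subset_iUnion _ i)

lemma Mesh.hasSectorAt_interior_tri {i : ι} {k : Fin 3} {y : Plane} (hx : x ∈ M.edge i k)
    (hy : y ∈ M.edge i k) (hyx : y ≠ x) : HasSectorAt (interior (M.tri i)) x (y - x) := by
  obtain ⟨z, hz⟩ := M.interior_tri_nonempty i
  refine ⟨z - x, fun h => ?_, ?_⟩
  · have hzk := M.mem_interior_tri_iff.1 hz k
    have h_line := affineMap_vertex_add ((M.basis i).coord k) x y z 0 1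
    rw [eq_smul_of_cross_eq_zero (sub_ne_zero.2 hyx) h, one_smul, zero_smul, add_zero] at h_line
    have h_edge := affineMap_vertex_add ((M.basis i).coord k) x y x
      (⟪y - x, z - x⟫_ℝ / ⟪y - x, y - x⟫_ℝ) 0
    rw [zero_smul, add_zero] at h_edge
    rw [h_line] at h_edge
    simp only [M.coord_eq_zero_of_mem_edge hx, M.coord_eq_zero_of_mem_edge hy] at h_edge
    linarith
  · have h_half : ∀ᶠ s in 𝓝[>] (0 : ℝ), s < 1 / 2 :=
      nhdsWithin_le_nhds (eventually_lt_nhds (by norm_num))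
    filter_upwards [prod_mem_prod h_half h_half, eventually_fst_snd_pos] with p hp ⟨hp₁, hp₂⟩
    obtain ⟨hs, ht⟩ : p.1 < 1 / 2 ∧ p.2 < 1 / 2 := hp
    refine M.mem_interior_tri_iff.2 fun j => ?_
    rw [par, affineMap_vertex_add]
    have hxj := M.mem_tri_iff.1 (M.edge_subset_tri i k hx) j
    have hyj := M.mem_tri_iff.1 (M.edge_subset_tri i k hy) j
    have hzj := M.mem_interior_tri_iff.1 hz j
    nlinarith [mul_pos hp₂ hzj, mul_nonneg hp₁.le hyj,
      mul_nonneg (show 0 ≤ 1 - p.1 - p.2 by linarith) hxj]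

lemma Interface.hasSectorAt_of_mem_edge {i : ι} {k : Fin 3} {y : Plane} (hx : x ∈ M.edge i k)
    (hy : y ∈ M.edge i k) (hyx : y ≠ x) : HasSectorAt (S.Ωm ∪ S.Ωp) x (y - x) := by
  rw [S.union]
  by_cases hx_cut : x ∈ closure (S.curve ∩ interior (M.tri i))
  swap
  · refine ((M.hasSectorAt_interior_tri hx hy hyx).inter_nhds
      (isClosed_closure.isOpen_compl.mem_nhds hx_cut)).mono fun z hz => ?_
    exact ⟨M.interior_tri_subset_domain i hz.1, fun hzc => hz.2 (subset_closure ⟨hzc, hz.1⟩)⟩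
  have hxc : x ∈ S.curve := S.isClosed_curve.closure_subset_iff.2 inter_subset_left hx_cut
  have h_cut : S.IsCut i := closure_nonempty_iff.1 ⟨x, hx_cut⟩
  have h_sector : HasSectorAt S.curveᶜ x (y - x) := by
    refine S.hasSectorAt_compl_curve hxc (sub_ne_zero.2 hyx) ?_
    have h_lim : Tendsto (fun s : ℝ => x + s • (y - x)) (𝓝[>] 0) (𝓝[≠] x) := by
      refine tendsto_nhdsWithin_iff.2 ⟨?_, ?_⟩
      · have h_cont : Continuous fun s : ℝ => x + s • (y - x) := by fun_prop
        simpa using (h_cont.tendsto 0).mono_left nhdsWithin_le_nhds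
      · filter_upwards [self_mem_nhdsWithin] with s hs
        simpa [sub_eq_zero, hyx] using (mem_Ioi.1 hs).ne'
    have h_notMem := h_lim (nhdsNE_le_cofinite x (toFinite {S.D i, S.E i}).compl_mem_cofinite)
    filter_upwards [h_notMem, Ioo_mem_nhdsGT one_pos] with s hs hs01 hsc
    refine hs ?_
    rw [← S.inter i h_cut]
    exact ⟨hsc, M.edge_subset_frontier i k
      ((convex_segment _ _).add_smul_sub_mem hx hy ⟨hs01.1.le, hs01.2.le⟩)⟩
  exact (h_sector.inter_nhds (isOpen_interior.mem_nhds (S.subset_domain hxc))).mono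
    fun z hz => ⟨hz.2, hz.1⟩

/-! ### Absolute continuity along the edges -/

lemma absolutelyContinuousOnInterval_comp_mul_add {g : ℝ → ℝ} {a b m k : ℝ}
    (hg : AbsolutelyContinuousOnInterval g (m * a + k) (m * b + k)) :
    AbsolutelyContinuousOnInterval (fun s => g (m * s + k)) a b := by
  wlog hab : a ≤ b generalizing a b
  · exact (this hg.symm (not_le.1 hab).le).symm
  refine absolutelyContinuousOnInterval_of_eq_integral (τ := fun t => m * deriv g (m * t + k)) hab
    (c := g (m * a + k)) ?_ fun x hx => ?_
  · rcases eq_or_ne m 0 with rfl | hm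
    · simp
    · have h := (hg.intervalIntegrable_deriv.comp_add_right k).comp_mul_left (c := m)
      simp only [add_sub_cancel_right, mul_div_cancel_left₀ _ hm] at h
      exact h.const_mul m
  · rw [intervalIntegral.integral_const_mul, intervalIntegral.mul_integral_comp_mul_add,
      (hg.mono ?_).integral_deriv_eq_sub, add_sub_cancel]
    refine uIcc_subset_uIcc_left (mem_uIcc.2 ?_)
    rcases le_total 0 m with hm | hm
    · exact Or.inl ⟨by nlinarith [hx.1], by nlinarith [hx.2]⟩
    · exact Or.inr ⟨by nlinarith [hx.2], by nlinarith [hx.1]⟩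

lemma Interface.exists_absolutelyContinuous {v : Plane → ℝ}
    (hv : ContinuousOn v (closure M.domain)) (hvm : MemH2 S.Ωm v) (hvp : MemH2 S.Ωp v)
    (h : HasSectorAt (S.Ωm ∪ S.Ωp) x e) :
    ∃ a > 0, AbsolutelyContinuousOnInterval (fun s => v (x + s • e)) 0 a := by
  obtain ⟨w, hc, hw⟩ := h
  obtain ⟨b, hb, hbU⟩ := (nhdsGT_basis (0 : ℝ)).prod_self.eventually_iff.1 hw
  have hb' : (0 : ℝ) < b := hb
  have h_closure : MapsTo (par x e w) (Icc 0 b ×ˢ Icc 0 b) (closure M.domain) := by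
    have h_open : MapsTo (par x e w) (Ioo 0 b ×ˢ Ioo 0 b) M.domain := fun p hp =>
      (S.union.subset (hbU hp)).1
    simpa only [closure_prod_eq, closure_Ioo hb'.ne] using h_open.closure continuous_par
  have hv_par : ContinuousOn (v ∘ par x e w) (Icc 0 b ×ˢ Icc 0 b) :=
    hv.comp continuous_par.continuousOn h_closure
  have h_connected : IsPreconnected (par x e w '' (Ioo 0 b ×ˢ Ioo 0 b)) :=
    (isPreconnected_Ioo.prod isPreconnected_Ioo).image _ continuous_par.continuousOn
  have h_half : b / 2 ∈ Ico 0 b := ⟨by linarith, by linarith⟩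
  refine ⟨b / 2, by linarith, ?_⟩
  rcases h_connected.subset_or_subset S.isOpen_m S.isOpen_p S.disjoint
    (image_subset_iff.2 fun p hp => hbU hp) with h | h
  · exact hvm.absolutelyContinuous_side S.isOpen_m hc hb' (image_subset_iff.1 h) hv_par h_half
  · exact hvp.absolutelyContinuous_side S.isOpen_p hc hb' (image_subset_iff.1 h) hv_par h_half

theorem Interface.absolutelyContinuous_edge {v : Plane → ℝ}
    (hv : ContinuousOn v (closure M.domain)) (hvm : MemH2 S.Ωm v) (hvp : MemH2 S.Ωp v)
    (i : ι) (k : Fin 3) :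
    AbsolutelyContinuousOnInterval
      (fun s => v (AffineMap.lineMap (M.A i (k + 1)) (M.A i (k + 2)) s)) 0 1 := by
  set l : ℝ →ᵃ[ℝ] Plane := AffineMap.lineMap (M.A i (k + 1)) (M.A i (k + 2))
  have hl_edge : ∀ s ∈ Icc (0 : ℝ) 1, l s ∈ M.edge i k := fun s hs => by
    rw [Mesh.edge, segment_eq_image_lineMap]
    exact mem_image_of_mem _ hs
  have hl_inj : Function.Injective l := AffineMap.lineMap_injective ℝ
    ((M.affineIndep i).injective.ne (by fin_cases k <;> decide))
  have h_local : ∀ s₀ ∈ Icc (0 : ℝ) 1, ∀ s₁ ∈ Icc (0 : ℝ) 1, s₁ ≠ s₀ →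
      ∃ a > 0, AbsolutelyContinuousOnInterval (fun s => v (l s)) s₀ (s₀ + a * (s₁ - s₀)) := by
    intro s₀ hs₀ s₁ hs₁ hs
    obtain ⟨a, ha, hac⟩ := S.exists_absolutelyContinuous hv hvm hvp
      (S.hasSectorAt_of_mem_edge (hl_edge s₀ hs₀) (hl_edge s₁ hs₁) (hl_inj.ne hs))
    refine ⟨a, ha, ?_⟩
    have hs' := sub_ne_zero.2 hs
    convert absolutelyContinuousOnInterval_comp_mul_add (a := s₀) (b := s₀ + a * (s₁ - s₀))
      (m := (s₁ - s₀)⁻¹) (k := -(s₁ - s₀)⁻¹ * s₀) (hac.mono ?_) using 3 with s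
    · simp only [l, AffineMap.lineMap_apply_module']
      match_scalars <;> field_simp <;> ring
    · have h_left : (s₁ - s₀)⁻¹ * s₀ + -(s₁ - s₀)⁻¹ * s₀ = 0 := by ring
      have h_right : (s₁ - s₀)⁻¹ * (s₀ + a * (s₁ - s₀)) + -(s₁ - s₀)⁻¹ * s₀ = a := by
        field_simp; ring
      rw [h_left, h_right]
  refine absolutelyContinuousOnInterval_of_locally zero_le_one (fun s hs => ?_) fun s hs => ?_
  · obtain ⟨a, ha, hac⟩ := h_local s ⟨hs.1, hs.2.le⟩ 1 ⟨zero_le_one, le_rfl⟩ hs.2.ne'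
    exact ⟨_, by nlinarith [hs.2], hac⟩
  · obtain ⟨a, ha, hac⟩ := h_local s ⟨hs.1.le, hs.2⟩ 0 ⟨le_rfl, zero_le_one⟩ hs.1.ne
    exact ⟨_, by nlinarith [hs.1], hac.symm⟩

end Edges

/-! ### Green's formula for gradients on one side of a segment -/

section Green

variable {U K : Set Plane} {P e w : Plane} {v φ q F : Plane → ℝ} {G : Plane → Plane}

lemma HasWeakLineDeriv.integral_mul_bracket {g_e g_w : Plane → ℝ}
    (he : HasWeakLineDeriv U e v g_e) (hw : HasWeakLineDeriv U w v g_w) (hU : IsOpen U)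
    (hφ : IsTest φ) (hq : ContDiff ℝ ∞ q) (hs : tsupport φ ∩ tsupport q ∩ closure U ⊆ U) :
    ∫ x in U, q x * (g_e x * fderiv ℝ φ x w - g_w x * fderiv ℝ φ x e) =
      ∫ x in U, v x * (fderiv ℝ q x w * fderiv ℝ φ x e - fderiv ℝ q x e * fderiv ℝ φ x w) := by
  have h_parts : ∀ {a b : Plane} {g : Plane → ℝ}, HasWeakLineDeriv U a v g →
      IntegrableOn (fun x => g x * (q x * fderiv ℝ φ x b)) U ∧
      IntegrableOn (fun x => v x * fderiv ℝ (fun y => q y * fderiv ℝ φ y b) x a) U ∧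
      ∫ x in U, v x * fderiv ℝ (fun y => q y * fderiv ℝ φ y b) x a =
        -∫ x in U, g x * (q x * fderiv ℝ φ x b) := by
    intro a b g h
    have hψ : IsTest fun x => q x * fderiv ℝ φ x b :=
      ⟨hq.mul (hφ.fderiv_apply b).1, (hφ.fderiv_apply b).2.mul_left⟩
    have hψs : tsupport (fun x => q x * fderiv ℝ φ x b) ∩ closure U ⊆ U := fun x hx =>
      hs ⟨⟨tsupport_fderiv_apply_subset ℝ b (tsupport_mul_subset_right hx.1),
        tsupport_mul_subset_left hx.1⟩, hx.2⟩
    exact ⟨integrableOn_mul_of_tsupport_inter_closure hU h.locInt' hψ.1.continuous hψ.2 hψs,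
      integrableOn_mul_of_tsupport_inter_closure hU h.locInt (hψ.fderiv_apply a).1.continuous
        (hψ.fderiv_apply a).2 ((inter_subset_inter_left _
          (tsupport_fderiv_apply_subset ℝ a)).trans hψs),
      h.integral_mul_fderiv hU hψ hψs⟩
  have h_leibniz (x a b : Plane) : fderiv ℝ (fun y => q y * fderiv ℝ φ y b) x a =
      q x * fderiv ℝ (fun y => fderiv ℝ φ y b) x a + fderiv ℝ φ x b * fderiv ℝ q x a := by
    rw [fderiv_fun_mul (hq.differentiable (by simp) x) ((hφ.fderiv_apply b).differentiable x)]
    rfl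
  obtain ⟨hge, hve, h_int_e⟩ := h_parts (b := w) he
  obtain ⟨hgw, hvw, h_int_w⟩ := h_parts (b := e) hw
  calc ∫ x in U, q x * (g_e x * fderiv ℝ φ x w - g_w x * fderiv ℝ φ x e)
    _ = (∫ x in U, g_e x * (q x * fderiv ℝ φ x w)) -
        ∫ x in U, g_w x * (q x * fderiv ℝ φ x e) := by
      rw [← integral_sub hge hgw]
      congr with x
      ring
    _ = (∫ x in U, v x * fderiv ℝ (fun y => q y * fderiv ℝ φ y e) x w) -
        ∫ x in U, v x * fderiv ℝ (fun y => q y * fderiv ℝ φ y w) x e := by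
      rw [h_int_e, h_int_w]
      ring
    _ = _ := by
      rw [← integral_sub hvw hve]
      congr with x
      rw [h_leibniz, h_leibniz, hφ.fderiv_fderiv_comm x e w]
      ring

lemma cross_mul_bracket_eq (a x : Plane) :
    cross e w * (a 1 * pd 0 φ x - a 0 * pd 1 φ x) =
      -(⟪e, a⟫_ℝ * fderiv ℝ φ x w - ⟪w, a⟫_ℝ * fderiv ℝ φ x e) := by
  have h_fderiv (d : Plane) : fderiv ℝ φ x d = d 0 * pd 0 φ x + d 1 * pd 1 φ x := by
    conv_lhs => rw [← eq_linearComb_single d]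
    simp only [map_add, map_smul, smul_eq_mul, pd]
  simp only [h_fderiv, inner_eq_coords, cross]
  ring

lemma HasWeakGrad.cross_mul_integral (hG : HasWeakGrad U v G) (hU : IsOpen U) (e w : Plane)
    (hφ : IsTest φ) (hq : ContDiff ℝ ∞ q) (hs : tsupport φ ∩ tsupport q ∩ closure U ⊆ U) :
    cross e w * ∫ x in U, q x * (G x 1 * pd 0 φ x - G x 0 * pd 1 φ x) =
      ∫ x in U, v x * (fderiv ℝ q x e * fderiv ℝ φ x w - fderiv ℝ q x w * fderiv ℝ φ x e) := by
  have h := (hG.hasWeakLineDeriv hU e).integral_mul_bracket (hG.hasWeakLineDeriv hU w) hU hφ hq hs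
  rw [← integral_const_mul]
  simp only [mul_left_comm (cross e w), cross_mul_bracket_eq, mul_neg, integral_neg, h]
  rw [← integral_neg]
  congr with x
  ring

lemma HasWeakGrad.hasWeakCurl_zero (hG : HasWeakGrad U v G) (hU : IsOpen U)
    (hGi : IntegrableOn G U) : HasWeakCurl U G fun _ => 0 where
  locInt := hGi.locallyIntegrableOn
  locInt' := (integrableOn_zero (μ := volume)).locallyIntegrableOn
  eq φ hφ hs := by
    simpa [cross] using hG.cross_mul_integral hU (EuclideanSpace.single 0 1)
      (EuclideanSpace.single 1 1) hφ (contDiff_const (c := (1 : ℝ)))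
      ((inter_subset_left.trans inter_subset_left).trans hs)

lemma hasFDerivAt_coordT (P e w x : Plane) :
    ∃ L : Plane →L[ℝ] ℝ, HasFDerivAt (coordT P e w) L x ∧ ∀ d, L d = cross e d / cross e w := by
  have hd : DifferentiableAt ℝ (coordT P e w) x := contDiff_coordT.differentiable (by simp) x
  refine ⟨_, hd.hasFDerivAt, fun d => ?_⟩
  rw [← hd.lineDeriv_eq_fderiv]
  refine HasLineDerivAt.lineDeriv ?_
  have h_line : (fun t : ℝ => coordT P e w (x + t • d)) =
      fun t => coordT P e w x + t * (cross e d / cross e w) := by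
    funext t
    simp only [coordT, cross, PiLp.sub_apply, PiLp.add_apply, PiLp.smul_apply, smul_eq_mul]
    ring
  rw [HasLineDerivAt, h_line]
  exact (hasDerivAt_mul_const _).const_add _

lemma fderiv_cutoff_coordT (r : ℝ) (x d : Plane) :
    fderiv ℝ (fun y => cutoff 0 r (coordT P e w y)) x d =
      deriv (cutoff 0 r) (coordT P e w x) * (cross e d / cross e w) := by
  obtain ⟨L, hL, hLd⟩ := hasFDerivAt_coordT P e w x
  have h_cutoff := ((contDiff_cutoff 0 r).differentiable (by simp) (coordT P e w x)).hasDerivAt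
  have h_comp : fderiv ℝ (fun y => cutoff 0 r (coordT P e w y)) x = _ :=
    (h_cutoff.comp_hasFDerivAt x hL).fderiv
  rw [← hLd, h_comp, smul_apply, smul_eq_mul]

lemma tsupport_cutoff_coordT_subset {r : ℝ} (hr : 0 < r) :
    tsupport (fun x => cutoff 0 r (coordT P e w x)) ⊆ {x | 0 < coordT P e w x} := by
  have h_le : tsupport (fun x => cutoff 0 r (coordT P e w x)) ⊆ {x | r ≤ coordT P e w x} := by
    refine closure_minimal (fun x (hx : _ ≠ 0) => ?_)
      (isClosed_le continuous_const contDiff_coordT.continuous)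
    by_contra h
    exact hx (cutoff_of_le hr (by simpa using (not_le.1 (mt mem_ofPred_eq.mpr h)).le))
  exact h_le.trans fun x => hr.trans_le

lemma integral_deriv_cutoff_coordT_mul (hc : cross e w ≠ 0) (hU : IsOpen U)
    (hUs : ∀ p, par P e w p ∈ U → p ∈ Ioo 0 1 ×ˢ Ioo 0 1) (hF : IntegrableOn F U) {r : ℝ}
    (hr : 0 < r) :
    ∫ x in U, deriv (cutoff 0 r) (coordT P e w x) * F x = |cross e w| *
      ∫ t in Ioo 0 1, (∫ s in Ioo 0 1, U.indicator F (par P e w (s, t))) *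
        deriv (cutoff 0 r) t := by
  have hV : MeasurableSet (par P e w ⁻¹' U) := (hU.preimage continuous_par).measurableSet
  have h_cutoff : IntegrableOn (fun x => deriv (cutoff 0 r) (coordT P e w x) * F x) U := by
    obtain ⟨C, hC⟩ := exists_norm_deriv_cutoff_le 0 hr
    exact hF.bdd_mul (c := C) ((continuous_deriv_cutoff 0 r).comp
      contDiff_coordT.continuous).aestronglyMeasurable (ae_of_all _ fun x => hC _)
  have h_ind : (par P e w ⁻¹' U).indicator
      (fun p => deriv (cutoff 0 r) (coordT P e w (par P e w p)) * F (par P e w p)) =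
      fun p => U.indicator F (par P e w p) * deriv (cutoff 0 r) p.2 := by
    funext p
    by_cases hp : par P e w p ∈ U
    · rw [indicator_of_mem hp, indicator_of_mem (mem_preimage.2 hp), coordT_par hc, mul_comm]
    · rw [indicator_of_notMem hp, indicator_of_notMem (mt mem_preimage.1 hp), zero_mul]
  have h_int : Integrable fun p : ℝ × ℝ =>
      U.indicator F (par P e w p) * deriv (cutoff 0 r) p.2 := by
    rw [← h_ind, integrable_indicator_iff hV]
    exact (integrableOn_comp_par_iff hc).2 h_cutoff
  have h_box : ∀ p ∉ Ioo (0 : ℝ) 1 ×ˢ Ioo (0 : ℝ) 1,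
      U.indicator F (par P e w p) * deriv (cutoff 0 r) p.2 = 0 := fun p hp => by
    rw [indicator_of_notMem fun h => hp (hUs p h), zero_mul]
  rw [setIntegral_eq_setIntegral_par hc, ← integral_indicator hV, h_ind,
    ← setIntegral_eq_integral_of_forall_compl_eq_zero h_box, Measure.volume_eq_prod,
    ← Measure.prod_restrict, integral_prod_symm]
  · simp only [integral_mul_const]
  · rw [Measure.prod_restrict]
    exact h_int.integrableOn

lemma integrableOn_integral_slice (hc : cross e w ≠ 0) (hU : IsOpen U) (hF : IntegrableOn F U) :
    IntegrableOn (fun t => ∫ s in Ioo 0 1, U.indicator F (par P e w (s, t))) (Ioo 0 1) := by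
  have h_int : Integrable fun p => U.indicator F (par P e w p) := by
    have h := (integrableOn_comp_par_iff (P := P) hc).2 hF
    rwa [← integrable_indicator_iff (hU.preimage continuous_par).measurableSet] at h
  have h_box : Integrable (fun p => U.indicator F (par P e w p))
      ((volume.restrict (Ioo 0 1)).prod (volume.restrict (Ioo 0 1))) := by
    rw [Measure.prod_restrict]
    exact h_int.integrableOn
  exact h_box.integral_prod_right

lemma tendsto_indicator_par (hUK : U ⊆ K) (hF : ContinuousOn F K) {s : ℝ}
    (hsK : par P e w (s, 0) ∈ K)
    (h_lim : F =ᶠ[𝓝 (par P e w (s, 0))] 0 ∨ ∀ᶠ t in 𝓝[>] (0 : ℝ), par P e w (s, t) ∈ U) :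
    Tendsto (fun t => U.indicator F (par P e w (s, t))) (𝓝[>] 0) (𝓝 (F (par P e w (s, 0)))) := by
  have h_par : Tendsto (fun t => par P e w (s, t)) (𝓝[>] 0) (𝓝 (par P e w (s, 0))) :=
    tendsto_nhdsWithin_of_tendsto_nhds (Continuous.tendsto (by fun_prop) 0)
  rcases h_lim with h_zero | h_mem
  · rw [h_zero.self_of_nhds]
    refine tendsto_const_nhds.congr' ?_
    filter_upwards [h_par.eventually h_zero] with t ht
    simp only [indicator, ht, Pi.zero_apply, ite_self]
  · have h_parK := tendsto_nhdsWithin_iff.2 ⟨h_par, h_mem.mono fun t ht => hUK ht⟩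
    refine ((hF _ hsK).tendsto.comp h_parK).congr' ?_
    filter_upwards [h_mem] with t ht
    rw [indicator_of_mem ht, Function.comp_apply]

lemma tendsto_integral_slice (hU : IsOpen U) (hK : IsCompact K) (hUK : U ⊆ K)
    (hF : ContinuousOn F K) (hsK : ∀ s ∈ Ioo (0 : ℝ) 1, par P e w (s, 0) ∈ K)
    (h_lim : ∀ s ∈ Ioo (0 : ℝ) 1, F =ᶠ[𝓝 (par P e w (s, 0))] 0 ∨
      ∀ᶠ t in 𝓝[>] (0 : ℝ), par P e w (s, t) ∈ U) :
    Tendsto (fun t => ∫ s in Ioo 0 1, U.indicator F (par P e w (s, t))) (𝓝[>] 0)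
      (𝓝 (∫ s in Ioo 0 1, F (par P e w (s, 0)))) := by
  obtain ⟨C, hC⟩ := hK.exists_bound_of_continuousOn hF
  have h_meas : Measurable (U.indicator F) := by
    classical
    rw [← piecewise_eq_indicator]
    exact (hF.mono hUK).measurable_piecewise continuousOn_const hU.measurableSet
  refine tendsto_integral_filter_of_dominated_convergence (fun _ => max C 0)
    (.of_forall fun t => ?_) (.of_forall fun t => ae_of_all _ fun s => ?_)
    (integrableOn_const (by simp)) ?_
  · exact (h_meas.comp (Continuous.measurable (by fun_prop))).aestronglyMeasurable
  · by_cases h : par P e w (s, t) ∈ U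
    · rw [indicator_of_mem h]
      exact (hC _ (hUK h)).trans (le_max_left _ _)
    · rw [indicator_of_notMem h, norm_zero]
      exact le_max_right _ _
  · filter_upwards [ae_restrict_mem measurableSet_Ioo] with s hs
    exact tendsto_indicator_par hUK hF (hsK s hs) (h_lim s hs)

lemma tendsto_integral_cutoff_mul (hU : IsOpen U) (hUt : ∀ x ∈ U, 0 < coordT P e w x)
    (hF : IntegrableOn F U) :
    Tendsto (fun r => ∫ x in U, cutoff 0 r (coordT P e w x) * F x) (𝓝[>] 0)
      (𝓝 (∫ x in U, F x)) := by
  refine tendsto_integral_filter_of_dominated_convergence (fun x => ‖F x‖)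
    (.of_forall fun r => ?_) (.of_forall fun r => ae_of_all _ fun x => ?_) hF.norm ?_
  · exact ((contDiff_cutoff 0 r).continuous.comp
      contDiff_coordT.continuous).aestronglyMeasurable.mul hF.aestronglyMeasurable
  · obtain ⟨h_nonneg, h_le⟩ := cutoff_mem_Icc 0 r (coordT P e w x)
    rw [norm_mul, Real.norm_of_nonneg h_nonneg]
    exact mul_le_of_le_one_left (norm_nonneg _) h_le
  · filter_upwards [ae_restrict_mem hU.measurableSet] with x hx
    simpa only [one_mul] using (tendsto_cutoff (hUt x hx)).mul_const (F x)

lemma integral_side_mul_fderiv (hac : AbsolutelyContinuousOnInterval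
      (fun s => v (par P e w (s, 0))) 0 1) (hφ : IsTest φ)
    (hφ₀ : φ (par P e w (0, 0)) = 0) (hφ₁ : φ (par P e w (1, 0)) = 0) :
    ∫ s in Ioo 0 1, v (par P e w (s, 0)) * fderiv ℝ φ (par P e w (s, 0)) e =
      -∫ s in (0 : ℝ)..1, deriv (fun s => v (par P e w (s, 0))) s * φ (par P e w (s, 0)) := by
  have h_deriv (s : ℝ) : HasDerivAt (fun s => φ (par P e w (s, 0)))
      (fderiv ℝ φ (par P e w (s, 0)) e) s := by
    refine (hφ.differentiable _).hasFDerivAt.comp_hasDerivAt s ?_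
    simpa [par] using ((hasDerivAt_id s).smul_const e).const_add P
  have hφ_ac : AbsolutelyContinuousOnInterval (fun s => φ (par P e w (s, 0))) 0 1 :=
    (ContDiff.contDiffOn (n := 1) ((hφ.1.of_le (by simp)).comp
      (by unfold par; fun_prop))).absolutelyContinuousOnInterval
  have h_parts := hac.integral_mul_deriv_eq_deriv_mul hφ_ac
  simp only [hφ₀, hφ₁, mul_zero, sub_zero, zero_sub, (h_deriv _).deriv] at h_parts
  rw [← integral_Ioc_eq_integral_Ioo, ← intervalIntegral.integral_of_le zero_le_one, h_parts]

lemma HasWeakGrad.integral_cutoff_mul (hG : HasWeakGrad U v G) (hU : IsOpen U)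
    (hc : cross e w ≠ 0) (hφ : IsTest φ)
    (hs : ∀ x ∈ tsupport φ ∩ closure U, 0 < coordT P e w x → x ∈ U) {r : ℝ} (hr : 0 < r) :
    ∫ x in U, cutoff 0 r (coordT P e w x) * (G x 1 * pd 0 φ x - G x 0 * pd 1 φ x) =
      -((cross e w)⁻¹ * ∫ x in U, deriv (cutoff 0 r) (coordT P e w x) *
        (v x * fderiv ℝ φ x e)) := by
  have h := hG.cross_mul_integral hU e w hφ ((contDiff_cutoff 0 r).comp contDiff_coordT)
    fun x hx => hs x ⟨hx.1.1, hx.2⟩ (tsupport_cutoff_coordT_subset (P := P) hr hx.1.2)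
  have h_ee : cross e e = 0 := by rw [cross]; ring
  simp only [Function.comp_def, fderiv_cutoff_coordT, h_ee, zero_div, mul_zero, zero_mul,
    zero_sub, div_self hc, mul_one, mul_neg, integral_neg, mul_left_comm (v _)] at h
  rw [eq_neg_iff_add_eq_zero, ← mul_right_inj' hc, mul_add, mul_inv_cancel_left₀ hc, h, mul_zero,
    neg_add_cancel]

lemma inv_mul_abs_eq_sign {c : ℝ} (hc : c ≠ 0) : c⁻¹ * |c| = Real.sign c := by
  rcases hc.lt_or_gt with h | h
  · rw [abs_of_neg h, Real.sign_of_neg h, mul_neg, inv_mul_cancel₀ hc]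
  · rw [abs_of_pos h, Real.sign_of_pos h, inv_mul_cancel₀ hc]

/-- Testing against `φ` cut off at distance `r` from the side and letting `r → 0` turns the weak
formulation into an integral over the side. -/
theorem HasWeakGrad.integral_eq_boundary (hG : HasWeakGrad U v G) (hU : IsOpen U)
    (hK : IsCompact K) (hUK : U ⊆ K) (hc : cross e w ≠ 0)
    (hUs : ∀ p, par P e w p ∈ U → p ∈ Ioo 0 1 ×ˢ Ioo 0 1)
    (hsK : ∀ s ∈ Ioo (0 : ℝ) 1, par P e w (s, 0) ∈ K) (hv : ContinuousOn v K)
    (hGi : IntegrableOn G U)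
    (hac : AbsolutelyContinuousOnInterval (fun s => v (par P e w (s, 0))) 0 1)
    (hφ : IsTest φ) (hφ₀ : φ (par P e w (0, 0)) = 0) (hφ₁ : φ (par P e w (1, 0)) = 0)
    (hs : ∀ x ∈ tsupport φ ∩ closure U, 0 < coordT P e w x → x ∈ U)
    (h_lim : ∀ s ∈ Ioo (0 : ℝ) 1, par P e w (s, 0) ∈ tsupport φ →
      ∀ᶠ t in 𝓝[>] (0 : ℝ), par P e w (s, t) ∈ U) :
    ∫ x in U, (G x 1 * pd 0 φ x - G x 0 * pd 1 φ x) = Real.sign (cross e w) *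
      ∫ s in (0 : ℝ)..1, deriv (fun s => v (par P e w (s, 0))) s * φ (par P e w (s, 0)) := by
  have hF_cont : ContinuousOn (fun x => v x * fderiv ℝ φ x e) K :=
    hv.mul (hφ.fderiv_apply e).1.continuous.continuousOn
  have hF : IntegrableOn (fun x => v x * fderiv ℝ φ x e) U :=
    (hF_cont.integrableOn_compact hK).mono_set hUK
  have hGφ (i j : Fin 2) : IntegrableOn (fun x => G x i * pd j φ x) U := by
    have hφj := hφ.fderiv_apply (EuclideanSpace.single j 1)
    obtain ⟨C, hC⟩ := hφj.2.exists_bound_of_continuous hφj.1.continuous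
    exact ((EuclideanSpace.proj i : Plane →L[ℝ] ℝ).integrable_comp hGi).mul_bdd
      hφj.1.continuous.aestronglyMeasurable (ae_of_all _ hC)
  have h_left := tendsto_integral_cutoff_mul hU (fun x hx => (hUs (coordS P e w x, coordT P e w x)
    (by rwa [par_coord hc])).2.1) ((hGφ 1 0).sub (hGφ 0 1))
  have h_slice := tendsto_integral_slice hU hK hUK hF_cont hsK fun s hs => by
    by_cases h : par P e w (s, 0) ∈ tsupport φ
    · exact .inr (h_lim s hs h)
    · refine .inl ?_
      filter_upwards [(notMem_tsupport_iff_eventuallyEq.1 h).fderiv (𝕜 := ℝ)] with x hx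
      simp [hx]
  have h_right := (tendsto_setIntegral_mul_deriv_cutoff zero_lt_one
    (integrableOn_integral_slice hc hU hF) h_slice).const_mul (-Real.sign (cross e w))
  rw [integral_side_mul_fderiv hac hφ hφ₀ hφ₁, neg_mul_neg] at h_right
  refine tendsto_nhds_unique h_left (h_right.congr' ?_)
  filter_upwards [self_mem_nhdsWithin] with r hr
  rw [Pi.sub_def, hG.integral_cutoff_mul hU hc hφ hs hr,
    integral_deriv_cutoff_coordT_mul hc hU hUs hF hr, ← mul_assoc, inv_mul_abs_eq_sign hc, neg_mul]

end Green

/-! ### Tangential traces of gradients on mesh edges -/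

lemma par_fst_zero (P Q w : Plane) (s : ℝ) :
    par P (Q - P) w (s, 0) = AffineMap.lineMap P Q s := by
  rw [AffineMap.lineMap_apply_module', par, zero_smul, add_zero, add_comm]

namespace Mesh

variable {ι : Type*} (M : Mesh ι)

lemma isCompact_tri (i : ι) : IsCompact (M.tri i) :=
  (finite_range _).isCompact_convexHull (𝕜 := ℝ)

lemma tri_subset_closure_domain (i : ι) : M.tri i ⊆ closure M.domain :=
  calc M.tri i ⊆ closure (M.tri i) := subset_closure
    _ = closure (interior (M.tri i)) :=
      ((convex_convexHull ℝ _).closure_interior_eq_closure_of_nonempty_interior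
        (M.interior_tri_nonempty i)).symm
    _ ⊆ closure M.domain := closure_mono (M.interior_tri_subset_domain i)

/-- The oblique coordinates whose first axis runs along the `k`-th edge of the `i`-th triangle, and
whose second axis runs along another edge; the triangle becomes the standard one. -/
abbrev edgePar (i : ι) (k : Fin 3) : ℝ × ℝ → Plane :=
  par (M.A i (k + 1)) (M.A i (k + 2) - M.A i (k + 1)) (M.A i k - M.A i (k + 1))

lemma edgePar_fst_zero (i : ι) (k : Fin 3) (s : ℝ) :
    M.edgePar i k (s, 0) = AffineMap.lineMap (M.A i (k + 1)) (M.A i (k + 2)) s :=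
  par_fst_zero _ _ _ s

lemma vertex_succ_ne (i : ι) (k : Fin 3) : M.A i (k + 1) ≠ M.A i (k + 2) :=
  (M.affineIndep i).injective.ne (by rw [Ne, add_right_inj]; decide)

lemma cross_edgePar_ne_zero (i : ι) (k : Fin 3) :
    cross (M.A i (k + 2) - M.A i (k + 1)) (M.A i k - M.A i (k + 1)) ≠ 0 :=
  cross_edges_ne_zero (M.basis i) k

variable {M} in
lemma coord_edgePar (i : ι) (k : Fin 3) (p : ℝ × ℝ) :
    (M.basis i).coord k (M.edgePar i k p) = p.2 ∧
      (M.basis i).coord (k + 1) (M.edgePar i k p) = 1 - p.1 - p.2 ∧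
      (M.basis i).coord (k + 2) (M.edgePar i k p) = p.1 := by
  have h_vertex (j l : Fin 3) : (M.basis i).coord j (M.A i l) = if j = l then 1 else 0 := by
    simpa only [M.coe_basis] using (M.basis i).coord_apply j l
  simp only [edgePar, par, affineMap_vertex_add, h_vertex]
  fin_cases k <;> norm_num [Fin.ext_iff] <;> ring

lemma edgePar_surjective (i : ι) (k : Fin 3) : Function.Surjective (M.edgePar i k) := fun x =>
  ⟨_, par_coord (M.cross_edgePar_ne_zero i k) x⟩

lemma coord_eq_coordT (i : ι) (k : Fin 3) (x : Plane) :
    (M.basis i).coord k x =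
      coordT (M.A i (k + 1)) (M.A i (k + 2) - M.A i (k + 1)) (M.A i k - M.A i (k + 1)) x := by
  obtain ⟨p, rfl⟩ := M.edgePar_surjective i k x
  rw [(M.coord_edgePar i k p).1, coordT_par (M.cross_edgePar_ne_zero i k)]

variable {M} in
lemma mem_edge_of_coord_eq_zero {i : ι} {k : Fin 3} {x : Plane} (hx : x ∈ M.tri i)
    (h₀ : (M.basis i).coord k x = 0) : x ∈ M.edge i k := by
  obtain ⟨⟨s, t⟩, rfl⟩ := M.edgePar_surjective i k x
  obtain ⟨h_k, h_k₁, h_k₂⟩ := M.coord_edgePar i k (s, t)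
  obtain rfl : t = 0 := h_k.symm.trans h₀
  have hs₀ := (M.mem_tri_iff.1 hx (k + 2)).trans_eq h_k₂
  have hs₁ := (M.mem_tri_iff.1 hx (k + 1)).trans_eq h_k₁
  rw [edgePar_fst_zero, edge, segment_eq_image_lineMap]
  exact mem_image_of_mem _ ⟨hs₀, by linarith⟩

lemma edgePar_mem_interior_tri_iff (i : ι) (k : Fin 3) (p : ℝ × ℝ) :
    M.edgePar i k p ∈ interior (M.tri i) ↔ 0 < p.1 ∧ 0 < p.2 ∧ p.1 + p.2 < 1 := by
  obtain ⟨h_k, h_k₁, h_k₂⟩ := M.coord_edgePar i k p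
  refine M.mem_interior_tri_iff.trans ⟨fun h => ?_, fun ⟨h_fst, h_snd, h_sum⟩ j => ?_⟩
  · have h_pos := (h (k + 1)).trans_eq h_k₁
    exact ⟨(h (k + 2)).trans_eq h_k₂, (h k).trans_eq h_k, by linarith⟩
  · rcases fin_three_eq_or j k with rfl | rfl | rfl
    · rwa [h_k]
    · rw [h_k₁]; linarith [h_sum]
    · rwa [h_k₂]

variable {M} in
lemma lineMap_notMem_edge {i : ι} {k : Fin 3} {s : ℝ} (hs : s ∈ Ioo (0 : ℝ) 1) :
    AffineMap.lineMap (M.A i (k + 1)) (M.A i (k + 2)) s ∉ M.edge i (k + 1) ∪ M.edge i (k + 2) := by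
  obtain ⟨-, h_k₁, h_k₂⟩ := M.coord_edgePar i k (s, 0)
  rw [← edgePar_fst_zero]
  rintro (h | h)
  · have := h_k₁.symm.trans (M.coord_eq_zero_of_mem_edge h)
    linarith [hs.2]
  · exact hs.1.ne' (h_k₂.symm.trans (M.coord_eq_zero_of_mem_edge h))

end Mesh

namespace Interface

variable {ι : Type*} {M : Mesh ι} (S : Interface M)

lemma isOpen_interior_diff (i : ι) : IsOpen (interior (M.tri i) \ S.curve) :=
  isOpen_interior.sdiff S.isClosed_curve

lemma interior_diff_subset (i : ι) : interior (M.tri i) \ S.curve ⊆ S.Ωm ∪ S.Ωp := by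
  rw [S.union]
  exact sdiff_subset_sdiff_left (M.interior_tri_subset_domain i)

end Interface

lemma HasWeakGrad.mono {U V : Set Plane} {v : Plane → ℝ} {G : Plane → Plane}
    (hG : HasWeakGrad U v G) (hVU : V ⊆ U) : HasWeakGrad V v G := fun j =>
  hasWeakPartial_iff.2 ((hasWeakPartial_iff.1 (hG j)).mono hVU)

lemma HasWeakGrad.ae_eq {U : Set Plane} {v : Plane → ℝ} {G₁ G₂ : Plane → Plane}
    (h₁ : HasWeakGrad U v G₁) (h₂ : HasWeakGrad U v G₂) (hU : IsOpen U) :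
    ∀ᵐ x, x ∈ U → G₁ x = G₂ x := by
  filter_upwards [(hasWeakPartial_iff.1 (h₁ 0)).ae_eq (hasWeakPartial_iff.1 (h₂ 0)) hU,
    (hasWeakPartial_iff.1 (h₁ 1)).ae_eq (hasWeakPartial_iff.1 (h₂ 1)) hU] with x h₀ h₁ hx
  exact plane_ext (h₀ hx) (h₁ hx)

lemma MemH2.integrableOn_grad {U V : Set Plane} {v : Plane → ℝ} {G : Plane → Plane}
    (hv : MemH2 U v) (hU : IsOpen U) (hG : HasWeakGrad U v G) (hVU : V ⊆ U)
    (hV : volume V ≠ ⊤) : IntegrableOn G V := by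
  obtain ⟨G', hG'_mem, hG'⟩ := hv.exists_hasWeakGrad
  have : IsFiniteMeasure (volume.restrict V) := isFiniteMeasure_restrict.2 hV
  have hG'_int : IntegrableOn G' V :=
    (hG'_mem.mono_measure (Measure.restrict_mono hVU le_rfl)).integrable one_le_two
  refine hG'_int.congr_fun_ae (ae_mono (Measure.restrict_mono hVU le_rfl) ?_)
  exact (ae_restrict_iff' hU.measurableSet).2 (hG'.ae_eq hG hU)

namespace Interface

variable {ι : Type*} {M : Mesh ι} {S : Interface M} {v : Plane → ℝ} {G : Plane → Plane}

lemma integrableOn_grad (hvm : MemH2 S.Ωm v) (hvp : MemH2 S.Ωp v)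
    (hG : HasWeakGrad (S.Ωm ∪ S.Ωp) v G) (i : ι) :
    IntegrableOn G (interior (M.tri i) \ S.curve) := by
  have h_fin {W : Set Plane} : volume ((interior (M.tri i) \ S.curve) ∩ W) ≠ ⊤ :=
    ((measure_mono (inter_subset_left.trans (sdiff_subset.trans interior_subset))).trans_lt
      (M.isCompact_tri i).measure_lt_top).ne
  rw [← inter_eq_self_of_subset_left (S.interior_diff_subset i), inter_union_distrib_left]
  have h_m := hvm.integrableOn_grad S.isOpen_m (hG.mono subset_union_left) inter_subset_right h_fin
  have h_p := hvp.integrableOn_grad S.isOpen_p (hG.mono subset_union_right) inter_subset_right h_fin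
  exact h_m.union h_p

/-- The part of the boundary of `T ∖ Γ` other than the relative interior of the `k`-th edge: the
test functions in the definition of the tangential trace vanish near it. -/
def traceBarrier (S : Interface M) (i : ι) (k : Fin 3) : Set Plane :=
  M.edge i (k + 1) ∪ M.edge i (k + 2) ∪ closure (S.curve ∩ interior (M.tri i))

lemma mem_interior_diff_of_coord_pos {i : ι} {k : Fin 3} {x : Plane}
    (hx : x ∈ closure (interior (M.tri i) \ S.curve)) (hxF : x ∉ S.traceBarrier i k)
    (h_pos : 0 < (M.basis i).coord k x) :
    x ∈ interior (M.tri i) \ S.curve := by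
  have hx_tri : x ∈ M.tri i :=
    closure_minimal (sdiff_subset.trans interior_subset) (M.isCompact_tri i).isClosed hx
  have hx_int : x ∈ interior (M.tri i) := M.mem_interior_tri_iff.2 fun j => by
    refine (M.mem_tri_iff.1 hx_tri j).lt_of_ne' fun h₀ => ?_
    rcases fin_three_eq_or j k with rfl | rfl | rfl
    · exact h_pos.ne' h₀
    · exact hxF (Or.inl (Or.inl (M.mem_edge_of_coord_eq_zero hx_tri h₀)))
    · exact hxF (Or.inl (Or.inr (M.mem_edge_of_coord_eq_zero hx_tri h₀)))
  exact ⟨hx_int, fun hxΓ => hxF (Or.inr (subset_closure ⟨hxΓ, hx_int⟩))⟩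

lemma eventually_edgePar_mem {i : ι} {k : Fin 3} {s : ℝ} (hs : s ∈ Ioo (0 : ℝ) 1)
    (hsF : M.edgePar i k (s, 0) ∉ S.traceBarrier i k) :
    ∀ᶠ t in 𝓝[>] (0 : ℝ), M.edgePar i k (s, t) ∈ interior (M.tri i) \ S.curve := by
  have h_cont : Continuous fun t => M.edgePar i k (s, t) := continuous_par.comp (by fun_prop)
  have h_off : ∀ᶠ t in 𝓝[>] (0 : ℝ),
      M.edgePar i k (s, t) ∉ closure (S.curve ∩ interior (M.tri i)) :=
    nhdsWithin_le_nhds (h_cont.continuousAt.eventually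
      (isClosed_closure.isOpen_compl.mem_nhds fun h => hsF (Or.inr h)))
  filter_upwards [h_off, Ioo_mem_nhdsGT (sub_pos.2 hs.2)] with t ht_off ht
  have h_int : M.edgePar i k (s, t) ∈ interior (M.tri i) :=
    (M.edgePar_mem_interior_tri_iff i k _).2 ⟨hs.1, ht.1, by linarith [ht.2]⟩
  exact ⟨h_int, fun hΓ => ht_off (subset_closure ⟨hΓ, h_int⟩)⟩

lemma integral_grad_eq_boundary (hv : ContinuousOn v (closure M.domain)) (hvm : MemH2 S.Ωm v)
    (hvp : MemH2 S.Ωp v) (hG : HasWeakGrad (S.Ωm ∪ S.Ωp) v G) {i : ι} {k : Fin 3}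
    {φ : Plane → ℝ} (hφ : IsTest φ) (hφF : Disjoint (tsupport φ) (S.traceBarrier i k)) :
    ∫ x in interior (M.tri i) \ S.curve, (G x 1 * pd 0 φ x - G x 0 * pd 1 φ x) =
      Real.sign (cross (M.A i (k + 2) - M.A i (k + 1)) (M.A i k - M.A i (k + 1))) *
        ∫ s in (0 : ℝ)..1,
          deriv (fun s => v (AffineMap.lineMap (M.A i (k + 1)) (M.A i (k + 2)) s)) s *
            φ (AffineMap.lineMap (M.A i (k + 1)) (M.A i (k + 2)) s) := by
  have h_ac := S.absolutelyContinuous_edge hv hvm hvp i k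
  have hφ_zero {x : Plane} (hx : x ∈ M.edge i (k + 1) ∪ M.edge i (k + 2)) : φ x = 0 :=
    image_eq_zero_of_notMem_tsupport fun h => disjoint_left.1 hφF h (Or.inl hx)
  simp only [← M.edgePar_fst_zero] at h_ac ⊢
  refine (hG.mono (S.interior_diff_subset i)).integral_eq_boundary (S.isOpen_interior_diff i)
    (M.isCompact_tri i) (sdiff_subset.trans interior_subset) (M.cross_edgePar_ne_zero i k)
    (fun p hp => ?_) (fun s hs => ?_) (hv.mono (M.tri_subset_closure_domain i))
    (integrableOn_grad hvm hvp hG i) h_ac hφ ?_ ?_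
    (fun x hx hx_pos => mem_interior_diff_of_coord_pos hx.2 (disjoint_left.1 hφF hx.1)
      (hx_pos.trans_eq (M.coord_eq_coordT i k x).symm))
    fun s hs hsφ => eventually_edgePar_mem hs (disjoint_left.1 hφF hsφ)
  · obtain ⟨h₁, h₂, h₃⟩ := (M.edgePar_mem_interior_tri_iff i k p).1 hp.1
    exact ⟨⟨h₁, by linarith⟩, ⟨h₂, by linarith⟩⟩
  · refine M.edge_subset_tri i k ?_
    rw [par_fst_zero, Mesh.edge, segment_eq_image_lineMap]
    exact mem_image_of_mem _ (Ioo_subset_Icc_self hs)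
  · rw [par_fst_zero, AffineMap.lineMap_apply_zero]
    refine hφ_zero (Or.inr ?_)
    rw [Mesh.edge, (fin_three_add k).2.2.2]
    exact right_mem_segment ℝ _ _
  · rw [par_fst_zero, AffineMap.lineMap_apply_one]
    refine hφ_zero (Or.inl ?_)
    rw [Mesh.edge, (fin_three_add k).1]
    exact left_mem_segment ℝ _ _

theorem hasEdgeIntegral (hv : ContinuousOn v (closure M.domain)) (hvm : MemH2 S.Ωm v)
    (hvp : MemH2 S.Ωp v) (hG : HasWeakGrad (S.Ωm ∪ S.Ωp) v G) (i : ι) (k : Fin 3) :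
    S.HasEdgeIntegral i k G (v (M.A i (k + 2)) - v (M.A i (k + 1))) := by
  have h_ac := S.absolutelyContinuous_edge hv hvm hvp i k
  have hGi := integrableOn_grad hvm hvp hG i
  refine ⟨deriv fun s => v (AffineMap.lineMap (M.A i (k + 1)) (M.A i (k + 2)) s),
    ⟨h_ac.intervalIntegrable_deriv, hGi, fun _ => 0, integrableOn_zero,
      (hG.mono (S.interior_diff_subset i)).hasWeakCurl_zero (S.isOpen_interior_diff i) hGi,
      fun φ hφ hφF => ?_⟩, ?_⟩
  · simp only [zero_mul, zero_add]
    exact integral_grad_eq_boundary hv hvm hvp hG hφ hφF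
  · rw [h_ac.integral_deriv_eq_sub, AffineMap.lineMap_apply_zero, AffineMap.lineMap_apply_one]

end Interface

/-! ### Uniqueness of tangential traces -/

lemma exists_isTest_eq_one {K F : Set Plane} (hK : IsCompact K) (hF : IsClosed F)
    (hKF : Disjoint K F) :
    ∃ ρ, IsTest ρ ∧ Disjoint (tsupport ρ) F ∧ ∀ x ∈ K, ρ x = 1 := by
  obtain ⟨L, hL, hKL, hLF⟩ :=
    exists_compact_between hK hF.isOpen_compl (subset_compl_iff_disjoint_right.2 hKF)
  obtain ⟨ρ, hρ₀, hρ₁, -⟩ := exists_contMDiffMap_zero_one_of_isClosed (n := ⊤)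
    (modelWithCornersSelf ℝ Plane) (isOpen_interior (s := L)).isClosed_compl hK.isClosed
    (disjoint_compl_left_iff_subset.2 hKL)
  have hρ_supp : tsupport ρ ⊆ L := closure_minimal
    (fun x hx => by_contra fun hxL => hx (hρ₀ fun h => hxL (interior_subset h))) hL.isClosed
  exact ⟨ρ, ⟨ρ.contMDiff.contDiff, hL.of_isClosed_subset (isClosed_tsupport _) hρ_supp⟩,
    disjoint_left.2 fun x hx => hLF (hρ_supp hx), fun x hx => hρ₁ hx⟩

lemma exists_isTest_comp_lineMap_eq {P Q : Plane} (hPQ : P ≠ Q) {F : Set Plane} (hF : IsClosed F)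
    {g : ℝ → ℝ} (hg : ContDiff ℝ ∞ g) (hgc : HasCompactSupport g)
    (hgF : ∀ s ∈ tsupport g, AffineMap.lineMap P Q s ∉ F) :
    ∃ φ, IsTest φ ∧ Disjoint (tsupport φ) F ∧ ∀ s, φ (AffineMap.lineMap P Q s) = g s := by
  obtain ⟨ρ, hρ, hρF, hρ_one⟩ := exists_isTest_eq_one
    (hgc.isCompact.image AffineMap.lineMap_continuous) hF
    (disjoint_left.2 (forall_mem_image.2 hgF))
  let σ : Plane → ℝ := fun x => ⟪Q - P, x - P⟫_ℝ / ‖Q - P‖ ^ 2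
  have hσ (s : ℝ) : σ (AffineMap.lineMap P Q s) = s := by
    have h_norm : ‖Q - P‖ ≠ 0 := norm_ne_zero_iff.2 (sub_ne_zero.2 hPQ.symm)
    simp only [σ, AffineMap.lineMap_apply_module', add_sub_cancel_right, inner_smul_right,
      real_inner_self_eq_norm_sq]
    field_simp
  have hσ_smooth : ContDiff ℝ ∞ σ :=
    (contDiff_const.inner ℝ (contDiff_id.sub contDiff_const)).div_const _
  refine ⟨fun x => g (σ x) * ρ x, ⟨(hg.comp hσ_smooth).mul hρ.1, hρ.2.mul_left⟩,
    hρF.mono_left tsupport_mul_subset_right, fun s => ?_⟩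
  simp only [hσ]
  by_cases hs : s ∈ tsupport g
  · rw [hρ_one _ (mem_image_of_mem _ hs), mul_one]
  · rw [image_eq_zero_of_notMem_tsupport hs, zero_mul]

namespace Interface

variable {ι : Type*} {M : Mesh ι} {S : Interface M} {i : ι} {k : Fin 3} {u : Plane → Plane}
  {τ₁ τ₂ : ℝ → ℝ}

lemma isClosed_traceBarrier : IsClosed (S.traceBarrier i k) := by
  have h_edge (l : Fin 3) : IsClosed (M.edge i l) := by
    rw [Mesh.edge, segment_eq_image_lineMap]
    exact (isCompact_Icc.image AffineMap.lineMap_continuous).isClosed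
  exact ((h_edge _).union (h_edge _)).union isClosed_closure

lemma HasEdgeTrace.integral_mul_eq (h₁ : S.HasEdgeTrace i k u τ₁) (h₂ : S.HasEdgeTrace i k u τ₂)
    {φ : Plane → ℝ} (hφ : IsTest φ) (hφF : Disjoint (tsupport φ) (S.traceBarrier i k)) :
    ∫ s in (0 : ℝ)..1, τ₁ s * φ (AffineMap.lineMap (M.A i (k + 1)) (M.A i (k + 2)) s) =
      ∫ s in (0 : ℝ)..1, τ₂ s * φ (AffineMap.lineMap (M.A i (k + 1)) (M.A i (k + 2)) s) := by
  obtain ⟨-, -, c₁, -, hc₁, h_green₁⟩ := h₁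
  obtain ⟨-, -, c₂, -, hc₂, h_green₂⟩ := h₂
  have hU := S.isOpen_interior_diff i
  have h_curl : ∀ᵐ x, x ∈ interior (M.tri i) \ S.curve → c₁ x = c₂ x :=
    ae_eq_of_forall_integral_mul_eq hU hc₁.locInt' hc₂.locInt' fun ψ hψ hψU =>
      neg_injective ((hc₁.eq ψ hψ hψU).symm.trans (hc₂.eq ψ hψ hψU))
  refine mul_left_cancel₀ (Real.sign_eq_zero_iff.not.2 (M.cross_edgePar_ne_zero i k)) ?_
  rw [← h_green₁ φ hφ hφF, ← h_green₂ φ hφ hφF]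
  refine setIntegral_congr_ae hU.measurableSet ?_
  filter_upwards [h_curl] with x hx hxU
  rw [hx hxU]

/-- The parameters of the points on the open `k`-th edge off the closure of `Γ ∩ T`, where test
functions detect the tangential trace. -/
def traceDomain (S : Interface M) (i : ι) (k : Fin 3) : Set ℝ :=
  Ioo 0 1 ∩ AffineMap.lineMap (M.A i (k + 1)) (M.A i (k + 2)) ⁻¹'
    (closure (S.curve ∩ interior (M.tri i)))ᶜ

lemma isOpen_traceDomain : IsOpen (S.traceDomain i k) :=
  isOpen_Ioo.inter (isClosed_closure.isOpen_compl.preimage AffineMap.lineMap_continuous)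

lemma HasEdgeTrace.ae_eq (h₁ : S.HasEdgeTrace i k u τ₁) (h₂ : S.HasEdgeTrace i k u τ₂) :
    ∀ᵐ s, s ∈ S.traceDomain i k → τ₁ s = τ₂ s := by
  have h_int {τ : ℝ → ℝ} (hτ : IntervalIntegrable τ volume 0 1) :
      LocallyIntegrableOn τ (S.traceDomain i k) :=
    (hτ.1.mono_set (inter_subset_left.trans Ioo_subset_Ioc_self)).locallyIntegrableOn
  have h_zero : ∀ᵐ s, s ∈ S.traceDomain i k → (τ₁ - τ₂) s = 0 := by
    refine isOpen_traceDomain.ae_eq_zero_of_integral_contDiff_smul_eq_zero (μ := volume)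
      ((h_int h₁.1).sub (h_int h₂.1)) fun g hg hgc hgV => ?_
    obtain ⟨φ, hφ, hφF, hφg⟩ := exists_isTest_comp_lineMap_eq (F := S.traceBarrier i k)
      (M.vertex_succ_ne i k) isClosed_traceBarrier hg hgc fun s hs h =>
        h.elim (M.lineMap_notMem_edge (hgV hs).1) (hgV hs).2
    have h_eq := h₁.integral_mul_eq h₂ hφ hφF
    have hg_zero : ∀ s ∉ Ioc (0 : ℝ) 1, g s • (τ₁ - τ₂) s = 0 := fun s hs => by
      rw [image_eq_zero_of_notMem_tsupport fun h => hs (Ioo_subset_Ioc_self (hgV h).1), zero_smul]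
    have hg_int {τ : ℝ → ℝ} (hτ : IntervalIntegrable τ volume 0 1) :
        IntervalIntegrable (fun s => τ s * g s) volume 0 1 :=
      hτ.mul_continuousOn hg.continuous.continuousOn
    simp only [hφg] at h_eq
    calc ∫ s, g s • (τ₁ - τ₂) s = ∫ s in (0 : ℝ)..1, g s • (τ₁ - τ₂) s := by
          rw [intervalIntegral.integral_of_le zero_le_one,
            setIntegral_eq_integral_of_forall_compl_eq_zero hg_zero]
      _ = ∫ s in (0 : ℝ)..1, (τ₁ s * g s - τ₂ s * g s) := by
          simp only [Pi.sub_apply, smul_eq_mul, mul_sub, mul_comm]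
      _ = 0 := by
          rw [intervalIntegral.integral_sub (hg_int h₁.1) (hg_int h₂.1), h_eq, sub_self]
  filter_upwards [h_zero] with s hs hsV
  exact sub_eq_zero.1 (hs hsV)

lemma finite_Ioo_diff_traceDomain : (Ioo (0 : ℝ) 1 \ S.traceDomain i k).Finite := by
  have h_inj : Function.Injective (AffineMap.lineMap (k := ℝ) (M.A i (k + 1)) (M.A i (k + 2))) :=
    AffineMap.lineMap_injective ℝ (M.vertex_succ_ne i k)
  refine ((toFinite {S.D i, S.E i}).preimage h_inj.injOn).subset fun s ⟨hs, hsV⟩ => ?_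
  have h_closure : AffineMap.lineMap (M.A i (k + 1)) (M.A i (k + 2)) s ∈
      closure (S.curve ∩ interior (M.tri i)) := by_contra fun h => hsV ⟨hs, h⟩
  have h_edge : AffineMap.lineMap (M.A i (k + 1)) (M.A i (k + 2)) s ∈ M.edge i k := by
    rw [Mesh.edge, segment_eq_image_lineMap]
    exact mem_image_of_mem _ (Ioo_subset_Icc_self hs)
  exact (S.inter i (closure_nonempty_iff.1 ⟨_, h_closure⟩)).subset
    ⟨closure_minimal inter_subset_left S.isClosed_curve h_closure,
      M.edge_subset_frontier i k h_edge⟩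

theorem HasEdgeIntegral.unique {I₁ I₂ : ℝ} (h₁ : S.HasEdgeIntegral i k u I₁)
    (h₂ : S.HasEdgeIntegral i k u I₂) : I₁ = I₂ := by
  obtain ⟨τ₁, hτ₁, rfl⟩ := h₁
  obtain ⟨τ₂, hτ₂, rfl⟩ := h₂
  rw [intervalIntegral.integral_of_le zero_le_one, intervalIntegral.integral_of_le zero_le_one,
    integral_Ioc_eq_integral_Ioo, integral_Ioc_eq_integral_Ioo]
  refine setIntegral_congr_ae measurableSet_Ioo ?_
  filter_upwards [hτ₁.ae_eq hτ₂, compl_mem_ae_iff.2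
    ((finite_Ioo_diff_traceDomain (S := S) (i := i) (k := k)).measure_zero volume)]
    with s h_eq hs_off hs
  exact h_eq (by_contra fun h => hs_off ⟨hs, h⟩)

variable {v : Plane → ℝ} {G : Plane → Plane}

theorem hasEdgeIntegral_iff (hv : ContinuousOn v (closure M.domain)) (hvm : MemH2 S.Ωm v)
    (hvp : MemH2 S.Ωp v) (hG : HasWeakGrad (S.Ωm ∪ S.Ωp) v G) {I : ℝ} :
    S.HasEdgeIntegral i k G I ↔ I = v (M.A i (k + 2)) - v (M.A i (k + 1)) := by
  have h := hasEdgeIntegral hv hvm hvp hG i k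
  exact ⟨fun hI => hI.unique h, fun hI => hI ▸ h⟩

end Interface

end

end IFE

theorem mainTheorem7_general {ι : Type*} (M : IFE.Mesh ι) (S : IFE.Interface M)
    (βm βp μm μp : ℝ) (hβm : 0 < βm) (hβp : 0 < βp) (hμm : 0 < μm) (hμp : 0 < μp)
    (hM : ∀ i, S.IsCut i → M.NonObtuse i)
    (v : IFE.Plane → ℝ) (hv : ContinuousOn v (closure M.domain))
    (hv₀ : ∀ x ∈ frontier M.domain, v x = 0) (hvm : IFE.MemH2 S.Ωm v) (hvp : IFE.MemH2 S.Ωp v)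
    (G : IFE.Plane → IFE.Plane) (hG : IFE.HasWeakGrad (S.Ωm ∪ S.Ωp) v G) :
    (∃! w, S.IsNodalInterp βm βp v w) ∧
    (∃! z, S.IsEdgeInterp βm βp μm μp G z) ∧
    ∀ w z, S.IsNodalInterp βm βp v w → S.IsEdgeInterp βm βp μm μp G z →
      S.MemSZero βm βp w ∧ S.MemINDZero βm βp μm μp z ∧ S.IsBrokenGrad w z :=
  IFE.Interface.commuting_of_hasEdgeIntegral_iff hβm hβp hμm hμp hM hv₀
    fun _ _ _ => IFE.Interface.hasEdgeIntegral_iff hv hvm hvp hG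

theorem mainTheorem7 {ι : Type*} [Finite ι] (M : IFE.Mesh ι) (S : IFE.Interface M)
    (βm βp μm μp : ℝ) (hβm : 0 < βm) (hβp : 0 < βp) (hμm : 0 < μm) (hμp : 0 < μp)
    (hM : ∀ i, S.IsCut i → M.NonObtuse i)
    (v : IFE.Plane → ℝ) (hv : S.MemH2Zero βm βp v)
    (G : IFE.Plane → IFE.Plane) (hG : IFE.HasWeakGrad (S.Ωm ∪ S.Ωp) v G) :
    (∃! w, S.IsNodalInterp βm βp v w) ∧
    (∃! z, S.IsEdgeInterp βm βp μm μp G z) ∧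
    ∀ w z, S.IsNodalInterp βm βp v w → S.IsEdgeInterp βm βp μm μp G z →
      S.MemSZero βm βp w ∧ S.MemINDZero βm βp μm μp z ∧ S.IsBrokenGrad w z :=
  mainTheorem7_general M S βm βp μm μp hβm hβp hμm hμp hM v hv.cont hv.zero hv.memH2_m hv.memH2_p
    G hG
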